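/- Theorem (Fast regime). A branching mechanism is the law of a point process $\mathcal L$ on $\mathbb R$. Its log-Laplace transform is $\kappa(\phi)=\log \mathbb E\big(\sum_{\ell\in\mathcal L}e^{\phi\ell}\big)\in(-\infty,+\infty]$ for $\phi>0$, and its speed is $v=\inf_{\phi>0}\kappa(\phi)/\phi$. Let $\mathcal L,\tilde{\mathcal L}$ be two branching mechanisms, with associated quantities $\kappa,v$ and $\tilde\kappa,\tilde v$. Assume that $\mathcal L$ satisfies the following conditions, and that $\tilde{\mathcal L}$ satisfies the same conditions with $\tilde\kappa,\tilde v,\tilde\theta^*$ in place of $\kappa,v,\theta^*$: 1. $\mathbb P(\mathcal L=\emptyset)=0$ and $\mathbb P(\#\mathcal L=1)<1$; 2. $\mathbb P(\mathcal L\subset r\mathbb Z+s)<1$ for all $r,s\in\mathbb R$; 3. there is $\theta^*>0$, with $\kappa$ finite in a neighbourhood of $\theta^*$, such that $\theta^*\kappa'(\theta^*)-\kappa(\theta^*)=0$; 4. $\mathbb E\big[\sum_{\ell\in\mathcal L}(\ell-v)^2e^{\theta^*\ell-\kappa(\theta^*)}\big]<\infty$; 5. $\mathbb E\big[\big(\sum_{\ell\in\mathcal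 L}(1+|\ell|)e^{\theta^*\ell}\big)^2\big]<\infty$. Let $t\in(0,1)$. For each $n\in\mathbb N$, consider the branching random walk through an interface up to generation $n$: it starts from one particle at $0$ at time $0$; at each time $k<n$ every particle present is replaced by children whose displacements from it form an independent copy of $\mathcal L$ if $k<\lfloor nt\rfloor$, and of $\tilde{\mathcal L}$ if $k\ge\lfloor nt\rfloor$, all these copies being independent. Let $M_n$ be the maximal position of a particle of generation $n$. Suppose that $\theta^*>\tilde\theta^*$. Suppose also that $\theta>0$ satisfies $$\frac{t\kappa(\theta)+(1-t)\tilde\kappa(\theta)}{\theta}=\inf_{\phi>0}\frac{t\kappa(\phi)+(1-t)\tilde\kappa(\phi)}{\phi},$$ and that $\kappa$ and $\tilde\kappa$ are finite in a neighbourhood of $\theta$. Set $a=\kappa'(\theta)$ and $b=\tilde\kappa'(\theta)$. Then $ta+(1-t)b>tv+(1-t)\tilde v$ (the speed is anomalously large), and $$M_n=(ta+(1-t)b)\,n-\frac1{2\theta}\log n+O_{\mathbb P}(1),$$ that is, for every $\varepsilon>0$ there is $A>0$ such that, for all $n\in\mathbb N$, $\mathbb P\big(\big|M_n-(ta+(1-t)b)n+\frac1{2\theta}\log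 n\big|\ge A\big)\le\varepsilon$ (with the convention $\log 0=0$ for $n=0$). -/

import Mathlib

open MeasureTheory ProbabilityTheory Filter Topology

open scoped ENNReal

noncomputable section

namespace BRW

/-- A realisation of a point process on `ℝ`, given by its number of points (possibly infinite)
and an enumeration of them: `(N, ℓ)` stands for the multiset `{ℓ i : i < N}`; the values `ℓ i`
with `i ≥ N` play no role. A branching mechanism is a probability measure on this space. -/
abbrev PointConfig : Type := ℕ∞ × (ℕ → ℝ)

/-- `∑ f ℓ` over the points `ℓ` of the configuration. -/
def PointConfig.sum (c : PointConfig) (f : ℝ → ℝ≥0∞) : ℝ≥0∞ :=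
  ∑' i : ℕ, if (i : ℕ∞) < c.1 then f (c.2 i) else 0

/-- The log-Laplace transform `κ(φ) = log E (∑ exp (φ ℓ))`, with value `+∞` when the expectation
is infinite. -/
def kappa (μ : Measure PointConfig) (φ : ℝ) : EReal :=
  ENNReal.log (∫⁻ c, PointConfig.sum c (fun x => ENNReal.ofReal (Real.exp (φ * x))) ∂μ)

/-- `κ` is finite near `φ` and `κ'(φ) = d`. -/
def HasKappaDerivAt (μ : Measure PointConfig) (d φ : ℝ) : Prop :=
  (∀ᶠ s in 𝓝 φ, kappa μ s < ⊤) ∧ HasDerivAt (fun s => (kappa μ s).toReal) d φ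

/-- The speed `v = inf_{φ > 0} κ(φ) / φ`. -/
def speed (μ : Measure PointConfig) : ℝ :=
  (⨅ φ : Set.Ioi (0 : ℝ), kappa μ φ / ((φ : ℝ) : EReal)).toReal

/-- Almost surely at least one child, and not almost surely exactly one. -/
def Breeding (μ : Measure PointConfig) : Prop :=
  μ {c | c.1 = 0} = 0 ∧ μ {c | c.1 = 1} < 1

/-- The points do not almost surely lie in a common translated lattice `rℤ + s` (the case `r = 0`
is included). -/
def NonLattice (μ : Measure PointConfig) : Prop :=
  ∀ r s : ℝ, μ {c | ∀ i : ℕ, (i : ℕ∞) < c.1 → ∃ k : ℤ, c.2 i = r * k + s} < 1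

/-- `θ > 0` and `θ κ'(θ) - κ(θ) = 0`. -/
def IsCritical (μ : Measure PointConfig) (θ : ℝ) : Prop :=
  0 < θ ∧ ∃ d : ℝ, HasKappaDerivAt μ d θ ∧ θ * d - (kappa μ θ).toReal = 0

/-- `E (∑ (ℓ - v)² exp (θ ℓ - κ(θ))) < ∞`. -/
def FiniteVariance (μ : Measure PointConfig) (θ : ℝ) : Prop :=
  ∫⁻ c, PointConfig.sum c (fun x => ENNReal.ofReal
    ((x - speed μ) ^ 2 * Real.exp (θ * x - (kappa μ θ).toReal))) ∂μ < ⊤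

/-- `E ((∑ (1 + |ℓ|) exp (θ ℓ))²) < ∞`. -/
def SecondOrder (μ : Measure PointConfig) (θ : ℝ) : Prop :=
  ∫⁻ c, (PointConfig.sum c (fun x => ENNReal.ofReal ((1 + |x|) * Real.exp (θ * x)))) ^ 2 ∂μ < ⊤

/-- The standing assumptions on a branching mechanism with critical parameter `θ`. -/
structure Admissible (μ : Measure PointConfig) (θ : ℝ) : Prop where
  breeding : Breeding μ
  nonLattice : NonLattice μ
  critical : IsCritical μ θ
  variance : FiniteVariance μ θ
  secondOrder : SecondOrder μ θ

/-- `(t κ(φ) + (1 - t) κ̃(φ)) / φ`. -/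
def interfaceRate (μ ν : Measure PointConfig) (t φ : ℝ) : EReal :=
  ((t : EReal) * kappa μ φ + ((1 - t : ℝ) : EReal) * kappa ν φ) / (φ : EReal)

/-- Individuals are words of child indices, latest index first: `i :: u` is the `i`-th child of
`u`, and its generation is its length. `c u` is the configuration of displacements of the
children of `u`. `InTree c u` says that the individual `u` exists. -/
def InTree (c : List ℕ → PointConfig) : List ℕ → Prop
  | [] => True
  | i :: u => InTree c u ∧ (i : ℕ∞) < (c u).1

/-- The position `V(u)`. -/
def position (c : List ℕ → PointConfig) : List ℕ → ℝ
  | [] => 0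
  | i :: u => position c u + (c u).2 i

/-- The maximal displacement `M_n`, the supremum of `V(u)` over the individuals of
generation `n` (a maximum when there are finitely many). -/
def maxDisplacement (c : List ℕ → PointConfig) (n : ℕ) : EReal :=
  ⨆ u : {u : List ℕ // u.length = n ∧ InTree c u}, ((position c u : ℝ) : EReal)

/-- The configurations `X u`, `|u| < n`, generate a branching random walk up to generation `n` in
the time-inhomogeneous environment `L`: they are independent and `X u` has law `L |u|`. -/
structure IsBRWtie {Ω : Type*} [MeasurableSpace Ω] (P : Measure Ω)
    (L : ℕ → Measure PointConfig) (n : ℕ) (X : List ℕ → Ω → PointConfig) : Prop where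
  measurable : ∀ u, u.length < n → Measurable (X u)
  law : ∀ u, u.length < n → P.map (X u) = L u.length
  indep : iIndepFun (fun u : {u : List ℕ // u.length < n} => X u) P

/-- Branching random walk through an interface: mechanism `μ` during the first `⌊n t⌋`
generations, then `ν`. -/
def IsBRWi {Ω : Type*} [MeasurableSpace Ω] (P : Measure Ω) (μ ν : Measure PointConfig) (t : ℝ)
    (n : ℕ) (X : List ℕ → Ω → PointConfig) : Prop :=
  IsBRWtie P (fun k => if k < ⌊(n : ℝ) * t⌋₊ then μ else ν) n X

/-- `Y_n = O_P(1)`; an infinite value of `Y_n` counts as large. -/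
def StochBounded {Ω : Type*} [MeasurableSpace Ω] (P : Measure Ω) (Y : ℕ → Ω → EReal) : Prop :=
  ∀ ε : ℝ, 0 < ε → ∃ A : ℝ, 0 < A ∧
    ∀ n, P {ω | ENNReal.ofReal A ≤ (Y n ω).abs} ≤ ENNReal.ofReal ε

end BRW

end

open MeasureTheory ProbabilityTheory Filter Topology

open scoped ENNReal

noncomputable section

namespace BRW

/-! Decomposing at the root turns the law of the maximum into a deterministic recursion, `cdfMax`
(`IsBRWtie.measure_maxDisplacement_le`). All later estimates concern this recursion and its
linearisation `meanMeasure`.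

Parameters. Minimality at `θ` gives the stationarity relation `t(θa - κ(θ)) + (1-t)(θb - κ̃(θ)) =
0`. By strict convexity `θκ'(θ) - κ(θ)` changes sign exactly at the critical parameter, so `θ̃* <
θ*` forces `θ̃* < θ < θ*`, `θa < κ(θ)` and `κ̃(θ) < θb` (`fast_regime_parameters`). The gain in
speed follows because `κ(θ) > vθ` and `κ̃(θ) > ṽθ`.

Upper tail. By the many-to-one formula (`isExpDensity_meanMeasure`) the mean number of particles in
a bounded window at `y`, after `k` and `m` generations of the two phases, is comparable to
`exp(kκ(θ) + mκ̃(θ) - θy)` times the probability that a random walk with tilted steps lies there.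
That probability is `O(n^{-1/2})`, so the mean is of order one at `y = (ta + (1-t)b)n - log n /
(2θ)`. The first moment is enough; no barrier is needed.

Lower tail. At that level a local limit estimate (`exists_local_lower_bound`) bounds the mean below.
To pass from mean to probability, a second moment is replaced by an exponent `1 + q` with small `q >
0` (`mul_meanMeasure_le`): the probability is at least `ε` times the mean minus `ε^{1+q}` times a
correction that records where genealogies split. A split at generation `j` of the first phase is
discounted by `exp(j(κ((1+q)θ) - (1+q)κ(θ)))`, and a split with `r` generations left in the second
phase by `exp(r(κ̃((1-q)θ) - (1-q)κ̃(θ)))`. For small `q` both rates are negative, precisely by the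
two strict inequalities above (`exists_moment_exponent`). The correction is thus bounded, and the
level is exceeded with probability bounded below (`exists_le_one_sub_cdfMax`).

Tightness. Branching during finitely many initial generations gives enough independent trials to
bring the failure probability below any `ε` (`exists_eventually_cdfMax_le`). -/

/-! ### Sums and products over a point configuration -/

theorem measurableSet_lt_card (i : ℕ) : MeasurableSet {c : PointConfig | (i : ℕ∞) < c.1} :=
  measurable_fst (MeasurableSet.of_discrete (s := {n : ℕ∞ | (i : ℕ∞) < n}))

theorem measurable_point (i : ℕ) : Measurable fun c : PointConfig => c.2 i :=
  (measurable_pi_apply i).comp measurable_snd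

theorem measurable_sum_joint {α : Type*} [MeasurableSpace α] {f : α → ℝ → ℝ≥0∞}
    (hf : Measurable (Function.uncurry f)) :
    Measurable fun p : α × PointConfig => p.2.sum (f p.1) := by
  unfold PointConfig.sum
  refine Measurable.tsum fun i => Measurable.ite ?_ ?_ measurable_const
  · exact measurable_snd (measurableSet_lt_card i)
  · exact hf.comp (measurable_fst.prodMk ((measurable_point i).comp measurable_snd))

theorem measurable_sum {f : ℝ → ℝ≥0∞} (hf : Measurable f) :
    Measurable fun c : PointConfig => c.sum f :=
  (measurable_sum_joint (α := Unit) (f := fun _ => f) (hf.comp measurable_snd)).comp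
    (measurable_const.prodMk measurable_id : Measurable fun c : PointConfig => ((), c))

theorem PointConfig.sum_mono (c : PointConfig) {f g : ℝ → ℝ≥0∞} (h : ∀ x, f x ≤ g x) :
    c.sum f ≤ c.sum g :=
  ENNReal.tsum_le_tsum fun i => by split_ifs <;> simp [h]

theorem PointConfig.sum_add (c : PointConfig) (f g : ℝ → ℝ≥0∞) :
    c.sum (fun x => f x + g x) = c.sum f + c.sum g := by
  unfold PointConfig.sum
  rw [← ENNReal.tsum_add]
  exact tsum_congr fun i => by split_ifs <;> simp

theorem PointConfig.sum_const_mul (c : PointConfig) (a : ℝ≥0∞) (f : ℝ → ℝ≥0∞) :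
    c.sum (fun x => a * f x) = a * c.sum f := by
  unfold PointConfig.sum
  rw [← ENNReal.tsum_mul_left]
  exact tsum_congr fun i => by split_ifs <;> simp

/-- The intensity measure of the point process with law `μ`. -/
def intensity (μ : Measure PointConfig) : Measure ℝ :=
  Measure.sum fun i : ℕ => (μ.restrict {c | (i : ℕ∞) < c.1}).map fun c => c.2 i

instance (μ : Measure PointConfig) [SFinite μ] : SFinite (intensity μ) := by
  unfold intensity; infer_instance

theorem lintegral_intensity (μ : Measure PointConfig) {f : ℝ → ℝ≥0∞} (hf : Measurable f) :
    ∫⁻ x, f x ∂(intensity μ) = ∫⁻ c, c.sum f ∂μ := by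
  rw [intensity, lintegral_sum_measure]
  unfold PointConfig.sum
  have h (i : ℕ) : Measurable fun c : PointConfig => if (i : ℕ∞) < c.1 then f (c.2 i) else 0 :=
    Measurable.ite (measurableSet_lt_card i) (hf.comp (measurable_point i)) measurable_const
  rw [lintegral_tsum fun i => (h i).aemeasurable]
  refine tsum_congr fun i => ?_
  rw [lintegral_map hf (measurable_point i), ← lintegral_indicator (measurableSet_lt_card i)]
  exact lintegral_congr fun c => by simp [Set.indicator_apply]

/-- `∏ g ℓ` over the first `k` points of the configuration. -/
def PointConfig.prodLT (c : PointConfig) (g : ℝ → ℝ≥0∞) (k : ℕ) : ℝ≥0∞ :=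
  ∏ i ∈ Finset.range k, if (i : ℕ∞) < c.1 then g (c.2 i) else 1

/-- `∏ g ℓ` over the points of the configuration, for `g ≤ 1`. -/
def PointConfig.prod (c : PointConfig) (g : ℝ → ℝ≥0∞) : ℝ≥0∞ :=
  ⨅ k : ℕ, c.prodLT g k

theorem PointConfig.prod_le_prodLT (c : PointConfig) (g : ℝ → ℝ≥0∞) (k : ℕ) :
    c.prod g ≤ c.prodLT g k := iInf_le _ k

theorem PointConfig.prodLT_mono (c : PointConfig) {f g : ℝ → ℝ≥0∞} (h : ∀ x, f x ≤ g x) (k : ℕ) :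
    c.prodLT f k ≤ c.prodLT g k :=
  Finset.prod_le_prod' fun i _ => by split_ifs <;> simp [h]

theorem PointConfig.prod_mono (c : PointConfig) {f g : ℝ → ℝ≥0∞} (h : ∀ x, f x ≤ g x) :
    c.prod f ≤ c.prod g := iInf_mono fun k => c.prodLT_mono h k

theorem PointConfig.prod_le_one (c : PointConfig) (g : ℝ → ℝ≥0∞) : c.prod g ≤ 1 :=
  (c.prod_le_prodLT g 0).trans (by simp [PointConfig.prodLT])

theorem PointConfig.prodLT_antitone (c : PointConfig) {g : ℝ → ℝ≥0∞} (h : ∀ x, g x ≤ 1) :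
    Antitone (c.prodLT g) := by
  refine antitone_nat_of_succ_le fun k => ?_
  rw [PointConfig.prodLT, Finset.prod_range_succ]
  refine mul_le_of_le_one_right' ?_
  split_ifs <;> simp [h]

theorem measurable_prodLT_joint {α : Type*} [MeasurableSpace α] {f : α → ℝ → ℝ≥0∞}
    (hf : Measurable (Function.uncurry f)) (k : ℕ) :
    Measurable fun p : α × PointConfig => p.2.prodLT (f p.1) k := by
  unfold PointConfig.prodLT
  refine Finset.measurable_prod _ fun i _ => Measurable.ite ?_ ?_ measurable_const
  · exact measurable_snd (measurableSet_lt_card i)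
  · exact hf.comp (measurable_fst.prodMk ((measurable_point i).comp measurable_snd))

theorem measurable_prodLT {f : ℝ → ℝ≥0∞} (hf : Measurable f) (k : ℕ) :
    Measurable fun c : PointConfig => c.prodLT f k :=
  (measurable_prodLT_joint (α := Unit) (f := fun _ => f) (hf.comp measurable_snd) k).comp
    (measurable_const.prodMk measurable_id : Measurable fun c : PointConfig => ((), c))

theorem measurable_prod {f : ℝ → ℝ≥0∞} (hf : Measurable f) :
    Measurable fun c : PointConfig => c.prod f :=
  Measurable.iInf fun k => measurable_prodLT hf k

/-! ### The recursion for the maximum and the first moment bound -/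

/-- The distribution function of the maximal displacement of a branching random walk whose
successive generations reproduce according to the mechanisms in the list. -/
def cdfMax : List (Measure PointConfig) → ℝ → ℝ≥0∞
  | [], y => if 0 ≤ y then 1 else 0
  | μ :: L, y => ∫⁻ c, c.prod (fun x => cdfMax L (y - x)) ∂μ

theorem cdfMax_mono (L : List (Measure PointConfig)) : Monotone (cdfMax L) := by
  induction L with
  | nil =>
    intro x y hxy
    simp only [cdfMax]
    split_ifs with h1 h2 <;> simp
    exact absurd (h1.trans hxy) h2
  | cons μ L ih =>
    intro x y hxy
    exact lintegral_mono fun c => c.prod_mono fun z => ih (by linarith)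

theorem measurable_cdfMax (L : List (Measure PointConfig)) : Measurable (cdfMax L) :=
  (cdfMax_mono L).measurable

theorem cdfMax_le_one (L : List (Measure PointConfig)) (hL : ∀ μ ∈ L, IsProbabilityMeasure μ)
    (y : ℝ) : cdfMax L y ≤ 1 := by
  cases L with
  | nil => simp only [cdfMax]; split_ifs <;> simp
  | cons μ L =>
    have := hL μ (by simp)
    calc ∫⁻ c, c.prod (fun x => cdfMax L (y - x)) ∂μ ≤ ∫⁻ _, 1 ∂μ :=
          lintegral_mono fun c => c.prod_le_one _
      _ = 1 := by simp

/-- The intensity measure of the positions of the last generation of a branching random walk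
whose successive generations reproduce according to the mechanisms in the list. -/
def meanMeasure : List (Measure PointConfig) → Measure ℝ
  | [] => Measure.dirac 0
  | μ :: L => intensity μ ∗ meanMeasure L

theorem sFinite_meanMeasure (L : List (Measure PointConfig))
    (hL : ∀ μ ∈ L, IsProbabilityMeasure μ) : SFinite (meanMeasure L) := by
  induction L with
  | nil => unfold meanMeasure; infer_instance
  | cons μ L ih =>
    have := hL μ (by simp)
    have := ih fun ν hν => hL ν (by simp [hν])
    unfold meanMeasure
    infer_instance

theorem conv_apply_eq_lintegral (α β : Measure ℝ) [SFinite β] {s : Set ℝ}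
    (hs : MeasurableSet s) : (α ∗ β) s = ∫⁻ x, β ((fun z => x + z) ⁻¹' s) ∂α := by
  rw [← lintegral_indicator_one hs, Measure.lintegral_conv (by fun_prop (disch := assumption))]
  refine lintegral_congr fun x => ?_
  rw [← lintegral_indicator_one ((measurable_const_add x) hs)]
  rfl

theorem preimage_const_add_Ioi' (x y : ℝ) : (fun z => x + z) ⁻¹' Set.Ioi y = Set.Ioi (y - x) := by
  ext z; simp [sub_lt_iff_lt_add']

theorem preimage_const_add_Ioc' (x y z : ℝ) :
    (fun u => x + u) ⁻¹' Set.Ioc y z = Set.Ioc (y - x) (z - x) := by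
  ext u; simp [sub_lt_iff_lt_add', le_sub_iff_add_le']

theorem meanMeasure_cons_Ioi (μ : Measure PointConfig) (L : List (Measure PointConfig))
    [SFinite (meanMeasure L)] (y : ℝ) :
    meanMeasure (μ :: L) (Set.Ioi y) =
      ∫⁻ c, c.sum (fun x => meanMeasure L (Set.Ioi (y - x))) ∂μ := by
  rw [meanMeasure, conv_apply_eq_lintegral _ _ measurableSet_Ioi]
  simp_rw [preimage_const_add_Ioi']
  refine lintegral_intensity μ ?_
  have : Monotone fun x => meanMeasure L (Set.Ioi (y - x)) := fun a b hab =>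
    measure_mono (Set.Ioi_subset_Ioi (by linarith))
  exact this.measurable

/-- The union bound for independent events, in truncated subtraction. -/
theorem one_sub_prodLT_le_sum {ι : Type*} (s : Finset ι) (f : ι → ℝ≥0∞) (hf : ∀ i, f i ≤ 1) :
    1 - ∏ i ∈ s, f i ≤ ∑ i ∈ s, (1 - f i) := by
  classical
  induction s using Finset.induction_on with
  | empty => simp
  | insert i s hi ih =>
    rw [Finset.prod_insert hi, Finset.sum_insert hi]
    have h1 : (1 : ℝ≥0∞) ≤ (1 - f i) + f i * 1 := by rw [mul_one]; exact le_tsub_add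
    have h2 : (1 : ℝ≥0∞) ≤ ∑ j ∈ s, (1 - f j) + ∏ j ∈ s, f j := by
      rw [add_comm]; exact tsub_le_iff_left.1 ih
    rw [tsub_le_iff_left]
    calc (1 : ℝ≥0∞) ≤ (1 - f i) + f i * 1 := h1
      _ ≤ (1 - f i) + f i * (∑ j ∈ s, (1 - f j) + ∏ j ∈ s, f j) := by gcongr
      _ ≤ (1 - f i) + (∑ j ∈ s, (1 - f j) + f i * ∏ j ∈ s, f j) := by
          rw [mul_add]; gcongr; exact mul_le_of_le_one_left' (hf i)
      _ = _ := by ring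

theorem PointConfig.sum_eq_iSup (c : PointConfig) (f : ℝ → ℝ≥0∞) :
    c.sum f = ⨆ k : ℕ, ∑ i ∈ Finset.range k, if (i : ℕ∞) < c.1 then f (c.2 i) else 0 :=
  ENNReal.tsum_eq_iSup_nat

theorem PointConfig.one_sub_prod_le_sum (c : PointConfig) {g : ℝ → ℝ≥0∞} (hg : ∀ x, g x ≤ 1) :
    1 - c.prod g ≤ c.sum fun x => 1 - g x := by
  rw [PointConfig.prod, ENNReal.sub_iInf, PointConfig.sum_eq_iSup]
  refine iSup_mono fun k => ?_
  rw [PointConfig.prodLT]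
  refine (one_sub_prodLT_le_sum _ _ fun i => ?_).trans_eq (Finset.sum_congr rfl fun i _ => ?_)
  · split_ifs <;> simp [hg]
  · split_ifs <;> simp

theorem one_sub_cdfMax_cons (μ : Measure PointConfig) [IsProbabilityMeasure μ]
    (L : List (Measure PointConfig)) (y : ℝ) :
    1 - cdfMax (μ :: L) y = ∫⁻ c, (1 - c.prod fun x => cdfMax L (y - x)) ∂μ := by
  rw [lintegral_sub]
  · simp [cdfMax]
  · exact measurable_prod ((measurable_cdfMax L).comp (by fun_prop))
  · refine ne_top_of_le_ne_top ENNReal.one_ne_top (b := 1) ?_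
    calc _ ≤ ∫⁻ _, 1 ∂μ := lintegral_mono fun c => c.prod_le_one _
      _ = 1 := by simp
  · exact ae_of_all _ fun c => c.prod_le_one _

/-- The first moment bound. -/
theorem one_sub_cdfMax_le (L : List (Measure PointConfig))
    (hL : ∀ μ ∈ L, IsProbabilityMeasure μ) (y : ℝ) :
    1 - cdfMax L y ≤ meanMeasure L (Set.Ioi y) := by
  induction L generalizing y with
  | nil =>
    simp only [cdfMax, meanMeasure]
    rw [Measure.dirac_apply' _ measurableSet_Ioi]
    by_cases h : 0 ≤ y
    · simp [h]
    · simp [h, not_le.1 h]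
  | cons μ L ih =>
    have := hL μ (by simp)
    have hL' : ∀ ν ∈ L, IsProbabilityMeasure ν := fun ν hν => hL ν (by simp [hν])
    have := sFinite_meanMeasure L hL'
    rw [one_sub_cdfMax_cons, meanMeasure_cons_Ioi]
    refine lintegral_mono fun c => ?_
    exact (c.one_sub_prod_le_sum fun x => cdfMax_le_one L hL' _).trans
      (c.sum_mono fun x => ih hL' _)

/-! ### The law of the maximal displacement is given by the recursion -/

theorem maxDisplacement_le_iff (c : List ℕ → PointConfig) (n : ℕ) (y : ℝ) :
    maxDisplacement c n ≤ (y : EReal) ↔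
      ∀ u : List ℕ, u.length = n → InTree c u → position c u ≤ y := by
  simp only [maxDisplacement, iSup_le_iff, EReal.coe_le_coe_iff, Subtype.forall]
  exact ⟨fun h u h1 h2 => h u ⟨h1, h2⟩, fun h u h1 => h u h1.1 h1.2⟩

/-- Words carry the latest index first, so the ancestor in generation one is the last letter. Tree
and positions are defined by growing at the leaves, whereas the recursion cuts at the root; this
lemma and the next one pass between the two. -/
theorem inTree_append_singleton (c : List ℕ → PointConfig) (u : List ℕ) (i : ℕ) :
    InTree c (u ++ [i]) ↔ (i : ℕ∞) < (c []).1 ∧ InTree (fun v => c (v ++ [i])) u := by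
  induction u with
  | nil => simp [InTree]
  | cons j u ih => simp [InTree, ih, and_assoc]

theorem position_append_singleton (c : List ℕ → PointConfig) (u : List ℕ) (i : ℕ) :
    position c (u ++ [i]) = (c []).2 i + position (fun v => c (v ++ [i])) u := by
  induction u with
  | nil => simp [position]
  | cons j u ih => simp [position, ih, add_assoc]

theorem maxDisplacement_succ_le_iff (c : List ℕ → PointConfig) (n : ℕ) (y : ℝ) :
    maxDisplacement c (n + 1) ≤ (y : EReal) ↔ ∀ i : ℕ, (i : ℕ∞) < (c []).1 →
      maxDisplacement (fun v => c (v ++ [i])) n ≤ ((y - (c []).2 i : ℝ) : EReal) := by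
  simp only [maxDisplacement_le_iff]
  constructor
  · intro h i hi u hu hT
    have := h (u ++ [i]) (by simp [hu]) ((inTree_append_singleton c u i).2 ⟨hi, hT⟩)
    rw [position_append_singleton] at this
    linarith
  · intro h u hu hT
    rcases List.eq_nil_or_concat u with rfl | ⟨v, i, rfl⟩
    · simp at hu
    · rw [List.concat_eq_append] at hu hT ⊢
      rw [inTree_append_singleton] at hT
      have := h i hT.1 v (by simpa using hu) hT.2
      rw [position_append_singleton]
      linarith

theorem measurableSet_inTree {Ω : Type*} {m : MeasurableSpace Ω} (X : List ℕ → Ω → PointConfig)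
    (n : ℕ) (hX : ∀ u : List ℕ, u.length < n → Measurable (X u)) (u : List ℕ)
    (hu : u.length ≤ n) : MeasurableSet {ω | InTree (fun v => X v ω) u} := by
  induction u with
  | nil => simp [InTree]
  | cons i u ih =>
    simp only [List.length_cons] at hu
    exact (ih (by omega)).inter ((hX u (by omega)) (measurableSet_lt_card i))

theorem measurable_position {Ω : Type*} {m : MeasurableSpace Ω} (X : List ℕ → Ω → PointConfig)
    (n : ℕ) (hX : ∀ u : List ℕ, u.length < n → Measurable (X u)) (u : List ℕ)
    (hu : u.length ≤ n) : Measurable fun ω => position (fun v => X v ω) u := by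
  induction u with
  | nil => exact measurable_const
  | cons i u ih =>
    simp only [List.length_cons] at hu
    exact (ih (by omega)).add ((measurable_point i).comp (hX u (by omega)))

theorem measurable_maxDisplacement {Ω : Type*} {m : MeasurableSpace Ω}
    (X : List ℕ → Ω → PointConfig) (n : ℕ)
    (hX : ∀ u : List ℕ, u.length < n → Measurable (X u)) :
    Measurable fun ω => maxDisplacement (fun u => X u ω) n := by
  classical
  have : (fun ω => maxDisplacement (fun u => X u ω) n) = fun ω =>
      ⨆ u : {u : List ℕ // u.length = n},
        if InTree (fun v => X v ω) u then ((position (fun v => X v ω) u : ℝ) : EReal) else ⊥ := by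
    ext ω
    refine le_antisymm (iSup_le fun u => ?_) (iSup_le fun u => ?_)
    · refine le_iSup_of_le ⟨u, u.2.1⟩ ?_
      simp [u.2.2]
    · split_ifs with h
      · exact le_iSup (fun u : {u : List ℕ // u.length = n ∧ InTree (fun v => X v ω) u} =>
          ((position (fun v => X v ω) u : ℝ) : EReal)) ⟨u, u.2, h⟩
      · exact bot_le
  rw [this]
  refine Measurable.iSup fun u => Measurable.ite ?_ ?_ measurable_const
  · exact measurableSet_inTree X n hX u u.2.le
  · exact (measurable_position X n hX u u.2.le).coe_real_ereal

/-- Disjoint groups of independent σ-algebras are independent. -/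
theorem iIndep_iSup_of_pairwise_disjoint {Ω ι κ : Type*} {mΩ : MeasurableSpace Ω} {P : Measure Ω}
    [IsProbabilityMeasure P] {m : ι → MeasurableSpace Ω} (hm : ∀ i, m i ≤ mΩ) (h : iIndep m P)
    {S : κ → Set ι} (hS : Pairwise fun j k => Disjoint (S j) (S k)) :
    iIndep (fun k => ⨆ i ∈ S k, m i) P := by
  classical
  rw [iIndep_iff]
  intro s
  induction s using Finset.induction_on with
  | empty => simp
  | insert k s hk ih =>
    intro f hf
    rw [Finset.prod_insert hk, Finset.set_biInter_insert,
      ← ih fun i hi => hf i (Finset.mem_insert_of_mem hi)]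
    have hd : Disjoint (S k) (⋃ j ∈ s, S j) := by
      simp only [Set.disjoint_iUnion_right]
      exact fun j hj => hS (by rintro rfl; exact hk hj)
    refine (Indep_iff _ _ P).1 (indep_iSup_of_disjoint hm h hd) _ _
      (hf k (Finset.mem_insert_self k s)) ?_
    refine Finset.measurableSet_biInter s fun j hj => ?_
    have hle : ⨆ i ∈ S j, m i ≤ ⨆ i ∈ ⋃ j ∈ s, S j, m i :=
      biSup_mono fun i hi => Set.mem_biUnion hj hi
    exact hle _ (hf j (Finset.mem_insert_of_mem hj))

section Root

variable {Ω : Type*} [MeasurableSpace Ω] {P : Measure Ω}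
  {L : ℕ → Measure PointConfig} {n : ℕ} {X : List ℕ → Ω → PointConfig}

/-- The branching random walk issued from the `i`-th child of the root. -/
theorem IsBRWtie.subtree (h : IsBRWtie P L (n + 1) X) (i : ℕ) :
    IsBRWtie P (fun k => L (k + 1)) n fun u => X (u ++ [i]) where
  measurable u hu := h.measurable _ (by simpa using hu)
  law u hu := by
    have := h.law (u ++ [i]) (by simpa using hu)
    simpa using this
  indep := by
    have := h.indep.precomp
      (g := fun u : {u : List ℕ // u.length < n} =>
        (⟨u ++ [i], by simpa using u.2⟩ : {u : List ℕ // u.length < n + 1}))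
      (fun u v huv => by simpa [Subtype.ext_iff] using huv)
    exact this

/-- The σ-algebra generated by the displacements in the group `none` (the root) or `some i` (the
descendants of the `i`-th child of the root). -/
def rootGroup (n : ℕ) : Option ℕ → Set {u : List ℕ // u.length < n + 1}
  | none => {u | u.1 = []}
  | some i => {u | ∃ v, u.1 = v ++ [i]}

theorem pairwise_disjoint_rootGroup (n : ℕ) :
    Pairwise fun j k => Disjoint (rootGroup n j) (rootGroup n k) := by
  intro j k hjk
  rw [Set.disjoint_left]
  rintro ⟨u, hu⟩ h1 h2
  rcases j with _ | i <;> rcases k with _ | k <;>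
    simp only [rootGroup, Set.mem_ofPred_eq] at h1 h2
  · exact hjk rfl
  · obtain ⟨v, hv⟩ := h2
    simp [h1] at hv
  · obtain ⟨v, hv⟩ := h1
    simp [h2] at hv
  · obtain ⟨v, hv⟩ := h1
    obtain ⟨w, hw⟩ := h2
    have := hv.symm.trans hw
    simp at this
    exact hjk (by rw [this.2])

/-- The root and the subtrees of distinct children read disjoint sets of words, hence independent
σ-algebras. Finitely many subtrees suffice, since infinite offspring is reached by a monotone limit.
-/
theorem IsBRWtie.map_root_subtrees [IsProbabilityMeasure P] (h : IsBRWtie P L (n + 1) X) (k : ℕ) :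
    P.map (fun ω => (X [] ω,
        fun i : Fin k => maxDisplacement (fun u => X (u ++ [(i : ℕ)]) ω) n)) =
      (L 0).prod (Measure.pi fun i : Fin k =>
        P.map fun ω => maxDisplacement (fun u => X (u ++ [(i : ℕ)]) ω) n) := by
  set m : {u : List ℕ // u.length < n + 1} → MeasurableSpace Ω :=
    fun u => MeasurableSpace.comap (X u) inferInstance with hm
  have hle : ∀ u, m u ≤ ‹MeasurableSpace Ω› := fun u => (h.measurable u u.2).comap_le
  have hind : iIndep m P := h.indep
  have hM' (i : ℕ) : Measurable[⨆ u ∈ rootGroup n (some i), m u]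
      fun ω => maxDisplacement (fun u => X (u ++ [i]) ω) n := by
    refine measurable_maxDisplacement (m := ⨆ u ∈ rootGroup n (some i), m u)
      (fun u => X (u ++ [i])) n fun u hu => ?_
    have hu' : (u ++ [i]).length < n + 1 := by simpa using hu
    have : m ⟨u ++ [i], hu'⟩ ≤ ⨆ u ∈ rootGroup n (some i), m u :=
      le_biSup m (show (⟨u ++ [i], hu'⟩ : {u : List ℕ // u.length < n + 1}) ∈ _ from ⟨u, rfl⟩)
    exact (comap_measurable (X (u ++ [i]))).mono this le_rfl
  have hM (i : ℕ) : Measurable fun ω => maxDisplacement (fun u => X (u ++ [i]) ω) n :=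
    (hM' i).mono (iSup₂_le fun u _ => hle u) le_rfl
  have hX0 : Measurable (X []) := h.measurable [] (by simp)
  have hgroups := iIndep_iSup_of_pairwise_disjoint hle hind (pairwise_disjoint_rootGroup n)
  have hpi : iIndepFun (fun (i : Fin k) ω => maxDisplacement (fun u => X (u ++ [(i : ℕ)]) ω) n) P := by
    have h1 : iIndep (fun i : Fin k => ⨆ u ∈ rootGroup n (some (i : ℕ)), m u) P :=
      hgroups.precomp (g := fun i : Fin k => some (i : ℕ))
        (fun i j hij => by simpa [Fin.ext_iff] using hij)
    rw [iIndepFun_iff_measure_inter_preimage_eq_mul]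
    intro s A hA
    exact h1.meas_biInter fun i hi => hM' i (hA i hi)
  have h2 : IndepFun (X []) (fun ω (i : Fin k) =>
      maxDisplacement (fun u => X (u ++ [(i : ℕ)]) ω) n) P := by
    have hd : Disjoint (rootGroup n none) (⋃ i : Fin k, rootGroup n (some (i : ℕ))) := by
      simp only [Set.disjoint_iUnion_right]
      exact fun i => pairwise_disjoint_rootGroup n (by simp)
    have h3 : Indep (⨆ u ∈ rootGroup n none, m u)
        (⨆ u ∈ ⋃ i : Fin k, rootGroup n (some (i : ℕ)), m u) P :=
      indep_iSup_of_disjoint hle hind hd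
    have h4 : MeasurableSpace.comap (fun ω (i : Fin k) =>
        maxDisplacement (fun u => X (u ++ [(i : ℕ)]) ω) n) inferInstance ≤
        ⨆ u ∈ ⋃ i : Fin k, rootGroup n (some (i : ℕ)), m u := by
      refine measurable_iff_comap_le.1 ?_
      refine @measurable_pi_lambda _ _ _ (⨆ u ∈ ⋃ i : Fin k, rootGroup n (some (i : ℕ)), m u)
        _ _ fun i s hs => ?_
      have hle' : ⨆ u ∈ rootGroup n (some (i : ℕ)), m u ≤
          ⨆ u ∈ ⋃ i : Fin k, rootGroup n (some (i : ℕ)), m u :=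
        biSup_mono fun u hu => Set.mem_iUnion_of_mem i hu
      exact hle' _ (hM' i hs)
    have h5 : MeasurableSpace.comap (X []) inferInstance ≤ ⨆ u ∈ rootGroup n none, m u :=
      le_biSup m (show (⟨[], by simp⟩ : {u : List ℕ // u.length < n + 1}) ∈ rootGroup n none from rfl)
    exact indep_of_indep_of_le_left (indep_of_indep_of_le_right h3 h4) h5
  have hMk : Measurable fun ω (i : Fin k) => maxDisplacement (fun u => X (u ++ [(i : ℕ)]) ω) n :=
    measurable_pi_lambda _ fun i => hM i
  rw [(indepFun_iff_map_prod_eq_prod_map_map hX0.aemeasurable hMk.aemeasurable).1 h2,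
    hpi.map_fun_eq_pi_map fun i : Fin k => (hM i).aemeasurable, h.law [] (by simp)]
  rfl

theorem IsBRWtie.measure_maxDisplacement_le [IsProbabilityMeasure P]
    (h : IsBRWtie P L n X) (y : ℝ) :
    P {ω | maxDisplacement (fun u => X u ω) n ≤ (y : EReal)} =
      cdfMax ((List.range n).map L) y := by
  induction n generalizing L X y with
  | zero =>
    by_cases hy : 0 ≤ y
    · have : ∀ ω, maxDisplacement (fun u => X u ω) 0 ≤ (y : EReal) := fun ω => by
        rw [maxDisplacement_le_iff]
        intro u hu _
        rw [List.length_eq_zero_iff.1 hu]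
        exact hy
      simp [cdfMax, this, hy]
    · have : ∀ ω, ¬ maxDisplacement (fun u => X u ω) 0 ≤ (y : EReal) := fun ω hω => by
        rw [maxDisplacement_le_iff] at hω
        exact hy (hω [] rfl trivial)
      simp [cdfMax, this, hy]
  | succ n ih =>
    rw [List.range_succ_eq_map, List.map_cons, List.map_map]
    change _ = ∫⁻ c, c.prod (fun x => cdfMax ((List.range n).map fun k => L (k + 1)) (y - x)) ∂L 0
    set L' := (List.range n).map fun k => L (k + 1)
    have hX0 : Measurable (X []) := h.measurable [] (by simp)
    have hL0 : IsProbabilityMeasure (L 0) := by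
      have := h.law [] (by simp)
      rw [List.length_nil] at this
      rw [← this]
      exact Measure.isProbabilityMeasure_map hX0.aemeasurable
    have hM (i : ℕ) : Measurable fun ω => maxDisplacement (fun u => X (u ++ [i]) ω) n :=
      measurable_maxDisplacement _ n (h.subtree i).measurable
    have hprob (i : ℕ) : IsProbabilityMeasure
        (P.map fun ω => maxDisplacement (fun u => X (u ++ [i]) ω) n) :=
      Measure.isProbabilityMeasure_map (hM i).aemeasurable
    -- Only the first `k` children are tested, so for a fixed root configuration the event is a
    -- rectangle and its probability is `prodLT`. Letting `k` grow decreases to the full event,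
    -- matching the infimum that defines `PointConfig.prod`.
    let A (k : ℕ) : Set (PointConfig × (Fin k → EReal)) :=
      ⋂ i : Fin k, {p | ((i : ℕ) : ℕ∞) < p.1.1 → p.2 i ≤ ((y - p.1.2 i : ℝ) : EReal)}
    have hA (k : ℕ) : MeasurableSet (A k) := by
      refine MeasurableSet.iInter fun i => ?_
      have h1 : MeasurableSet {p : PointConfig × (Fin k → EReal) | ((i : ℕ) : ℕ∞) < p.1.1} :=
        measurable_fst (measurableSet_lt_card i)
      have h2 : MeasurableSet {p : PointConfig × (Fin k → EReal) |
          p.2 i ≤ ((y - p.1.2 i : ℝ) : EReal)} := by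
        refine measurableSet_le ((measurable_pi_apply i).comp measurable_snd) ?_
        exact (measurable_const.sub ((measurable_point i).comp measurable_fst)).coe_real_ereal
      exact h1.imp h2
    have hJ (k : ℕ) : Measurable fun ω => (X [] ω,
        fun i : Fin k => maxDisplacement (fun u => X (u ++ [(i : ℕ)]) ω) n) :=
      hX0.prodMk (measurable_pi_lambda _ fun i => hM i)
    have hPA (k : ℕ) : P ((fun ω => (X [] ω,
        fun i : Fin k => maxDisplacement (fun u => X (u ++ [(i : ℕ)]) ω) n)) ⁻¹' A k) =
        ∫⁻ c, c.prodLT (fun x => cdfMax L' (y - x)) k ∂L 0 := by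
      rw [← Measure.map_apply (hJ k) (hA k), h.map_root_subtrees k, Measure.prod_apply (hA k)]
      refine lintegral_congr fun c => ?_
      have : Prod.mk c ⁻¹' A k = Set.pi Set.univ fun i : Fin k =>
          {z : EReal | ((i : ℕ) : ℕ∞) < c.1 → z ≤ ((y - c.2 i : ℝ) : EReal)} := by
        ext z; simp [A]
      rw [this, Measure.pi_pi, PointConfig.prodLT, Finset.prod_range]
      refine Finset.prod_congr rfl fun i _ => ?_
      split_ifs with hi
      · simp only [hi, true_imp_iff]
        rw [← ih (h.subtree i)]
        exact Measure.map_apply (hM i) measurableSet_Iic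
      · simp [hi]
    have hset : {ω | maxDisplacement (fun u => X u ω) (n + 1) ≤ (y : EReal)} =
        ⋂ k, (fun ω => (X [] ω,
          fun i : Fin k => maxDisplacement (fun u => X (u ++ [(i : ℕ)]) ω) n)) ⁻¹' A k := by
      ext ω
      simp only [Set.mem_ofPred_eq, maxDisplacement_succ_le_iff, Set.mem_iInter, Set.mem_preimage, A]
      exact ⟨fun H k i => H i, fun H i => H (i + 1) ⟨i, by omega⟩⟩
    have hanti : Antitone fun k => (fun ω => (X [] ω,
        fun i : Fin k => maxDisplacement (fun u => X (u ++ [(i : ℕ)]) ω) n)) ⁻¹' A k := by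
      intro j k hjk ω hω
      simp only [Set.mem_iInter, Set.mem_preimage, A, Set.mem_ofPred_eq] at hω ⊢
      exact fun i => hω ⟨i, by omega⟩
    rw [hset, hanti.measure_iInter (fun k => ((hJ k) (hA k)).nullMeasurableSet)
      ⟨0, measure_ne_top _ _⟩]
    simp_rw [hPA]
    unfold PointConfig.prod
    have hcm : Measurable fun x => cdfMax L' (y - x) := (measurable_cdfMax L').comp (by fun_prop)
    have hle1 : ∀ x, cdfMax L' (y - x) ≤ 1 := fun x => by
      rw [← ih (h.subtree 0)]
      exact prob_le_one
    rw [lintegral_iInf (fun k => measurable_prodLT hcm k)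
      (fun j k hjk c => c.prodLT_antitone hle1 hjk)]
    simp [PointConfig.prodLT]

end Root

/-! ### A lower bound by moments of order 1 + q -/

/-- A second order Bonferroni inequality, stated additively to avoid truncated subtraction. -/
theorem prod_one_sub_add_sum_le {ι : Type*} (s : Finset ι) (p : ι → ℝ≥0∞) (hp : ∀ i, p i ≤ 1) :
    ∏ i ∈ s, (1 - p i) + ∑ i ∈ s, p i ≤ 1 + (∑ i ∈ s, p i) ^ 2 := by
  classical
  induction s using Finset.induction_on with
  | empty => simp
  | insert i s hi ih =>
    rw [Finset.prod_insert hi, Finset.sum_insert hi]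
    set S := ∑ j ∈ s, p j
    set Q := ∏ j ∈ s, (1 - p j)
    obtain ⟨a, ha⟩ : ∃ a, a = 1 - p i := ⟨_, rfl⟩
    have hap : a + p i = 1 := by rw [ha]; exact tsub_add_cancel_of_le (hp i)
    have ha1 : a ≤ 1 := by rw [ha]; exact tsub_le_self
    rw [← ha]
    calc a * Q + (p i + S) = a * Q + (p i + (a + p i) * S) := by rw [hap, one_mul]
      _ = a * (Q + S) + (p i + p i * S) := by ring
      _ ≤ a * (1 + S ^ 2) + (p i + p i * S) := by gcongr
      _ = (a + p i) + a * S ^ 2 + p i * S := by ring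
      _ ≤ 1 + 1 * S ^ 2 + p i * S := by rw [hap]; gcongr
      _ ≤ 1 + 1 * S ^ 2 + p i * S + (p i ^ 2 + p i * S) := le_self_add
      _ = 1 + (p i + S) ^ 2 := by ring

/-- Below one the square in the Bonferroni inequality is dominated by the power `1 + q`, since `q ≤
1`. Above one the power alone dominates the sum. -/
theorem sum_le_one_sub_prod_add {ι : Type*} (s : Finset ι) (p : ι → ℝ≥0∞) (hp : ∀ i, p i ≤ 1)
    {q : ℝ} (hq0 : 0 ≤ q) (hq1 : q ≤ 1) :
    ∑ i ∈ s, p i ≤ (1 - ∏ i ∈ s, (1 - p i)) + (∑ i ∈ s, p i) ^ (1 + q) := by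
  rcases le_total 1 (∑ i ∈ s, p i) with h | h
  · refine le_add_left ?_
    calc ∑ i ∈ s, p i = (∑ i ∈ s, p i) ^ (1 : ℝ) := by simp
      _ ≤ _ := ENNReal.rpow_le_rpow_of_exponent_le h (by linarith)
  · have h1 : ∏ i ∈ s, (1 - p i) ≤ 1 := Finset.prod_le_one' fun i _ => tsub_le_self
    have h2 : (∑ i ∈ s, p i) ^ 2 ≤ (∑ i ∈ s, p i) ^ (1 + q) := by
      rw [← ENNReal.rpow_natCast]
      exact ENNReal.rpow_le_rpow_of_exponent_ge h (by push_cast; linarith)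
    have h3 := prod_one_sub_add_sum_le s p hp
    refine le_trans ?_ (add_le_add_right h2 _)
    refine (ENNReal.add_le_add_iff_left (ne_top_of_le_ne_top ENNReal.one_ne_top h1)).1 ?_
    rw [← add_assoc, add_tsub_cancel_of_le h1]
    exact h3

theorem PointConfig.sum_le_one_sub_prod_add (c : PointConfig) {g : ℝ → ℝ≥0∞} (hg : ∀ x, g x ≤ 1)
    {q : ℝ} (hq0 : 0 ≤ q) (hq1 : q ≤ 1) :
    c.sum g ≤ (1 - c.prod fun x => 1 - g x) + (c.sum g) ^ (1 + q) := by
  conv_lhs => rw [PointConfig.sum_eq_iSup]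
  refine iSup_le fun k => ?_
  refine (BRW.sum_le_one_sub_prod_add (Finset.range k) _ (fun i => ?_) hq0 hq1).trans ?_
  · split_ifs <;> simp [hg]
  · refine add_le_add (tsub_le_tsub_left ?_ 1) (ENNReal.rpow_le_rpow ?_ (by linarith))
    · refine (c.prod_le_prodLT _ k).trans_eq (Finset.prod_congr rfl fun i _ => ?_)
      split_ifs <;> simp
    · exact ENNReal.sum_le_tsum _

theorem measurable_measure_Ioc (ρ : Measure ℝ) [SFinite ρ] (y H : ℝ) :
    Measurable fun x => ρ (Set.Ioc (y - x) (y - x + H)) := by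
  have : MeasurableSet {p : ℝ × ℝ | p.2 ∈ Set.Ioc (y - p.1) (y - p.1 + H)} :=
    MeasurableSet.inter (s₁ := {p : ℝ × ℝ | y - p.1 < p.2}) (s₂ := {p : ℝ × ℝ | p.2 ≤ y - p.1 + H})
      (measurableSet_lt (by fun_prop) (by fun_prop))
      (measurableSet_le (by fun_prop) (by fun_prop))
  exact measurable_measure_prodMk_left this

theorem meanMeasure_cons_Ioc (μ : Measure PointConfig) (L : List (Measure PointConfig))
    [SFinite (meanMeasure L)] (y H : ℝ) :
    meanMeasure (μ :: L) (Set.Ioc y (y + H)) =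
      ∫⁻ c, c.sum (fun x => meanMeasure L (Set.Ioc (y - x) (y - x + H))) ∂μ := by
  rw [meanMeasure, conv_apply_eq_lintegral _ _ measurableSet_Ioc]
  simp_rw [preimage_const_add_Ioc', add_sub_right_comm]
  exact lintegral_intensity μ (measurable_measure_Ioc _ y H)

/-- The correction term, of order `1 + q`, in the lower bound of the probability that a branching
random walk visits `(y, y + H]`. -/
def correction (q H : ℝ) : List (Measure PointConfig) → ℝ → ℝ≥0∞
  | [], _ => 0
  | μ :: L, y => ∫⁻ c, (c.sum (fun x => correction q H L (y - x)) +
      (c.sum fun x => meanMeasure L (Set.Ioc (y - x) (y - x + H))) ^ (1 + q)) ∂μ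

/-- This replaces the second moment method. Since the correction carries the factor `ε^{1+q}`
against `ε` for the mean, a small fixed `ε` makes the bound useful as soon as the mean is bounded
below and the correction above. Only conditional means given the children are raised to the power `1
+ q`, so no moment of the particle count itself is needed. -/
theorem mul_meanMeasure_le (L : List (Measure PointConfig))
    (hL : ∀ μ ∈ L, IsProbabilityMeasure μ) {q H ε : ℝ} (hq0 : 0 ≤ q) (hq1 : q ≤ 1)
    (hε1 : ε ≤ 1) (y : ℝ) :
    ENNReal.ofReal ε * meanMeasure L (Set.Ioc y (y + H)) ≤
      (1 - cdfMax L y) + ENNReal.ofReal ε ^ (1 + q) * correction q H L y := by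
  have hε1' : ENNReal.ofReal ε ≤ 1 := by simpa using hε1
  set e := ENNReal.ofReal ε
  have he : e ^ (1 + q) ≠ ∞ := ENNReal.rpow_ne_top_of_nonneg (by linarith) ENNReal.ofReal_ne_top
  induction L generalizing y with
  | nil =>
    simp only [cdfMax, meanMeasure, correction, mul_zero, add_zero]
    rw [Measure.dirac_apply' _ measurableSet_Ioc]
    by_cases h : 0 ≤ y
    · simp [h]
    · simp only [h, if_false, tsub_zero]
      refine mul_le_one' hε1' ?_
      exact Set.indicator_le_self' (fun _ _ => zero_le) 0 |>.trans le_rfl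
  | cons μ L ih =>
    have := hL μ (by simp)
    have hL' : ∀ ν ∈ L, IsProbabilityMeasure ν := fun ν hν => hL ν (by simp [hν])
    have := sFinite_meanMeasure L hL'
    have hmeas : Measurable fun c : PointConfig => 1 - c.prod fun x => cdfMax L (y - x) :=
      measurable_const.sub (measurable_prod ((measurable_cdfMax L).comp (by fun_prop)))
    rw [meanMeasure_cons_Ioc, one_sub_cdfMax_cons, correction,
      ← lintegral_const_mul' _ _ ENNReal.ofReal_ne_top, ← lintegral_const_mul' _ _ he,
      ← lintegral_add_left hmeas]
    refine lintegral_mono fun c => ?_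
    set A : ℝ → ℝ≥0∞ := fun x => meanMeasure L (Set.Ioc (y - x) (y - x + H))
    set F : ℝ → ℝ≥0∞ := fun x => cdfMax L (y - x)
    set s : ℝ → ℝ≥0∞ := fun x => correction q H L (y - x)
    have ih' (x : ℝ) : e * A x ≤ (1 - F x) + e ^ (1 + q) * s x := ih hL' (y - x)
    -- The minimum serves twice: `p ≤ 1 - F` compares the product over children with the true one,
    -- and `p ≤ e * A` bounds the power of the sum. By induction the loss in replacing `e * A` by
    -- `p` is at most `e ^ (1 + q) * s`.
    let p : ℝ → ℝ≥0∞ := fun x => min (1 - F x) (e * A x)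
    have hp (x : ℝ) : e * A x ≤ p x + e ^ (1 + q) * s x := by
      simp only [p]
      rcases le_total (1 - F x) (e * A x) with h | h
      · rw [min_eq_left h]; exact ih' x
      · rw [min_eq_right h]; exact le_self_add
    have hp1 (x : ℝ) : p x ≤ 1 := (min_le_left _ _).trans tsub_le_self
    have hpF : c.prod F ≤ c.prod fun x => 1 - p x := c.prod_mono fun x => by
      have h1 : F x ≤ 1 := cdfMax_le_one L hL' _
      calc F x = 1 - (1 - F x) := (ENNReal.sub_sub_cancel ENNReal.one_ne_top h1).symm
        _ ≤ 1 - p x := tsub_le_tsub_left (min_le_left _ _) 1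
    have hpA : c.sum p ≤ e * c.sum A := by
      rw [← c.sum_const_mul]
      exact c.sum_mono fun x => min_le_right _ _
    calc e * c.sum A = c.sum fun x => e * A x := (c.sum_const_mul e A).symm
      _ ≤ c.sum fun x => p x + e ^ (1 + q) * s x := c.sum_mono hp
      _ = c.sum p + e ^ (1 + q) * c.sum s := by rw [c.sum_add, c.sum_const_mul]
      _ ≤ (1 - c.prod fun x => 1 - p x) + c.sum p ^ (1 + q) + e ^ (1 + q) * c.sum s := by
          gcongr
          exact c.sum_le_one_sub_prod_add hp1 hq0 hq1
      _ ≤ (1 - c.prod F) + (e * c.sum A) ^ (1 + q) + e ^ (1 + q) * c.sum s := by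
          gcongr
      _ = _ := by
          rw [ENNReal.mul_rpow_of_nonneg _ _ (by linarith), mul_add, add_assoc,
            add_comm (e ^ (1 + q) * _)]

/-! ### The Fejér kernel and concentration -/

/-- The Fejér-type kernel with Fourier transform the triangle function on `[-η, η]`. -/
def fejer (η x : ℝ) : ℝ := ∫ s in (-η)..η, (1 - |s| / η) * Real.cos (s * x)

theorem fejer_eq {η x : ℝ} (hη : 0 < η) (hx : x ≠ 0) :
    fejer η x = 2 * (1 - Real.cos (η * x)) / (η * x ^ 2) := by
  have hcont : Continuous fun s => (1 - |s| / η) * Real.cos (s * x) := by fun_prop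
  have hhalf : ∫ s in (0 : ℝ)..η, (1 - |s| / η) * Real.cos (s * x) =
      (1 - Real.cos (η * x)) / (η * x ^ 2) := by
    -- The antiderivative produced by one integration by parts.
    have hd : ∀ s ∈ Set.uIcc 0 η, HasDerivAt
        (fun s => (1 - s / η) * (Real.sin (s * x) / x) - Real.cos (s * x) / (η * x ^ 2))
        ((1 - |s| / η) * Real.cos (s * x)) s := by
      intro s hs
      rw [Set.uIcc_of_le hη.le] at hs
      rw [abs_of_nonneg hs.1]
      have h1 : HasDerivAt (fun s : ℝ => 1 - s / η) (-(1 / η)) s :=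
        ((hasDerivAt_id s).div_const η).const_sub 1
      have h2 : HasDerivAt (fun s : ℝ => s * x) x s := by
        simpa using (hasDerivAt_id s).mul_const x
      have h3 := h1.mul ((h2.sin).div_const x)
      have h4 := (h2.cos).div_const (η * x ^ 2)
      refine (h3.sub h4).congr_deriv ?_
      field_simp
      ring
    rw [intervalIntegral.integral_eq_sub_of_hasDerivAt hd (hcont.intervalIntegrable _ _)]
    field_simp
    simp
    ring
  have hneg : ∫ s in (-η)..0, (1 - |s| / η) * Real.cos (s * x) =
      ∫ s in (0 : ℝ)..η, (1 - |s| / η) * Real.cos (s * x) := by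
    have := intervalIntegral.integral_comp_neg (a := -η) (b := 0)
      fun s => (1 - |s| / η) * Real.cos (s * x)
    simpa using this
  rw [fejer, ← intervalIntegral.integral_add_adjacent_intervals
    (hcont.intervalIntegrable (-η) 0) (hcont.intervalIntegrable 0 η), hneg, hhalf]
  ring

theorem fejer_zero {η : ℝ} (hη : 0 < η) : fejer η 0 = η := by
  have hcont : Continuous fun s : ℝ => 1 - |s| / η := by fun_prop
  have hhalf : ∫ s in (0 : ℝ)..η, (1 - |s| / η) = η / 2 := by
    have : ∫ s in (0 : ℝ)..η, (1 - |s| / η) = ∫ s in (0 : ℝ)..η, (1 - s / η) := by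
      refine intervalIntegral.integral_congr fun s hs => ?_
      rw [Set.uIcc_of_le hη.le] at hs
      simp [abs_of_nonneg hs.1]
    rw [this, intervalIntegral.integral_sub (by simp) (by simp),
      intervalIntegral.integral_div, integral_id]
    simp
    field_simp
    ring
  have hneg : ∫ s in (-η)..0, (1 - |s| / η) = ∫ s in (0 : ℝ)..η, (1 - |s| / η) := by
    have := intervalIntegral.integral_comp_neg (a := -η) (b := 0) fun s => 1 - |s| / η
    simpa using this
  simp only [fejer, mul_zero, Real.cos_zero, mul_one]
  rw [← intervalIntegral.integral_add_adjacent_intervals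
    (hcont.intervalIntegrable (-η) 0) (hcont.intervalIntegrable 0 η), hneg, hhalf]
  ring

theorem fejer_nonneg {η : ℝ} (hη : 0 < η) (x : ℝ) : 0 ≤ fejer η x := by
  by_cases hx : x = 0
  · rw [hx, fejer_zero hη]; exact hη.le
  · rw [fejer_eq hη hx]
    have := Real.cos_le_one (η * x)
    have : 0 ≤ 1 - Real.cos (η * x) := by linarith
    positivity

theorem fejer_le {η : ℝ} (hη : 0 < η) (x : ℝ) : fejer η x ≤ η := by
  by_cases hx : x = 0
  · rw [hx, fejer_zero hη]
  · rw [fejer_eq hη hx, div_le_iff₀ (by positivity)]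
    have := Real.one_sub_sq_div_two_le_cos (x := η * x)
    nlinarith

theorem fejer_le_div {η : ℝ} (hη : 0 < η) {x : ℝ} (hx : x ≠ 0) :
    fejer η x ≤ 4 / (η * x ^ 2) := by
  rw [fejer_eq hη hx]
  have := Real.neg_one_le_cos (η * x)
  gcongr
  linarith

theorem le_fejer {η : ℝ} (hη : 0 < η) (hη1 : η ≤ 1) {x : ℝ} (hx : |x| ≤ 1) :
    η / 2 ≤ fejer η x := by
  by_cases hx0 : x = 0
  · rw [hx0, fejer_zero hη]; linarith
  · rw [fejer_eq hη hx0, le_div_iff₀ (by positivity)]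
    have h1 : |η * x| ≤ 1 := by
      rw [abs_mul, abs_of_pos hη]
      exact mul_le_one₀ hη1 (abs_nonneg _) hx
    have h2 := (abs_le.1 (Real.cos_bound h1)).2
    have h3 : |η * x| ^ 4 ≤ (η * x) ^ 2 := by
      rw [← sq_abs (η * x)]
      exact pow_le_pow_of_le_one (abs_nonneg _) h1 (by norm_num)
    nlinarith [sq_nonneg (η * x)]

theorem continuous_fejer (η : ℝ) : Continuous (fejer η) := by
  unfold fejer
  exact intervalIntegral.continuous_parametric_intervalIntegral_of_continuous' (by fun_prop) _ _

theorem charFun_re (ρ : Measure ℝ) [IsFiniteMeasure ρ] (s : ℝ) :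
    (charFun ρ s).re = ∫ x, Real.cos (s * x) ∂ρ := by
  rw [charFun_apply_real]
  have hint : Integrable (fun x : ℝ => Complex.exp (s * x * Complex.I)) ρ := by
    refine Integrable.of_bound (by fun_prop) 1 (ae_of_all _ fun x => ?_)
    rw [← Complex.ofReal_mul, Complex.norm_exp_ofReal_mul_I]
  have := Complex.reCLM.integral_comp_comm hint
  simp only [Complex.reCLM_apply] at this
  rw [← this]
  refine integral_congr_ae (ae_of_all _ fun x => ?_)
  simp only
  rw [← Complex.ofReal_mul, Complex.exp_ofReal_mul_I_re]

/-- Fubini. Only frequencies in `[-η, η]` enter, so everything below uses the characteristic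
function near zero alone and no condition against lattices is needed, at the price of windows of
fixed, not arbitrarily small, length. -/
theorem integral_fejer (ρ : Measure ℝ) [IsFiniteMeasure ρ] {η : ℝ} (hη : 0 < η) :
    ∫ x, fejer η x ∂ρ = ∫ s in (-η)..η, (1 - |s| / η) * (charFun ρ s).re := by
  simp only [fejer, intervalIntegral.integral_of_le (show -η ≤ η by linarith)]
  rw [integral_integral_swap]
  · refine integral_congr_ae (ae_of_all _ fun s => ?_)
    simp only [charFun_re]
    exact integral_const_mul _ _
  · have hf : Continuous (Function.uncurry fun x s : ℝ => (1 - |s| / η) * Real.cos (s * x)) := by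
      unfold Function.uncurry; fun_prop
    have hm : ∀ᵐ s ∂(volume.restrict (Set.Ioc (-η) η)), s ∈ Set.Ioc (-η) η :=
      ae_restrict_mem measurableSet_Ioc
    refine Integrable.of_bound hf.aestronglyMeasurable 2 ?_
    have hset : ∀ᵐ p ∂(ρ.prod (volume.restrict (Set.Ioc (-η) η))), p.2 ∈ Set.Ioc (-η) η :=
      Measure.quasiMeasurePreserving_snd.ae hm
    filter_upwards [hset] with p hp
    simp only [Function.uncurry, norm_mul, Real.norm_eq_abs]
    have h1 : |p.2| / η ≤ 1 := by
      rw [div_le_one hη]; exact abs_le.2 ⟨hp.1.le, hp.2⟩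
    have h2 : |1 - |p.2| / η| ≤ 1 := by
      rw [abs_of_nonneg (by linarith)]
      have : 0 ≤ |p.2| / η := by positivity
      linarith
    calc |1 - |p.2| / η| * |Real.cos (p.2 * p.1)| ≤ 1 * 1 := by
          gcongr; exact Real.abs_cos_le_one _
      _ ≤ 2 := by norm_num

theorem integrable_fejer (ρ : Measure ℝ) [IsFiniteMeasure ρ] {η : ℝ} (hη : 0 < η) (w : ℝ) :
    Integrable (fun x => fejer η (x - w)) ρ := by
  refine Integrable.of_bound
    ((continuous_fejer η).comp (by fun_prop)).aestronglyMeasurable η (ae_of_all _ fun x => ?_)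
  rw [Real.norm_eq_abs, abs_of_nonneg (fejer_nonneg hη _)]
  exact fejer_le hη _

theorem integral_fejer_sub (ρ : Measure ℝ) [IsFiniteMeasure ρ] {η : ℝ} (hη : 0 < η) (w : ℝ) :
    ∫ x, fejer η (x - w) ∂ρ =
      ∫ s in (-η)..η, (1 - |s| / η) * (charFun (ρ.map fun x => x + -w) s).re := by
  rw [← integral_fejer _ hη, integral_map (by fun_prop)
    (continuous_fejer η).aestronglyMeasurable]
  simp [sub_eq_add_neg]

/-- A concentration bound in terms of the characteristic function. -/
theorem measure_Ioc_le_of_norm_charFun_le (ρ : Measure ℝ) [IsProbabilityMeasure ρ] {η c : ℝ}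
    (hη : 0 < η) (hη1 : η ≤ 1) (hc : 0 < c)
    (h : ∀ s : ℝ, |s| ≤ η → ‖charFun ρ s‖ ≤ Real.exp (-c * s ^ 2)) (x : ℝ) :
    ρ (Set.Ioc x (x + 1)) ≤ ENNReal.ofReal (2 / η * Real.sqrt (Real.pi / c)) := by
  -- The kernel is nonnegative everywhere and at least `η / 2` within distance one of its centre.
  have h1 : ρ.real (Set.Ioc x (x + 1)) * (η / 2) ≤ ∫ u, fejer η (u - x) ∂ρ := by
    rw [← smul_eq_mul, ← integral_indicator_const _ measurableSet_Ioc]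
    refine integral_mono ((integrable_const _).indicator measurableSet_Ioc)
      (integrable_fejer ρ hη x) fun u => ?_
    by_cases hu : u ∈ Set.Ioc x (x + 1)
    · simp only [Set.indicator_of_mem hu]
      refine le_fejer hη hη1 (abs_le.2 ⟨?_, ?_⟩) <;> linarith [hu.1, hu.2]
    · simp only [Set.indicator_of_notMem hu]
      exact fejer_nonneg hη _
  have h2 : ∫ u, fejer η (u - x) ∂ρ ≤ Real.sqrt (Real.pi / c) := by
    rw [integral_fejer_sub ρ hη, ← integral_gaussian c,
      intervalIntegral.integral_of_le (show -η ≤ η by linarith)]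
    calc ∫ s in Set.Ioc (-η) η, (1 - |s| / η) * (charFun (ρ.map fun x_1 => x_1 + -x) s).re
        ≤ ∫ s in Set.Ioc (-η) η, Real.exp (-c * s ^ 2) := by
          refine setIntegral_mono_on ?_ (integrable_exp_neg_mul_sq hc).integrableOn
            measurableSet_Ioc fun s hs => ?_
          · refine Integrable.mono' (g := fun _ => (1 : ℝ)) (integrable_const 1) ?_ ?_
            · refine AEStronglyMeasurable.mul (by fun_prop) ?_
              have : IsProbabilityMeasure (ρ.map fun x_1 => x_1 + -x) :=
                Measure.isProbabilityMeasure_map (by fun_prop)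
              exact (Complex.measurable_re.comp measurable_charFun).aestronglyMeasurable
            · filter_upwards [ae_restrict_mem measurableSet_Ioc] with s hs
              have : IsProbabilityMeasure (ρ.map fun x_1 => x_1 + -x) :=
                Measure.isProbabilityMeasure_map (by fun_prop)
              have h1 : |s| / η ≤ 1 := by
                rw [div_le_one hη]; exact abs_le.2 ⟨hs.1.le, hs.2⟩
              have h2 : |1 - |s| / η| ≤ 1 := by
                rw [abs_of_nonneg (by linarith)]
                have : 0 ≤ |s| / η := by positivity
                linarith
              rw [norm_mul, Real.norm_eq_abs]
              refine mul_le_one₀ h2 (norm_nonneg _) ?_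
              exact (Complex.abs_re_le_norm _).trans (norm_charFun_le_one s)
          · have hs' : |s| ≤ η := abs_le.2 ⟨hs.1.le, hs.2⟩
            have h3 : ‖charFun (ρ.map fun x_1 => x_1 + -x) s‖ ≤ Real.exp (-c * s ^ 2) := by
              rw [charFun_map_add_const, norm_mul, Complex.norm_exp_ofReal_mul_I, mul_one]
              exact h s hs'
            have h4 : 0 ≤ 1 - |s| / η := by
              have : |s| / η ≤ 1 := by rwa [div_le_one hη]
              linarith
            have h5 : 1 - |s| / η ≤ 1 := by
              have : 0 ≤ |s| / η := by positivity
              linarith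
            calc _ ≤ (1 - |s| / η) * Real.exp (-c * s ^ 2) := by
                  gcongr
                  exact (Complex.re_le_norm _).trans h3
              _ ≤ 1 * Real.exp (-c * s ^ 2) := by gcongr
              _ = _ := one_mul _
      _ ≤ ∫ s, Real.exp (-c * s ^ 2) :=
          setIntegral_le_integral (integrable_exp_neg_mul_sq hc)
            (ae_of_all _ fun s => (Real.exp_pos _).le)
  rw [← ofReal_measureReal]
  refine ENNReal.ofReal_le_ofReal ?_
  have h3 := h1.trans h2
  rw [← le_div_iff₀ (by positivity)] at h3
  refine h3.trans_eq ?_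
  field_simp

/-! ### Random walks: concentration and a local lower bound -/

/-- The law of a random walk with step law `ρ` after `n` steps. -/
def convPow (ρ : Measure ℝ) : ℕ → Measure ℝ
  | 0 => Measure.dirac 0
  | n + 1 => ρ ∗ convPow ρ n

instance (ρ : Measure ℝ) [IsProbabilityMeasure ρ] (n : ℕ) : IsProbabilityMeasure (convPow ρ n) := by
  induction n with
  | zero => unfold convPow; infer_instance
  | succ n ih => unfold convPow; infer_instance

theorem charFun_convPow (ρ : Measure ℝ) [IsProbabilityMeasure ρ] (n : ℕ) (s : ℝ) :
    charFun (convPow ρ n) s = charFun ρ s ^ n := by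
  induction n with
  | zero => simp [convPow]
  | succ n ih => rw [convPow, charFun_conv, ih, pow_succ']

/-- The characteristic function of the law `ρ` centred at `a`. -/
def centeredCharFun (ρ : Measure ℝ) (a s : ℝ) : ℂ := charFun (ρ.map fun x => x + -a) s

theorem centeredCharFun_eq (ρ : Measure ℝ) (a s : ℝ) :
    centeredCharFun ρ a s = charFun ρ s * Complex.exp ((-(a * s) : ℝ) * Complex.I) := by
  rw [centeredCharFun, charFun_map_add_const]
  simp [mul_comm]

theorem norm_centeredCharFun (ρ : Measure ℝ) (a s : ℝ) :
    ‖centeredCharFun ρ a s‖ = ‖charFun ρ s‖ := by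
  rw [centeredCharFun_eq, norm_mul, Complex.norm_exp_ofReal_mul_I, mul_one]

theorem centeredCharFun_isLittleO (ρ : Measure ℝ) [IsProbabilityMeasure ρ] (hρ : MemLp id 2 ρ)
    {a : ℝ} (ha : ∫ x, x ∂ρ = a) :
    (fun s => centeredCharFun ρ a s - (1 - ((∫ x, (x - a) ^ 2 ∂ρ : ℝ) : ℂ) * s ^ 2 / 2))
      =o[𝓝 0] fun s : ℝ => s ^ 2 := by
  have hX : AEMeasurable (fun x : ℝ => x + -a) ρ := by fun_prop
  have hint : MemLp id 2 (ρ.map fun x => x + -a) := by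
    rw [memLp_map_measure_iff (by fun_prop) hX]
    exact hρ.add (memLp_const (-a))
  have h0 : ∫ x, (x + -a) ∂ρ = 0 := by
    have hint1 : Integrable (fun x : ℝ => x) ρ := hρ.integrable (by norm_num)
    rw [integral_add hint1 (integrable_const _)]
    simp [ha]
  have := Measure.isProbabilityMeasure_map hX
  have h1 := taylor_isLittleO_univ (x₀ := (0 : ℝ)) (n := 2) (contDiff_charFun hint)
  simp_rw [taylorWithinEval_charFun_two_zero hX hint, h0] at h1
  simpa [centeredCharFun, sub_eq_add_neg] using h1

/-- Centring does not change the modulus, and the centred characteristic function is `1 - v s² / 2 +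
o(s²)` with `v > 0`. -/
theorem exists_norm_charFun_le (ρ : Measure ℝ) [IsProbabilityMeasure ρ] (hρ : MemLp id 2 ρ)
    {a : ℝ} (ha : ∫ x, x ∂ρ = a) (hv : 0 < ∫ x, (x - a) ^ 2 ∂ρ) :
    ∃ η c : ℝ, 0 < η ∧ η ≤ 1 ∧ 0 < c ∧
      ∀ s : ℝ, |s| ≤ η → ‖charFun ρ s‖ ≤ Real.exp (-c * s ^ 2) := by
  set v := ∫ x, (x - a) ^ 2 ∂ρ
  have h1 := (centeredCharFun_isLittleO ρ hρ ha).def (show 0 < v / 4 by positivity)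
  obtain ⟨δ, hδ, h2⟩ := Metric.eventually_nhds_iff.1 h1
  -- Half of the quadratic term `v / 2` absorbs the error `v / 4`. The bound `1 / (1 + v)` keeps `1
  -- - v s² / 2` nonnegative, so that it equals its modulus.
  refine ⟨min (δ / 2) (min 1 (1 / (1 + v))), v / 4, by positivity, ?_, by positivity, fun s hs => ?_⟩
  · exact (min_le_right _ _).trans (min_le_left _ _)
  · have hsδ : |s| < δ := by
      have := hs.trans (min_le_left _ _)
      linarith
    have hs1 : |s| ≤ 1 := hs.trans ((min_le_right _ _).trans (min_le_left _ _))
    have hsv : |s| ≤ 1 / (1 + v) := hs.trans ((min_le_right _ _).trans (min_le_right _ _))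
    have h3 := h2 (y := s) (by simpa using hsδ)
    have h4 : s ^ 2 * v ≤ 1 := by
      rw [le_div_iff₀ (by positivity)] at hsv
      rw [← sq_abs]
      nlinarith [abs_nonneg s]
    have h5 : ‖(1 - (v : ℂ) * s ^ 2 / 2 : ℂ)‖ = 1 - v * s ^ 2 / 2 := by
      rw [show (1 - (v : ℂ) * s ^ 2 / 2 : ℂ) = ((1 - v * s ^ 2 / 2 : ℝ) : ℂ) by push_cast; ring,
        Complex.norm_real, Real.norm_eq_abs, abs_of_nonneg (by linarith)]
    rw [← norm_centeredCharFun ρ a]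
    have h6 : ‖centeredCharFun ρ a s‖ ≤ (1 - v * s ^ 2 / 2) + v / 4 * ‖s ^ 2‖ := by
      rw [← h5]
      refine le_trans ?_ (add_le_add_right h3 _)
      refine le_trans (le_of_eq ?_) (norm_add_le _ _)
      congr 1
      ring
    rw [Real.norm_eq_abs, abs_of_nonneg (sq_nonneg s)] at h6
    have h7 := Real.add_one_le_exp (-(v / 4) * s ^ 2)
    linarith

theorem exists_convPow_Ioc_le (ρ : Measure ℝ) [IsProbabilityMeasure ρ] (hρ : MemLp id 2 ρ)
    {a : ℝ} (ha : ∫ x, x ∂ρ = a) (hv : 0 < ∫ x, (x - a) ^ 2 ∂ρ) :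
    ∃ C : ℝ, 0 < C ∧ ∀ n : ℕ, 0 < n → ∀ x : ℝ,
      convPow ρ n (Set.Ioc x (x + 1)) ≤ ENNReal.ofReal (C / Real.sqrt n) := by
  obtain ⟨η, c, hη, hη1, hc, h⟩ := exists_norm_charFun_le ρ hρ ha hv
  have hpi := Real.pi_pos
  refine ⟨2 / η * Real.sqrt (Real.pi / c), by positivity, fun n hn x => ?_⟩
  have hn' : (0 : ℝ) < n := by exact_mod_cast hn
  refine (measure_Ioc_le_of_norm_charFun_le (convPow ρ n) hη hη1 (c := n * c) (by positivity)
    (fun s hs => ?_) x).trans_eq ?_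
  · rw [charFun_convPow, norm_pow]
    calc ‖charFun ρ s‖ ^ n ≤ Real.exp (-c * s ^ 2) ^ n := by
          gcongr; exact h s hs
      _ = _ := by rw [← Real.exp_nat_mul]; ring_nf
  · congr 1
    rw [show Real.pi / (n * c) = Real.pi / c / n by field_simp, Real.sqrt_div (by positivity)]
    ring

/-- A uniform bound on windows survives convolution. This allows either of the two phases alone to
supply the factor `n^{-1/2}`. -/
theorem conv_Ioc_le (α β : Measure ℝ) [SFinite β] {H : ℝ} {K : ℝ≥0∞}
    (h : ∀ x, β (Set.Ioc x (x + H)) ≤ K) (x : ℝ) :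
    (α ∗ β) (Set.Ioc x (x + H)) ≤ α Set.univ * K := by
  rw [conv_apply_eq_lintegral _ _ measurableSet_Ioc]
  simp_rw [preimage_const_add_Ioc', add_sub_right_comm]
  calc _ ≤ ∫⁻ _, K ∂α := lintegral_mono fun u => h _
    _ = _ := by rw [lintegral_const, mul_comm]

theorem tendsto_one_add_pow_exp_of_tendsto_mul {z : ℕ → ℂ} {k : ℕ → ℕ} {w : ℂ}
    (hz : Tendsto z atTop (𝓝 0)) (hk : Tendsto (fun n => k n * z n) atTop (𝓝 w)) :
    Tendsto (fun n => (1 + z n) ^ k n) atTop (𝓝 (Complex.exp w)) := by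
  have h1 : (fun n => Complex.log (1 + z n) - z n) =O[atTop] fun n => z n ^ 2 :=
    Complex.log_sub_self_isBigO.comp_tendsto hz
  have h2 : Tendsto (fun n => (k n : ℂ) * (Complex.log (1 + z n) - z n)) atTop (𝓝 0) := by
    have h3 : (fun n => (k n : ℂ) * (Complex.log (1 + z n) - z n)) =O[atTop]
        fun n => (k n * z n) * z n := by
      refine ((Asymptotics.isBigO_refl (fun n => (k n : ℂ)) atTop).mul h1).congr_right fun n => ?_
      ring
    refine h3.trans_tendsto ?_
    simpa using hk.mul hz
  have h4 : Tendsto (fun n => (k n : ℂ) * Complex.log (1 + z n)) atTop (𝓝 w) := by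
    have := h2.add hk
    rw [zero_add] at this
    refine this.congr fun n => by ring
  refine ((Complex.continuous_exp.tendsto _).comp h4).congr' ?_
  filter_upwards [hz.eventually_ne (show (0 : ℂ) ≠ -1 by simp)] with n hn
  have : 1 + z n ≠ 0 := fun h => hn (by linear_combination h)
  simp only [Function.comp]
  rw [Complex.exp_nat_mul, Complex.exp_log this]

theorem tendsto_centeredCharFun_pow (ρ : Measure ℝ) [IsProbabilityMeasure ρ] (hρ : MemLp id 2 ρ)
    {a : ℝ} (ha : ∫ x, x ∂ρ = a) {k : ℕ → ℕ} {t : ℝ}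
    (hk : Tendsto (fun n => (k n : ℝ) / n) atTop (𝓝 t)) (r : ℝ) :
    Tendsto (fun n : ℕ => centeredCharFun ρ a (r / Real.sqrt n) ^ k n) atTop
      (𝓝 (Complex.exp ((-((∫ x, (x - a) ^ 2 ∂ρ) * t * r ^ 2 / 2) : ℝ) : ℂ))) := by
  set v := ∫ x, (x - a) ^ 2 ∂ρ
  have hs : Tendsto (fun n : ℕ => r / Real.sqrt n) atTop (𝓝 0) :=
    tendsto_const_nhds.div_atTop (Real.tendsto_sqrt_atTop.comp tendsto_natCast_atTop_atTop)
  have hks : Tendsto (fun n : ℕ => (k n : ℝ) * (r / Real.sqrt n) ^ 2) atTop (𝓝 (t * r ^ 2)) := by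
    refine (hk.mul_const (r ^ 2)).congr fun n => ?_
    rw [div_pow, Real.sq_sqrt (Nat.cast_nonneg n)]
    ring
  have hR := (centeredCharFun_isLittleO ρ hρ ha).comp_tendsto hs
  set R : ℕ → ℂ := fun n => centeredCharFun ρ a (r / Real.sqrt n) -
    (1 - (v : ℂ) * ((r / Real.sqrt n : ℝ) : ℂ) ^ 2 / 2) with hRdef
  have hR0 : Tendsto R atTop (𝓝 0) := hR.trans_tendsto (by simpa [Function.comp_def] using hs.pow 2)
  have hkR : Tendsto (fun n => (k n : ℂ) * R n) atTop (𝓝 0) := by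
    have h1 : (fun n => (k n : ℂ)) =O[atTop] fun n => (k n : ℝ) :=
      Asymptotics.IsBigO.of_norm_le fun n => by simp
    have h2 := h1.mul_isLittleO hR
    exact (Asymptotics.isLittleO_one_iff ℝ).1 (h2.trans_isBigO (hks.isBigO_one ℝ))
  have hz : ∀ n : ℕ, centeredCharFun ρ a (r / Real.sqrt n) =
      1 + (R n - (v : ℂ) * ((r / Real.sqrt n : ℝ) : ℂ) ^ 2 / 2) := fun n => by
    simp only [hRdef]; ring
  simp_rw [hz]
  have hsc : Tendsto (fun n : ℕ => ((r / Real.sqrt n : ℝ) : ℂ) ^ 2) atTop (𝓝 0) := by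
    have := (Complex.continuous_ofReal.tendsto (0 : ℝ)).comp (by simpa using hs.pow 2)
    simpa [Function.comp_def] using this
  have hksc : Tendsto (fun n : ℕ => (k n : ℂ) * ((r / Real.sqrt n : ℝ) : ℂ) ^ 2) atTop
      (𝓝 ((t * r ^ 2 : ℝ) : ℂ)) := by
    refine ((Complex.continuous_ofReal.tendsto _).comp hks).congr fun n => ?_
    simp [Function.comp]
  refine tendsto_one_add_pow_exp_of_tendsto_mul ?_ ?_
  · simpa using hR0.sub ((hsc.const_mul (v : ℂ)).div_const 2)
  · have := hkR.sub ((hksc.const_mul (v : ℂ)).div_const 2)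
    rw [show ((-(v * t * r ^ 2 / 2) : ℝ) : ℂ) = 0 - (v : ℂ) * ((t * r ^ 2 : ℝ) : ℂ) / 2 by
      push_cast; ring]
    exact this.congr fun n => by ring

theorem charFun_conv_convPow_sub (π π' : Measure ℝ) [IsProbabilityMeasure π]
    [IsProbabilityMeasure π'] (a a' : ℝ) (k m : ℕ) (w s : ℝ) :
    charFun ((convPow π k ∗ convPow π' m).map fun x => x + -w) s =
      centeredCharFun π a s ^ k * centeredCharFun π' a' s ^ m *
        Complex.exp ((-((w - k * a - m * a') * s) : ℝ) * Complex.I) := by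
  rw [charFun_map_add_const, charFun_conv, charFun_convPow, charFun_convPow, centeredCharFun_eq,
    centeredCharFun_eq, mul_pow, mul_pow, ← Complex.exp_nat_mul, ← Complex.exp_nat_mul]
  have : Complex.exp (((inner ℝ (-w) s : ℝ) : ℂ) * Complex.I) =
      Complex.exp (k * ((-(a * s) : ℝ) * Complex.I)) *
      Complex.exp (m * ((-(a' * s) : ℝ) * Complex.I)) *
        Complex.exp ((-((w - k * a - m * a') * s) : ℝ) * Complex.I) := by
    rw [← Complex.exp_add, ← Complex.exp_add]
    congr 1
    simp
    ring
  rw [this]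
  ring

/-- Fourier inversion for a smoothed indicator: after the substitution `s = r / √n` the central
limit theorem gives pointwise convergence to a Gaussian. The decay of the first characteristic
function alone provides domination; the second is bounded by one. -/
theorem tendsto_sqrt_mul_integral_fejer (π π' : Measure ℝ) [IsProbabilityMeasure π]
    [IsProbabilityMeasure π'] (hπ : MemLp id 2 π) (hπ' : MemLp id 2 π') {a a' : ℝ}
    (ha : ∫ x, x ∂π = a) (ha' : ∫ x, x ∂π' = a') {η c : ℝ} (hη : 0 < η) (hc : 0 < c)
    (h : ∀ s : ℝ, |s| ≤ η → ‖charFun π s‖ ≤ Real.exp (-c * s ^ 2)) {t t' : ℝ} (ht : 0 < t)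
    {k m : ℕ → ℕ} (hk : Tendsto (fun n => (k n : ℝ) / n) atTop (𝓝 t))
    (hm : Tendsto (fun n => (m n : ℝ) / n) atTop (𝓝 t')) {w : ℕ → ℝ}
    (hw : Tendsto (fun n => (w n - k n * a - m n * a') / Real.sqrt n) atTop (𝓝 0)) :
    Tendsto (fun n : ℕ => Real.sqrt n *
        ∫ x, fejer η (x - w n) ∂(convPow π (k n) ∗ convPow π' (m n))) atTop
      (𝓝 (∫ r : ℝ, Real.exp (-(((∫ x, (x - a) ^ 2 ∂π) * t + (∫ x, (x - a') ^ 2 ∂π') * t') / 2) *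
        r ^ 2))) := by
  set v := ∫ x, (x - a) ^ 2 ∂π
  set v' := ∫ x, (x - a') ^ 2 ∂π'
  let Q : ℕ → ℝ → ℂ := fun n s => centeredCharFun π a s ^ k n * centeredCharFun π' a' s ^ m n *
        Complex.exp ((-((w n - k n * a - m n * a') * s) : ℝ) * Complex.I)
  let f : ℕ → ℝ → ℝ := fun n =>
    (Set.Ioc (-η) η).indicator fun s => (1 - |s| / η) * (Q n s).re
  have hfm (n : ℕ) : Measurable (f n) := by
    refine Measurable.indicator ?_ measurableSet_Ioc
    refine Measurable.mul (by fun_prop) (Complex.measurable_re.comp ?_)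
    have hmeas (ρ : Measure ℝ) [IsProbabilityMeasure ρ] (b : ℝ) :
        Measurable fun s => centeredCharFun ρ b s := by
      have : IsProbabilityMeasure (ρ.map fun x => x + -b) :=
        Measure.isProbabilityMeasure_map (by fun_prop)
      exact measurable_charFun
    exact (((hmeas π a).pow_const _).mul ((hmeas π' a').pow_const _)).mul (by fun_prop)
  have hQ (n : ℕ) (s : ℝ) (hs : |s| ≤ η) : ‖Q n s‖ ≤ Real.exp (-c * s ^ 2) ^ k n := by
    simp only [Q]
    rw [norm_mul, Complex.norm_exp_ofReal_mul_I, mul_one, norm_mul, norm_pow, norm_pow,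
      norm_centeredCharFun, norm_centeredCharFun]
    calc ‖charFun π s‖ ^ k n * ‖charFun π' s‖ ^ m n ≤ Real.exp (-c * s ^ 2) ^ k n * 1 := by
          gcongr
          · exact h s hs
          · exact pow_le_one₀ (norm_nonneg _) (norm_charFun_le_one _)
      _ = _ := mul_one _
  have hfb (n : ℕ) (s : ℝ) : ‖f n s‖ ≤ Real.exp (-c * s ^ 2) ^ k n := by
    simp only [f]
    by_cases hs : s ∈ Set.Ioc (-η) η
    · rw [Set.indicator_of_mem hs, norm_mul]
      have hs' : |s| ≤ η := abs_le.2 ⟨hs.1.le, hs.2⟩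
      have h1 : |s| / η ≤ 1 := by rwa [div_le_one hη]
      have h2 : ‖1 - |s| / η‖ ≤ 1 := by
        rw [Real.norm_eq_abs, abs_of_nonneg (by linarith)]
        have : 0 ≤ |s| / η := by positivity
        linarith
      calc _ ≤ 1 * Real.exp (-c * s ^ 2) ^ k n := by
            gcongr
            exact (Complex.abs_re_le_norm _).trans (hQ n s hs')
        _ = _ := one_mul _
    · rw [Set.indicator_of_notMem hs]
      simp only [norm_zero]
      positivity
  have heq : ∀ᶠ n : ℕ in atTop, ∫ r, f n (r / Real.sqrt n) = Real.sqrt n *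
      ∫ x, fejer η (x - w n) ∂(convPow π (k n) ∗ convPow π' (m n)) := by
    filter_upwards with n
    rw [Measure.integral_comp_div, abs_of_nonneg (Real.sqrt_nonneg _), smul_eq_mul,
      integral_fejer_sub _ hη, intervalIntegral.integral_of_le (show -η ≤ η by linarith),
      integral_indicator measurableSet_Ioc]
    congr 1
    refine integral_congr_ae (ae_of_all _ fun s => ?_)
    simp only [Q]
    rw [charFun_conv_convPow_sub π π' a a']
  refine Tendsto.congr' heq ?_
  refine tendsto_integral_filter_of_dominated_convergence
    (fun r => Real.exp (-(c * (t / 2)) * r ^ 2)) ?_ ?_ ?_ ?_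
  · exact Eventually.of_forall fun n => ((hfm n).comp (by fun_prop)).aestronglyMeasurable
  -- Eventually `k n ≥ (t / 2) n`, so the `k n`-th power of the Gaussian bound at `r / √n` is below
  -- a fixed Gaussian in `r`.
  · filter_upwards [hk.eventually (lt_mem_nhds (show t / 2 < t by linarith)),
      eventually_gt_atTop 0] with n hn hn0
    refine ae_of_all _ fun r => (hfb n _).trans ?_
    have hn0' : (0 : ℝ) < n := by exact_mod_cast hn0
    rw [← Real.exp_nat_mul, div_pow, Real.sq_sqrt hn0'.le]
    refine Real.exp_le_exp.2 ?_
    have h1 : (k n : ℝ) * (-c * (r ^ 2 / n)) = -(c * (k n / n)) * r ^ 2 := by ring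
    rw [h1]
    have h2 : c * (t / 2) ≤ c * (k n / n) := by gcongr
    nlinarith [sq_nonneg r]
  · exact integrable_exp_neg_mul_sq (by positivity)
  · refine ae_of_all _ fun r => ?_
    have hs : Tendsto (fun n : ℕ => r / Real.sqrt n) atTop (𝓝 0) :=
      tendsto_const_nhds.div_atTop (Real.tendsto_sqrt_atTop.comp tendsto_natCast_atTop_atTop)
    have h1 := tendsto_centeredCharFun_pow π hπ ha hk r
    have h2 := tendsto_centeredCharFun_pow π' hπ' ha' hm r
    have h3 : Tendsto (fun n : ℕ => Complex.exp
        ((-((w n - k n * a - m n * a') * (r / Real.sqrt n)) : ℝ) * Complex.I)) atTop (𝓝 1) := by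
      have h4 : Tendsto (fun n : ℕ => -((w n - k n * a - m n * a') * (r / Real.sqrt n))) atTop
          (𝓝 0) := by
        have := (hw.mul_const r).neg
        simp only [zero_mul, neg_zero] at this
        exact this.congr fun n => by ring
      have h5 : Continuous fun u : ℝ => Complex.exp ((u : ℂ) * Complex.I) := by fun_prop
      have h6 := (h5.tendsto 0).comp h4
      rw [Complex.ofReal_zero, zero_mul, Complex.exp_zero] at h6
      exact h6
    have h6 := ((Complex.continuous_re.tendsto _).comp ((h1.mul h2).mul h3))
    have h7 : Tendsto (fun n : ℕ => 1 - |r / Real.sqrt n| / η) atTop (𝓝 1) := by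
      simpa using (hs.abs.div_const η).const_sub 1
    have h8 := h7.mul h6
    have h9 : ∀ᶠ n : ℕ in atTop, r / Real.sqrt n ∈ Set.Ioc (-η) η :=
      hs.eventually (Ioc_mem_nhds (by linarith) hη)
    have h10 : (1 : ℝ) * (Complex.exp ((-(v * t * r ^ 2 / 2) : ℝ) : ℂ) *
        Complex.exp ((-(v' * t' * r ^ 2 / 2) : ℝ) : ℂ) * 1).re =
        Real.exp (-((v * t + v' * t') / 2) * r ^ 2) := by
      rw [one_mul, mul_one, ← Complex.exp_add, ← Complex.ofReal_add, Complex.exp_ofReal_re]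
      congr 1
      ring
    rw [h10] at h8
    refine h8.congr' ?_
    filter_upwards [h9] with n hn
    simp only [f, Set.indicator_of_mem hn, Q, Function.comp]

theorem lintegral_iUnion_le_tsum {ρ : Measure ℝ} {K : ℝ≥0∞} {S : ℕ → Set ℝ} {a : ℕ → ℝ≥0∞}
    {f : ℝ → ℝ≥0∞} (hS : ∀ j, MeasurableSet (S j)) (hK : ∀ j, ρ (S j) ≤ K)
    (hf : ∀ j, ∀ x ∈ S j, f x ≤ a j) : ∫⁻ x in ⋃ j, S j, f x ∂ρ ≤ K * ∑' j, a j := by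
  calc ∫⁻ x in ⋃ j, S j, f x ∂ρ ≤ ∑' j, ∫⁻ x in S j, f x ∂ρ := lintegral_iUnion_le _ _
    _ ≤ ∑' j, K * a j := by
        refine ENNReal.tsum_le_tsum fun j => ?_
        calc ∫⁻ x in S j, f x ∂ρ ≤ ∫⁻ x in S j, a j ∂ρ := setLIntegral_mono' (hS j) (hf j)
          _ = a j * ρ (S j) := by rw [setLIntegral_const]
          _ ≤ K * a j := by rw [mul_comm]; gcongr; exact hK j
    _ = _ := ENNReal.tsum_mul_left

theorem Ioi_subset_iUnion_Ioc (x : ℝ) :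
    Set.Ioi x ⊆ ⋃ j : ℕ, Set.Ioc (x + j) (x + j + 1) := by
  intro u hu
  have hu' : 0 < u - x := sub_pos.2 hu
  have h1 : 1 ≤ ⌈u - x⌉₊ := Nat.one_le_ceil_iff.2 hu'
  have h2 := Nat.le_ceil (u - x)
  have h3 := Nat.ceil_lt_add_one hu'.le
  refine Set.mem_iUnion.2 ⟨⌈u - x⌉₊ - 1, ?_, ?_⟩ <;> push_cast [h1] <;> linarith

theorem Iic_subset_iUnion_Ioc (x : ℝ) :
    Set.Iic x ⊆ ⋃ j : ℕ, Set.Ioc (x - j - 1) (x - j - 1 + 1) := by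
  intro u hu
  have hu' : 0 ≤ x - u := sub_nonneg.2 hu
  have h2 := Nat.floor_le hu'
  have h3 := Nat.lt_floor_add_one (x - u)
  exact Set.mem_iUnion.2 ⟨⌊x - u⌋₊, by linarith, by linarith⟩

/-- Far from its centre the kernel decays quadratically. Unit windows of mass at most `K` then
contribute the tail of a convergent series, which is small for large `R`. -/
theorem lintegral_fejer_le (ρ : Measure ℝ) {K : ℝ≥0∞} (hK : ∀ x, ρ (Set.Ioc x (x + 1)) ≤ K)
    {η : ℝ} (hη : 0 < η) (w : ℝ) {R : ℕ} (hR : 0 < R) :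
    ∫⁻ x, ENNReal.ofReal (fejer η (x - w)) ∂ρ ≤
      ENNReal.ofReal η * ρ (Set.Ioc (w - R) (w - R + 2 * R)) +
        2 * (K * ∑' j : ℕ, ENNReal.ofReal (4 / (η * ((j + R : ℕ) : ℝ) ^ 2))) := by
  set f : ℝ → ℝ≥0∞ := fun x => ENNReal.ofReal (fejer η (x - w))
  set a : ℕ → ℝ≥0∞ := fun j => ENNReal.ofReal (4 / (η * ((j + R : ℕ) : ℝ) ^ 2))
  have hR' : (0 : ℝ) < R := by exact_mod_cast hR
  have hfa (j : ℕ) (x : ℝ) (hx : (j : ℝ) + R ≤ |x - w|) : f x ≤ a j := by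
    refine ENNReal.ofReal_le_ofReal ?_
    have hj : (0 : ℝ) ≤ j := Nat.cast_nonneg j
    have hx0 : x - w ≠ 0 := by
      intro h0
      rw [h0, abs_zero] at hx
      linarith
    refine (fejer_le_div hη hx0).trans ?_
    rw [← sq_abs (x - w)]
    push_cast
    gcongr
  have hcover : (Set.univ : Set ℝ) ⊆ Set.Ioc (w - R) (w - R + 2 * R) ∪
      ((⋃ j : ℕ, Set.Ioc (w + R + j) (w + R + j + 1)) ∪
        ⋃ j : ℕ, Set.Ioc (w - R - j - 1) (w - R - j - 1 + 1)) := by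
    intro x _
    rcases le_or_gt x (w - R) with h1 | h1
    · exact Or.inr (Or.inr (Iic_subset_iUnion_Ioc _ h1))
    · rcases le_or_gt x (w + R) with h2 | h2
      · exact Or.inl ⟨h1, by linarith⟩
      · exact Or.inr (Or.inl (Ioi_subset_iUnion_Ioc _ h2))
  calc ∫⁻ x, f x ∂ρ = ∫⁻ x in Set.univ, f x ∂ρ := by rw [Measure.restrict_univ]
    _ ≤ _ := lintegral_mono_set hcover
    _ ≤ ∫⁻ x in Set.Ioc (w - R) (w - R + 2 * R), f x ∂ρ +
        (∫⁻ x in ⋃ j : ℕ, Set.Ioc (w + R + j) (w + R + j + 1), f x ∂ρ +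
        ∫⁻ x in ⋃ j : ℕ, Set.Ioc (w - R - j - 1) (w - R - j - 1 + 1), f x ∂ρ) :=
      (lintegral_union_le _ _ _).trans (add_le_add_right (lintegral_union_le _ _ _) _)
    _ ≤ ENNReal.ofReal η * ρ (Set.Ioc (w - R) (w - R + 2 * R)) +
        (K * ∑' j, a j + K * ∑' j, a j) := by
      gcongr
      · rw [← setLIntegral_const]
        exact setLIntegral_mono' measurableSet_Ioc fun x _ =>
          ENNReal.ofReal_le_ofReal (fejer_le hη _)
      · refine lintegral_iUnion_le_tsum (fun j => measurableSet_Ioc) (fun j => hK _)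
          fun j x hx => hfa j x ?_
        exact le_trans (by linarith [hx.1]) (le_abs_self _)
      · refine lintegral_iUnion_le_tsum (fun j => measurableSet_Ioc) (fun j => hK _)
          fun j x hx => hfa j x ?_
        exact le_trans (by linarith [hx.2]) (neg_le_abs _)
    _ = _ := by rw [two_mul (K * _)]

theorem tendsto_tsum_ofReal_div_sq (b : ℝ) :
    Tendsto (fun R : ℕ => ∑' j : ℕ, ENNReal.ofReal (b / ((j + R : ℕ) : ℝ) ^ 2)) atTop (𝓝 0) := by
  refine ENNReal.tendsto_sum_nat_add (fun j : ℕ => ENNReal.ofReal (b / (j : ℝ) ^ 2)) ?_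
  have : Summable fun j : ℕ => b / (j : ℝ) ^ 2 :=
    ((Real.summable_nat_pow_inv (p := 2)).2 (by norm_num)).mul_left b
  exact this.tsum_ofReal_ne_top

theorem convPow_conv_comm (π π' : Measure ℝ) [IsProbabilityMeasure π] [IsProbabilityMeasure π']
    (k m : ℕ) : convPow π k ∗ convPow π' m = convPow π' m ∗ convPow π k :=
  Measure.conv_comm _ _

/-- A lower bound of local limit type for the sum of two random walks. -/
theorem exists_local_lower_bound (π π' : Measure ℝ) [IsProbabilityMeasure π]
    [IsProbabilityMeasure π'] (hπ : MemLp id 2 π) (hπ' : MemLp id 2 π') {a a' : ℝ}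
    (ha : ∫ x, x ∂π = a) (ha' : ∫ x, x ∂π' = a') (hv : 0 < ∫ x, (x - a) ^ 2 ∂π)
    {t t' : ℝ} (ht : 0 < t) (ht' : 0 ≤ t') :
    ∃ c H : ℝ, 0 < c ∧ 0 < H ∧ ∀ (k m : ℕ → ℕ) (w : ℕ → ℝ),
      Tendsto (fun n => (k n : ℝ) / n) atTop (𝓝 t) →
      Tendsto (fun n => (m n : ℝ) / n) atTop (𝓝 t') →
      Tendsto (fun n : ℕ => (w n - k n * a - m n * a') / Real.sqrt n) atTop (𝓝 0) →
      ∀ᶠ n : ℕ in atTop, ENNReal.ofReal (c / Real.sqrt n) ≤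
        (convPow π (k n) ∗ convPow π' (m n)) (Set.Ioc (w n) (w n + H)) := by
  obtain ⟨η, c₀, hη, hη1, hc₀, h⟩ := exists_norm_charFun_le π hπ ha hv
  obtain ⟨C, hC, hconc⟩ := exists_convPow_Ioc_le π hπ ha hv
  set V := ((∫ x, (x - a) ^ 2 ∂π) * t + (∫ x, (x - a') ^ 2 ∂π') * t') / 2 with hVdef
  have hv' : 0 ≤ ∫ x, (x - a') ^ 2 ∂π' := integral_nonneg fun x => sq_nonneg _
  have hV : 0 < V := by positivity
  set I₀ := ∫ r : ℝ, Real.exp (-V * r ^ 2)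
  have hI₀ : 0 < I₀ := by
    have hpi := Real.pi_pos
    simp only [I₀, integral_gaussian]
    positivity
  set C₂ := C * Real.sqrt (2 / t)
  have hC₂ : 0 < C₂ := by positivity
  -- The kernel integral will exceed `I₀ / (2√n)`. This `R` makes the two outer tails together at
  -- most `I₀ / (4√n)`, and since the kernel is at most `η`, the window keeps mass at least `I₀ /
  -- (4η√n)`.
  obtain ⟨R, hRS, hR⟩ := (((tendsto_tsum_ofReal_div_sq (4 / η)).eventually
    (ge_mem_nhds (show (0 : ℝ≥0∞) < ENNReal.ofReal (I₀ / (8 * C₂)) by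
      rw [ENNReal.ofReal_pos]; positivity))).and (eventually_gt_atTop 0)).exists
  have hR' : (0 : ℝ) < R := by exact_mod_cast hR
  refine ⟨I₀ / (4 * η), 2 * R, by positivity, by positivity, fun k m w hk hm hw => ?_⟩
  -- The kernel is centred at the midpoint `w n + R` of the window, a bounded shift that is
  -- negligible against `√n`.
  have hw' : Tendsto (fun n : ℕ => ((w n + R) - k n * a - m n * a') / Real.sqrt n) atTop (𝓝 0) := by
    have h1 : Tendsto (fun n : ℕ => (R : ℝ) / Real.sqrt n) atTop (𝓝 0) :=
      tendsto_const_nhds.div_atTop (Real.tendsto_sqrt_atTop.comp tendsto_natCast_atTop_atTop)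
    have h2 := hw.add h1
    rw [add_zero] at h2
    exact h2.congr fun n => by ring
  have hlim := tendsto_sqrt_mul_integral_fejer π π' hπ hπ' ha ha' hη hc₀ h ht hk hm hw'
  filter_upwards [hlim.eventually (lt_mem_nhds (show I₀ / 2 < I₀ by linarith)),
    hk.eventually (lt_mem_nhds (show t / 2 < t by linarith)), eventually_gt_atTop 0]
    with n hn hkn hn0
  set ρ := convPow π (k n) ∗ convPow π' (m n) with hρ
  have hn0' : (0 : ℝ) < n := by exact_mod_cast hn0
  have hsq : 0 < Real.sqrt n := Real.sqrt_pos.2 hn0'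
  have hkn' : t / 2 * n < k n := by rwa [lt_div_iff₀ hn0'] at hkn
  have hk0 : (0 : ℝ) < k n := lt_trans (by positivity) hkn'
  have hK (x : ℝ) : ρ (Set.Ioc x (x + 1)) ≤ ENNReal.ofReal (C₂ / Real.sqrt n) := by
    rw [hρ, convPow_conv_comm]
    refine (conv_Ioc_le _ _ (fun x => hconc (k n) (by exact_mod_cast hk0) x) x).trans ?_
    rw [measure_univ, one_mul]
    refine ENNReal.ofReal_le_ofReal ?_
    rw [div_le_div_iff₀ (Real.sqrt_pos.2 hk0) hsq]
    simp only [C₂]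
    rw [mul_assoc, ← Real.sqrt_mul (by positivity)]
    gcongr
    rw [div_mul_eq_mul_div, le_div_iff₀ ht]
    linarith
  have h1 := lintegral_fejer_le ρ hK hη (w n + R) hR
  rw [← ofReal_integral_eq_lintegral_ofReal (integrable_fejer ρ hη _)
    (ae_of_all _ fun x => fejer_nonneg hη _)] at h1
  have h2 : 2 * (ENNReal.ofReal (C₂ / Real.sqrt n) *
      ∑' j : ℕ, ENNReal.ofReal (4 / (η * ((j + R : ℕ) : ℝ) ^ 2))) ≤
      ENNReal.ofReal (I₀ / 4 / Real.sqrt n) := by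
    simp_rw [← div_div (4 : ℝ) η]
    calc _ ≤ 2 * (ENNReal.ofReal (C₂ / Real.sqrt n) * ENNReal.ofReal (I₀ / (8 * C₂))) := by
          gcongr
      _ = _ := by
        rw [← ENNReal.ofReal_mul (by positivity), show (2 : ℝ≥0∞) = ENNReal.ofReal 2 by simp,
          ← ENNReal.ofReal_mul (by norm_num)]
        congr 1
        field_simp
        norm_num
  have h3 := h1.trans (add_le_add_right h2 _)
  rw [add_sub_cancel_right, ← ofReal_measureReal, ← ENNReal.ofReal_mul hη.le,
    ← ENNReal.ofReal_add (by positivity) (by positivity),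
    ENNReal.ofReal_le_ofReal_iff (by positivity)] at h3
  rw [← ofReal_measureReal]
  refine ENNReal.ofReal_le_ofReal ?_
  set J := ∫ x, fejer η (x - (w n + R)) ∂ρ
  have h4 : I₀ / 2 / Real.sqrt n ≤ J := by
    rw [div_le_iff₀ hsq, mul_comm]
    exact hn.le
  have h5 : I₀ / 2 / Real.sqrt n = 2 * (I₀ / 4 / Real.sqrt n) := by ring
  have h6 : I₀ / (4 * η) / Real.sqrt n = (I₀ / 4 / Real.sqrt n) / η := by field_simp
  rw [h6, div_le_iff₀ hη]
  linarith

/-! ### Log-Laplace transform, exponential tilting and the many-to-one formula -/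

/-- The Laplace transform `E (∑ exp (φ ℓ))`. -/
def laplace (μ : Measure PointConfig) (φ : ℝ) : ℝ≥0∞ :=
  ∫⁻ x, ENNReal.ofReal (Real.exp (φ * x)) ∂(intensity μ)

theorem measurable_ofReal_exp (φ : ℝ) :
    Measurable fun x : ℝ => ENNReal.ofReal (Real.exp (φ * x)) := by
  fun_prop

theorem kappa_eq_log_laplace (μ : Measure PointConfig) (φ : ℝ) :
    kappa μ φ = ENNReal.log (laplace μ φ) := by
  rw [kappa, laplace, lintegral_intensity μ (measurable_ofReal_exp φ)]

theorem kappa_lt_top_iff (μ : Measure PointConfig) (φ : ℝ) : kappa μ φ < ⊤ ↔ laplace μ φ < ∞ := by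
  rw [kappa_eq_log_laplace, ENNReal.log_lt_top_iff]

theorem laplace_ne_zero {μ : Measure PointConfig} [IsProbabilityMeasure μ]
    (h : μ {c | c.1 = 0} = 0) (φ : ℝ) : laplace μ φ ≠ 0 := by
  rw [laplace, lintegral_intensity μ (measurable_ofReal_exp φ)]
  intro h0
  rw [lintegral_eq_zero_iff (measurable_sum (measurable_ofReal_exp φ))] at h0
  have h1 : ∀ᵐ c ∂μ, c.1 ≠ 0 := by
    rwa [ae_iff, show {c : PointConfig | ¬ c.1 ≠ 0} = {c | c.1 = 0} by ext; simp]
  have h2 : ∀ᵐ _ ∂μ, False := by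
    filter_upwards [h0, h1] with c hc0 hc1
    have h3 := ENNReal.tsum_eq_zero.1 hc0 0
    have h4 : ((0 : ℕ) : ℕ∞) < c.1 := by simpa [pos_iff_ne_zero] using hc1
    rw [if_pos h4, ENNReal.ofReal_eq_zero] at h3
    exact absurd h3 (not_le.2 (Real.exp_pos _))
  exact IsProbabilityMeasure.ne_zero μ (by simpa using h2)

theorem laplace_eq_ofReal_exp {μ : Measure PointConfig} [IsProbabilityMeasure μ]
    (h : μ {c | c.1 = 0} = 0) {φ : ℝ} (hφ : kappa μ φ < ⊤) :
    laplace μ φ = ENNReal.ofReal (Real.exp (kappa μ φ).toReal) := by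
  have h0 := laplace_ne_zero h φ
  have h1 := ((kappa_lt_top_iff μ φ).1 hφ).ne
  rw [kappa_eq_log_laplace, ENNReal.log_pos_real h0 h1, EReal.toReal_coe,
    Real.exp_log (ENNReal.toReal_pos h0 h1), ENNReal.ofReal_toReal h1]

theorem coe_toReal_kappa {μ : Measure PointConfig} [IsProbabilityMeasure μ]
    (h : μ {c | c.1 = 0} = 0) {φ : ℝ} (hφ : kappa μ φ < ⊤) :
    ((kappa μ φ).toReal : EReal) = kappa μ φ := by
  refine EReal.coe_toReal hφ.ne ?_
  rw [kappa_eq_log_laplace, Ne, ENNReal.log_eq_bot_iff]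
  exact laplace_ne_zero h φ

theorem integrable_exp_iff (μ : Measure PointConfig) (φ : ℝ) :
    Integrable (fun x => Real.exp (φ * x)) (intensity μ) ↔ laplace μ φ < ∞ := by
  rw [laplace]
  constructor
  · exact fun h => h.lintegral_lt_top
  · intro h
    refine ⟨by fun_prop, ?_⟩
    rw [hasFiniteIntegral_iff_ofReal (ae_of_all _ fun x => (Real.exp_pos _).le)]
    exact h

theorem cgf_intensity {μ : Measure PointConfig} [IsProbabilityMeasure μ]
    (h : μ {c | c.1 = 0} = 0) {φ : ℝ} (hφ : kappa μ φ < ⊤) :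
    cgf id (intensity μ) φ = (kappa μ φ).toReal := by
  have h1 : mgf id (intensity μ) φ = Real.exp (kappa μ φ).toReal := by
    rw [mgf, integral_eq_lintegral_of_nonneg_ae (ae_of_all _ fun x => (Real.exp_pos _).le)
      (by fun_prop)]
    have := laplace_eq_ofReal_exp h hφ
    rw [laplace] at this
    simp only [id]
    rw [this, ENNReal.toReal_ofReal (Real.exp_pos _).le]
  rw [cgf, h1, Real.log_exp]

/-- `ρ` is the measure `exp (E - θ x) σ(dx)`. -/
def IsExpDensity (θ E : ℝ) (ρ σ : Measure ℝ) : Prop :=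
  ∀ f : ℝ → ℝ≥0∞, Measurable f → ∫⁻ x, f x ∂ρ =
    ENNReal.ofReal (Real.exp E) * ∫⁻ x, f x * ENNReal.ofReal (Real.exp (-(θ * x))) ∂σ

/-- `π` is the step law of the random walk associated by the many-to-one formula with the
mechanism `μ` at the parameter `θ`, where `κ(θ) = E` and `κ'(θ) = a`. -/
structure IsTiltedLaw (μ : Measure PointConfig) (θ E a : ℝ) (π : Measure ℝ) : Prop where
  prob : IsProbabilityMeasure π
  memLp : MemLp id 2 π
  mean : ∫ x, x ∂π = a
  variance_pos : 0 < ∫ x, (x - a) ^ 2 ∂π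
  density : IsExpDensity θ E (intensity μ) π

theorem ae_eq_of_intensity {μ : Measure PointConfig} {s : ℝ}
    (h : ∀ᵐ x ∂(intensity μ), x = s) :
    ∀ᵐ c ∂μ, ∀ i : ℕ, (i : ℕ∞) < c.1 → c.2 i = s := by
  have h1 : (intensity μ) {s}ᶜ = 0 := by
    rw [ae_iff] at h; exact h
  have hm : MeasurableSet ({s}ᶜ : Set ℝ) := (measurableSet_singleton s).compl
  rw [← lintegral_indicator_one hm, lintegral_intensity μ (measurable_one.indicator hm),
    lintegral_eq_zero_iff (measurable_sum (measurable_one.indicator hm))] at h1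
  filter_upwards [h1] with c hc i hi
  have := ENNReal.tsum_eq_zero.1 hc i
  rw [if_pos hi] at this
  by_contra hne
  simp [hne] at this

/-- The law is the intensity measure tilted by `exp(θx)`. Finiteness of `κ` around `θ` puts `θ` in
the interior of the domain of the cumulant generating function, which gives the second moment and
identifies the mean with `κ'(θ)`. -/
theorem exists_isTiltedLaw {μ : Measure PointConfig} [IsProbabilityMeasure μ]
    (h : μ {c | c.1 = 0} = 0) (hnl : NonLattice μ) {θ a : ℝ} (hθ : HasKappaDerivAt μ a θ) :
    ∃ π, IsTiltedLaw μ θ (kappa μ θ).toReal a π := by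
  obtain ⟨hfin, hder⟩ := hθ
  have hfinθ : kappa μ θ < ⊤ := hfin.self_of_nhds
  set I := intensity μ with hI
  have hint : θ ∈ interior (integrableExpSet id I) := by
    rw [mem_interior_iff_mem_nhds]
    filter_upwards [hfin] with s hs
    exact (integrable_exp_iff μ s).2 ((kappa_lt_top_iff μ s).1 hs)
  have hexp : Integrable (fun x => Real.exp (θ * id x)) I :=
    interior_subset (s := integrableExpSet id I) hint
  have hI0 : I ≠ 0 := by
    intro h0
    exact laplace_ne_zero h θ (by rw [laplace, ← hI, h0, lintegral_zero_measure])
  have : NeZero I := ⟨hI0⟩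
  set π := I.tilted (θ * id ·) with hπ
  have hprob : IsProbabilityMeasure π := isProbabilityMeasure_tilted hexp
  have hmem : MemLp id 2 π := by
    have := memLp_tilted_mul hint 2
    exact_mod_cast this
  have hmean : ∫ x, x ∂π = a := by
    have h1 := integral_tilted_mul_self hint
    have h2 : deriv (cgf id I) θ = a := by
      rw [← hder.deriv]
      refine Filter.EventuallyEq.deriv_eq ?_
      filter_upwards [hfin] with s hs using cgf_intensity h hs
    rw [h2] at h1
    exact h1
  have hsq : Integrable (fun x : ℝ => (x - a) ^ 2) π := by
    have := (hmem.sub (memLp_const a)).integrable_sq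
    exact this
  have hmgf : ∫ x, Real.exp (θ * id x) ∂I = Real.exp (kappa μ θ).toReal := by
    have := cgf_intensity h hfinθ
    rw [cgf] at this
    rw [← this, Real.exp_log (mgf_pos' hI0 hexp)]
    rfl
  refine ⟨π, hprob, hmem, hmean, ?_, ?_⟩
  · refine (integral_nonneg fun x => sq_nonneg _).lt_of_ne' fun h0 => ?_
    rw [integral_eq_zero_iff_of_nonneg (fun x => sq_nonneg _) hsq] at h0
    have h1 : ∀ᵐ x ∂π, x = a := by
      filter_upwards [h0] with x hx
      have : (x - a) ^ 2 = 0 := hx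
      nlinarith [pow_eq_zero_iff (two_ne_zero) |>.1 this]
    have h2 : ∀ᵐ x ∂I, x = a := (absolutelyContinuous_tilted hexp).ae_le h1
    have h3 := ae_eq_of_intensity h2
    -- Zero variance would put almost surely every point at `a`, which the case `r = 0` of the
    -- non-lattice condition excludes.
    refine (hnl 0 a).ne ?_
    have h4 : ∀ᵐ c ∂μ, c ∈ {c : PointConfig | ∀ i : ℕ, (i : ℕ∞) < c.1 →
        ∃ k : ℤ, c.2 i = 0 * k + a} := by
      filter_upwards [h3] with c hc i hi
      exact ⟨0, by simp [hc i hi]⟩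
    exact (measure_eq_measure_of_null_sdiff (Set.subset_univ _) (by
      rw [← Set.compl_eq_univ_sdiff]; exact h4)).trans measure_univ
  · intro f hf
    rw [hπ, lintegral_tilted, hmgf, ← lintegral_const_mul _ (by fun_prop)]
    refine lintegral_congr fun x => ?_
    have : ENNReal.ofReal (Real.exp (kappa μ θ).toReal) *
        (ENNReal.ofReal (Real.exp (θ * id x) / Real.exp (kappa μ θ).toReal) *
          (f x * ENNReal.ofReal (Real.exp (-(θ * x))))) =
        f x * (ENNReal.ofReal (Real.exp (kappa μ θ).toReal) *
        ENNReal.ofReal (Real.exp (θ * id x) / Real.exp (kappa μ θ).toReal) *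
          ENNReal.ofReal (Real.exp (-(θ * x)))) := by ring
    rw [this, ← ENNReal.ofReal_mul (Real.exp_pos _).le, ← ENNReal.ofReal_mul (by positivity)]
    rw [show Real.exp (kappa μ θ).toReal * (Real.exp (θ * id x) / Real.exp (kappa μ θ).toReal) *
      Real.exp (-(θ * x)) = 1 by
        rw [mul_div_cancel₀ _ (Real.exp_pos _).ne', ← Real.exp_add]; simp]
    simp

/-- The log-Laplace transform lies strictly above its tangents. -/
theorem IsTiltedLaw.tangent_lt {μ : Measure PointConfig} [IsProbabilityMeasure μ]
    (h : μ {c | c.1 = 0} = 0) {θ E a : ℝ} {π : Measure ℝ} (hπ : IsTiltedLaw μ θ E a π) {φ : ℝ}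
    (hφ : φ ≠ θ) (hfin : kappa μ φ < ⊤) : E + a * (φ - θ) < (kappa μ φ).toReal := by
  have := hπ.prob
  have h1 : laplace μ φ = ENNReal.ofReal (Real.exp E) *
      ∫⁻ x, ENNReal.ofReal (Real.exp ((φ - θ) * x)) ∂π := by
    rw [laplace, hπ.density _ (measurable_ofReal_exp φ)]
    congr 1
    refine lintegral_congr fun x => ?_
    rw [← ENNReal.ofReal_mul (Real.exp_pos _).le, ← Real.exp_add]
    congr 2
    ring
  have h2 : Integrable (fun x => Real.exp ((φ - θ) * x)) π := by
    refine ⟨by fun_prop, ?_⟩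
    rw [hasFiniteIntegral_iff_ofReal (ae_of_all _ fun x => (Real.exp_pos _).le)]
    have h3 := (kappa_lt_top_iff μ φ).1 hfin
    rw [h1] at h3
    refine ENNReal.lt_top_of_mul_ne_top_right h3.ne ?_
    simp [Real.exp_pos]
  have hid : Integrable (fun x : ℝ => x) π := hπ.memLp.integrable (by norm_num)
  have h4 : Real.exp ((φ - θ) * a) < ∫ x, Real.exp ((φ - θ) * x) ∂π := by
    have h5 : ∫ x, Real.exp ((φ - θ) * a) * (1 + (φ - θ) * (x - a)) ∂π =
        Real.exp ((φ - θ) * a) := by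
      have hsub : Integrable (fun x : ℝ => (φ - θ) * (x - a)) π :=
        (hid.sub (integrable_const a)).const_mul _
      rw [integral_const_mul, integral_add (integrable_const _) hsub, integral_const_mul,
        integral_sub hid (integrable_const a), hπ.mean]
      simp
    have hle (x : ℝ) : Real.exp ((φ - θ) * a) * (1 + (φ - θ) * (x - a)) ≤
        Real.exp ((φ - θ) * x) := by
      have := Real.add_one_le_exp ((φ - θ) * (x - a))
      calc _ ≤ Real.exp ((φ - θ) * a) * Real.exp ((φ - θ) * (x - a)) := by
            gcongr; linarith
        _ = _ := by rw [← Real.exp_add]; congr 1; ring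
    have hintl : Integrable (fun x => Real.exp ((φ - θ) * a) * (1 + (φ - θ) * (x - a))) π :=
      ((integrable_const _).add ((hid.sub (integrable_const a)).const_mul _)).const_mul _
    rw [← h5]
    -- Equality in this Jensen-type bound forces the exponential to meet its tangent almost
    -- everywhere, hence the law to be degenerate at `a`.
    refine lt_of_le_of_ne (integral_mono hintl h2 hle) fun heq => ?_
    have h6 := (integral_eq_iff_of_ae_le hintl h2 (ae_of_all _ hle)).1 heq
    have h7 : ∀ᵐ x ∂π, (x - a) ^ 2 = 0 := by
      filter_upwards [h6] with x hx
      by_contra hne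
      have hxa : (φ - θ) * (x - a) ≠ 0 :=
        mul_ne_zero (sub_ne_zero.2 hφ) (fun h0 => hne (by rw [h0]; norm_num))
      have h8 := Real.add_one_lt_exp hxa
      have h9 : Real.exp ((φ - θ) * x) =
          Real.exp ((φ - θ) * a) * Real.exp ((φ - θ) * (x - a)) := by
        rw [← Real.exp_add]; congr 1; ring
      have h10 : Real.exp ((φ - θ) * a) * (1 + (φ - θ) * (x - a)) = Real.exp ((φ - θ) * x) := hx
      rw [h9] at h10
      have := mul_left_cancel₀ (Real.exp_pos _).ne' h10
      linarith
    have h11 := integral_congr_ae h7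
    have := hπ.variance_pos
    rw [h11] at this
    simp at this
  have h12 : Real.exp (kappa μ φ).toReal = Real.exp E * ∫ x, Real.exp ((φ - θ) * x) ∂π := by
    have h13 := laplace_eq_ofReal_exp h hfin
    rw [h1, ← ofReal_integral_eq_lintegral_ofReal h2 (ae_of_all _ fun x => (Real.exp_pos _).le),
      ← ENNReal.ofReal_mul (Real.exp_pos _).le] at h13
    rw [ENNReal.ofReal_eq_ofReal_iff (by positivity) (Real.exp_pos _).le] at h13
    exact h13.symm
  rw [← Real.exp_lt_exp, h12, Real.exp_add, mul_comm a]
  gcongr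

theorem IsExpDensity.conv {θ E E' : ℝ} {ρ ρ' σ σ' : Measure ℝ} [SFinite ρ'] [SFinite σ']
    [SFinite σ] (h : IsExpDensity θ E ρ σ) (h' : IsExpDensity θ E' ρ' σ') :
    IsExpDensity θ (E + E') (ρ ∗ ρ') (σ ∗ σ') := by
  intro f hf
  have hf2 : Measurable (Function.uncurry fun x y : ℝ => f (x + y)) := by
    unfold Function.uncurry; fun_prop
  rw [Measure.lintegral_conv hf, Measure.lintegral_conv (by fun_prop)]
  have h1 : Measurable fun x => ∫⁻ y, f (x + y) ∂ρ' := hf2.lintegral_prod_right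
  rw [h _ h1, Real.exp_add, ENNReal.ofReal_mul (Real.exp_pos _).le, mul_assoc]
  congr 1
  have hg : Measurable fun x => ∫⁻ y, f (x + y) * ENNReal.ofReal (Real.exp (-(θ * (x + y)))) ∂σ' :=
    Measurable.lintegral_prod_right (f := fun x y : ℝ =>
      f (x + y) * ENNReal.ofReal (Real.exp (-(θ * (x + y))))) (by unfold Function.uncurry; fun_prop)
  rw [← lintegral_const_mul _ hg]
  refine lintegral_congr fun x => ?_
  rw [h' _ (by fun_prop), mul_assoc, ← lintegral_mul_const _ (by fun_prop)]
  congr 1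
  refine lintegral_congr fun y => ?_
  rw [mul_assoc, ← ENNReal.ofReal_mul (Real.exp_pos _).le, ← Real.exp_add]
  congr 4
  ring

theorem isExpDensity_dirac_zero (θ : ℝ) :
    IsExpDensity θ 0 (Measure.dirac 0) (Measure.dirac 0) := by
  intro f hf
  rw [lintegral_dirac' _ hf, lintegral_dirac' _ (by fun_prop)]
  simp

/-- The many-to-one formula through the interface: exponential densities multiply under convolution.
-/
theorem isExpDensity_meanMeasure {μ ν : Measure PointConfig} [IsProbabilityMeasure μ]
    [IsProbabilityMeasure ν] {θ E E' a a' : ℝ} {π π' : Measure ℝ} (hπ : IsTiltedLaw μ θ E a π)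
    (hπ' : IsTiltedLaw ν θ E' a' π') (k m : ℕ) :
    IsExpDensity θ (k * E + m * E')
      (meanMeasure (List.replicate k μ ++ List.replicate m ν)) (convPow π k ∗ convPow π' m) := by
  have := hπ.prob
  have := hπ'.prob
  have hsf (k m : ℕ) : SFinite (meanMeasure (List.replicate k μ ++ List.replicate m ν)) :=
    sFinite_meanMeasure _ fun ρ hρ => by
      rcases List.mem_append.1 hρ with h | h
      · rw [List.eq_of_mem_replicate h]; infer_instance
      · rw [List.eq_of_mem_replicate h]; infer_instance
  induction k with
  | zero =>
    simp only [List.replicate_zero, List.nil_append, convPow, Measure.dirac_zero_conv,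
      CharP.cast_eq_zero, zero_mul, zero_add]
    induction m with
    | zero => simpa [meanMeasure, convPow] using isExpDensity_dirac_zero θ
    | succ m ih =>
      have := hsf 0 m
      rw [List.replicate_succ, meanMeasure, convPow]
      simp only [List.replicate_zero, List.nil_append] at this
      have h1 := hπ'.density.conv ih
      rwa [show ((m + 1 : ℕ) : ℝ) * E' = E' + m * E' by push_cast; ring]
  | succ k ih =>
    have := hsf k m
    rw [List.replicate_succ, List.cons_append, meanMeasure, convPow, Measure.conv_assoc]
    have h1 := hπ.density.conv ih
    rwa [show ((k + 1 : ℕ) : ℝ) * E + m * E' = E + (k * E + m * E') by push_cast; ring]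

/-! ### Speed, critical parameter and position of θ -/

section Speed

variable {μ : Measure PointConfig} [IsProbabilityMeasure μ] {θc : ℝ}

/-- Criticality says that the tangent to `κ` at the critical parameter passes through the origin. As
`κ` lies strictly above it elsewhere, its slope is the infimum of `κ(φ)/φ`. -/
theorem Admissible.exists_critical_tangent (h : Admissible μ θc) :
    0 < θc ∧ speed μ * θc = (kappa μ θc).toReal ∧ kappa μ θc < ⊤ ∧
      ∀ φ, φ ≠ θc → kappa μ φ < ⊤ → speed μ * φ < (kappa μ φ).toReal := by
  obtain ⟨hθ, d, hd, hcrit⟩ := h.critical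
  have hb := h.breeding.1
  obtain ⟨π, hπ⟩ := exists_isTiltedLaw hb h.nonLattice hd
  have hfin : kappa μ θc < ⊤ := hd.1.self_of_nhds
  have htan (φ : ℝ) (hφ : φ ≠ θc) (hf : kappa μ φ < ⊤) : d * φ < (kappa μ φ).toReal := by
    have := hπ.tangent_lt hb hφ hf
    nlinarith
  have hspeed : speed μ = d := by
    have h1 : (⨅ φ : Set.Ioi (0 : ℝ), kappa μ φ / ((φ : ℝ) : EReal)) = (d : EReal) := by
      refine le_antisymm (iInf_le_of_le ⟨θc, hθ⟩ ?_) (le_iInf fun φ => ?_)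
      · simp only
        rw [← coe_toReal_kappa hb hfin, ← EReal.coe_div, EReal.coe_le_coe_iff,
          div_le_iff₀ hθ]
        linarith
      · have hφ0 : (0 : ℝ) < φ := φ.2
        rw [EReal.le_div_iff_mul_le (by exact_mod_cast hφ0) (EReal.coe_ne_top _)]
        by_cases hf : kappa μ φ < ⊤
        · rw [← coe_toReal_kappa hb hf, ← EReal.coe_mul, EReal.coe_le_coe_iff]
          by_cases hφ : (φ : ℝ) = θc
          · rw [hφ]; linarith
          · exact (htan φ hφ hf).le
        · rw [not_lt_top_iff.1 hf]; exact le_top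
    rw [speed, h1, EReal.toReal_coe]
  refine ⟨hθ, ?_, hfin, fun φ hφ hf => ?_⟩
  · rw [hspeed]; linarith
  · rw [hspeed]; exact htan φ hφ hf

/-- Position of the slope `κ'(θ)` relative to `κ(θ) / θ`, on both sides of the critical
parameter. -/
theorem Admissible.slope_bounds (h : Admissible μ θc) {θ a : ℝ} (hθ : 0 < θ)
    (ha : HasKappaDerivAt μ a θ) :
    speed μ * θ ≤ (kappa μ θ).toReal ∧ (θ ≠ θc → speed μ * θ < (kappa μ θ).toReal) ∧
    (θ < θc → θ * a < (kappa μ θ).toReal) ∧ (θ = θc → θ * a = (kappa μ θ).toReal) ∧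
    (θc < θ → (kappa μ θ).toReal < θ * a) := by
  obtain ⟨hθc, h1, hfinc, h2⟩ := h.exists_critical_tangent
  have hb := h.breeding.1
  have hfin : kappa μ θ < ⊤ := ha.1.self_of_nhds
  obtain ⟨π, hπ⟩ := exists_isTiltedLaw hb h.nonLattice ha
  have h3 (hne : θ ≠ θc) := hπ.tangent_lt hb hne.symm hfinc
  refine ⟨?_, fun hne => h2 θ hne hfin, fun hlt => ?_, fun heq => ?_, fun hlt => ?_⟩
  · by_cases hne : θ = θc
    · rw [hne]; exact h1.le
    · exact (h2 θ hne hfin).le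
  -- The tangent at `θ` lies below `κ` at the critical parameter, while `κ(θ)` lies above the line
  -- of slope `v` through the origin. Comparing the two yields `a < v`; the last case is symmetric.
  · have h4 := h3 hlt.ne
    have h5 := h2 θ hlt.ne hfin
    have h6 : a < speed μ := by
      by_contra hcon
      nlinarith
    nlinarith
  · obtain ⟨_, d, hd, hcrit⟩ := h.critical
    rw [← heq] at hd hcrit
    rw [ha.2.unique hd.2]
    linarith
  · have h4 := h3 hlt.ne'
    have h5 := h2 θ hlt.ne' hfin
    have h6 : speed μ < a := by
      by_contra hcon
      nlinarith
    nlinarith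

end Speed

/-- First order condition at the minimum: the derivative of the ratio vanishes. -/
theorem stationary_interfaceRate {μ ν : Measure PointConfig} [IsProbabilityMeasure μ]
    [IsProbabilityMeasure ν] (hμ : μ {c | c.1 = 0} = 0) (hν : ν {c | c.1 = 0} = 0) {t θ a b : ℝ}
    (hθ : 0 < θ)
    (hmin : interfaceRate μ ν t θ = ⨅ φ : Set.Ioi (0 : ℝ), interfaceRate μ ν t φ)
    (ha : HasKappaDerivAt μ a θ) (hb : HasKappaDerivAt ν b θ) :
    (t * a + (1 - t) * b) * θ = t * (kappa μ θ).toReal + (1 - t) * (kappa ν θ).toReal := by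
  set r : ℝ → ℝ := fun φ => (t * (kappa μ φ).toReal + (1 - t) * (kappa ν φ).toReal) / φ with hr
  have hcoe (φ : ℝ) (h1 : kappa μ φ < ⊤) (h2 : kappa ν φ < ⊤) :
      interfaceRate μ ν t φ = ((r φ : ℝ) : EReal) := by
    rw [interfaceRate, ← coe_toReal_kappa hμ h1, ← coe_toReal_kappa hν h2, hr]
    push_cast
    rfl
  have hloc : IsLocalMin r θ := by
    filter_upwards [ha.1, hb.1, lt_mem_nhds hθ] with φ h1 h2 h3
    have h4 : interfaceRate μ ν t θ ≤ interfaceRate μ ν t φ :=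
      hmin.trans_le (iInf_le (fun φ : Set.Ioi (0 : ℝ) => interfaceRate μ ν t φ) ⟨φ, h3⟩)
    rwa [hcoe θ ha.1.self_of_nhds hb.1.self_of_nhds, hcoe φ h1 h2, EReal.coe_le_coe_iff] at h4
  have hd : HasDerivAt r (((t * a + (1 - t) * b) * θ -
      (t * (kappa μ θ).toReal + (1 - t) * (kappa ν θ).toReal) * 1) / θ ^ 2) θ :=
    ((ha.2.const_mul t).add (hb.2.const_mul (1 - t))).div (hasDerivAt_id θ) hθ.ne'
  have h0 := hloc.hasDerivAt_eq_zero hd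
  rw [div_eq_zero_iff] at h0
  rcases h0 with h0 | h0
  · linarith
  · exact absurd h0 (by positivity)

/-- Stationarity says that `θκ'(θ) - κ(θ)` and its counterpart for the second mechanism have a zero
average with positive weights. They cannot both be nonnegative with one positive, nor both
nonpositive with one negative, which leaves only `θ` strictly between the critical parameters. -/
theorem fast_regime_parameters {μ ν : Measure PointConfig} [IsProbabilityMeasure μ]
    [IsProbabilityMeasure ν] {θμ θν : ℝ} (hμ : Admissible μ θμ) (hν : Admissible ν θν)
    {t : ℝ} (ht : t ∈ Set.Ioo (0 : ℝ) 1) (hfast : θν < θμ) {θ a b : ℝ} (hθ : 0 < θ)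
    (hmin : interfaceRate μ ν t θ = ⨅ φ : Set.Ioi (0 : ℝ), interfaceRate μ ν t φ)
    (ha : HasKappaDerivAt μ a θ) (hb : HasKappaDerivAt ν b θ) :
    θν < θ ∧ θ < θμ ∧ θ * a < (kappa μ θ).toReal ∧ (kappa ν θ).toReal < θ * b ∧
      t * speed μ + (1 - t) * speed ν < t * a + (1 - t) * b := by
  have hst := stationary_interfaceRate hμ.breeding.1 hν.breeding.1 hθ hmin ha hb
  obtain ⟨a1, a2, a3, a4, a5⟩ := hμ.slope_bounds hθ ha
  obtain ⟨b1, b2, b3, b4, b5⟩ := hν.slope_bounds hθ hb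
  have ht0 := ht.1
  have ht1 : 0 < 1 - t := by linarith [ht.2]
  have h1 : θ < θμ := by
    by_contra hcon
    have h2 := b5 (by linarith)
    have h3 : (kappa μ θ).toReal ≤ θ * a := by
      rcases (not_lt.1 hcon).eq_or_lt with h | h
      · exact (a4 h.symm).ge
      · exact (a5 h).le
    nlinarith
  have h2 : θν < θ := by
    by_contra hcon
    have h3 := a3 h1
    have h4 : θ * b ≤ (kappa ν θ).toReal := by
      rcases (not_lt.1 hcon).eq_or_lt with h | h
      · exact (b4 h).le
      · exact (b3 h).le
    nlinarith
  refine ⟨h2, h1, a3 h1, b5 h2, ?_⟩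
  have h3 := a2 h1.ne
  have h4 := b2 h2.ne'
  have h5 : (t * speed μ + (1 - t) * speed ν) * θ < (t * a + (1 - t) * b) * θ := by
    rw [hst]; nlinarith
  exact lt_of_mul_lt_mul_right h5 hθ.le

/-! ### The exponent q and the moments it requires -/

/-- `∑ exp (φ ℓ)` over the points of the configuration. -/
def PointConfig.expSum (c : PointConfig) (φ : ℝ) : ℝ≥0∞ :=
  c.sum fun x => ENNReal.ofReal (Real.exp (φ * x))

theorem measurable_expSum (φ : ℝ) : Measurable fun c : PointConfig => c.expSum φ :=
  measurable_sum (measurable_ofReal_exp φ)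

theorem laplace_eq_lintegral_expSum (μ : Measure PointConfig) (φ : ℝ) :
    laplace μ φ = ∫⁻ c, c.expSum φ ∂μ := lintegral_intensity μ (measurable_ofReal_exp φ)

theorem rpow_mul_rpow_le_add (A B : ℝ≥0∞) {p : ℝ} (hp0 : 0 ≤ p) (hp1 : p ≤ 1) :
    A ^ p * B ^ (1 - p) ≤ A + B := by
  have h1 : A ≤ max A B := le_max_left _ _
  have h2 : B ≤ max A B := le_max_right _ _
  calc A ^ p * B ^ (1 - p) ≤ max A B ^ p * max A B ^ (1 - p) := by
        gcongr
    _ = max A B := by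
        rw [← ENNReal.rpow_add_of_nonneg _ _ hp0 (by linarith)]; simp
    _ ≤ A + B := max_le le_self_add (le_add_left le_rfl)

theorem ofReal_exp_interpolate (ψ₁ ψ₂ p x : ℝ) :
    ENNReal.ofReal (Real.exp ((p * ψ₁ + (1 - p) * ψ₂) * x)) =
      ENNReal.ofReal (Real.exp (ψ₁ * x)) ^ p * ENNReal.ofReal (Real.exp (ψ₂ * x)) ^ (1 - p) := by
  rw [ENNReal.ofReal_rpow_of_pos (Real.exp_pos _), ENNReal.ofReal_rpow_of_pos (Real.exp_pos _),
    ← Real.exp_mul, ← Real.exp_mul, ← ENNReal.ofReal_mul (Real.exp_pos _).le, ← Real.exp_add]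
  congr 2
  ring

theorem PointConfig.expSum_interpolate_le (c : PointConfig) (ψ₁ ψ₂ : ℝ) {p : ℝ} (hp0 : 0 ≤ p)
    (hp1 : p ≤ 1) : c.expSum (p * ψ₁ + (1 - p) * ψ₂) ≤ c.expSum ψ₁ + c.expSum ψ₂ := by
  unfold PointConfig.expSum
  rw [← c.sum_add]
  refine c.sum_mono fun x => ?_
  rw [ofReal_exp_interpolate]
  exact rpow_mul_rpow_le_add _ _ hp0 hp1

theorem le_one_add_rpow_of_le {Y : ℝ≥0∞} {s r : ℝ} (hs : 0 ≤ s) (hsr : s ≤ r) :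
    Y ^ s ≤ 1 + Y ^ r := by
  rcases le_total Y 1 with h | h
  · exact (ENNReal.rpow_le_one h hs).trans le_self_add
  · exact (ENNReal.rpow_le_rpow_of_exponent_le h hsr).trans (le_add_left le_rfl)

/-- Square integrability is known at the critical parameter only. It is interpolated with a finite
first moment at a parameter on the other side of `θ`, which suffices for a small power `q`. -/
theorem lintegral_expSum_mul_rpow_lt_top {μ : Measure PointConfig} [IsProbabilityMeasure μ]
    {ψ₁ ψ₂ : ℝ} (h1 : laplace μ ψ₁ < ∞) (h2 : ∫⁻ c, c.expSum ψ₂ ^ 2 ∂μ < ∞) {p p' q : ℝ}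
    (hp0 : 0 ≤ p) (hp1 : p < 1) (hp0' : 0 ≤ p') (hp1' : p' ≤ 1) (hq0 : 0 ≤ q)
    (hq : 2 * q ≤ 1 - p) :
    ∫⁻ c, c.expSum (p * ψ₁ + (1 - p) * ψ₂) * c.expSum (p' * ψ₁ + (1 - p') * ψ₂) ^ q ∂μ < ∞ := by
  have hbound (c : PointConfig) :
      c.expSum (p * ψ₁ + (1 - p) * ψ₂) * c.expSum (p' * ψ₁ + (1 - p') * ψ₂) ^ q ≤
        2 * c.expSum ψ₁ + 2 * c.expSum ψ₂ ^ 2 + 2 := by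
    set Y := c.expSum (p' * ψ₁ + (1 - p') * ψ₂)
    set X₁ := c.expSum ψ₁
    set X₂ := c.expSum ψ₂
    -- The factor `Y ^ q` is absorbed into the `1 - p` part of the interpolation, giving `X₁ + X₂ *
    -- Z`. The condition `2q ≤ 1 - p` makes `Z ^ 2` at most linear in `Y`, so only `X₂` appears
    -- squared.
    set Z := Y ^ (q / (1 - p))
    have hp : 0 < 1 - p := by linarith
    have hY : Y ≤ X₁ + X₂ := c.expSum_interpolate_le ψ₁ ψ₂ hp0' hp1'
    have hZ : Z ^ (1 - p) = Y ^ q := by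
      simp only [Z]
      rw [← ENNReal.rpow_mul, div_mul_cancel₀ _ hp.ne']
    have hstep : c.expSum (p * ψ₁ + (1 - p) * ψ₂) * Y ^ q ≤ X₁ + X₂ * Z := by
      simp only [X₁, X₂]
      rw [mul_comm, mul_comm _ Z]
      unfold PointConfig.expSum
      rw [← c.sum_const_mul, ← c.sum_const_mul, ← c.sum_add]
      refine c.sum_mono fun x => ?_
      rw [ofReal_exp_interpolate, ← hZ]
      calc _ = ENNReal.ofReal (Real.exp (ψ₁ * x)) ^ p *
            (Z * ENNReal.ofReal (Real.exp (ψ₂ * x))) ^ (1 - p) := by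
            rw [ENNReal.mul_rpow_of_nonneg _ _ hp.le]; ring
        _ ≤ _ := rpow_mul_rpow_le_add _ _ hp0 hp1.le
    have hZ2 : Z ^ 2 ≤ 1 + Y := by
      simp only [Z]
      rw [← ENNReal.rpow_natCast, ← ENNReal.rpow_mul]
      have := le_one_add_rpow_of_le (Y := Y) (s := q / (1 - p) * (2 : ℕ)) (r := 1)
        (by positivity) (by
          push_cast
          rw [div_mul_eq_mul_div, div_le_one hp]
          linarith)
      simpa using this
    have hX2 : X₂ ≤ 1 + X₂ ^ 2 := by
      have := le_one_add_rpow_of_le (Y := X₂) (s := 1) (r := 2) (by norm_num) (by norm_num)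
      simpa using this
    have hXZ : X₂ * Z ≤ X₂ ^ 2 + Z ^ 2 := by
      rcases le_total X₂ Z with h | h
      · refine le_add_left ?_
        rw [sq]; gcongr
      · refine le_add_right ?_
        rw [sq]; gcongr
    calc _ ≤ X₁ + X₂ * Z := hstep
      _ ≤ X₁ + (X₂ ^ 2 + (1 + (X₁ + (1 + X₂ ^ 2)))) := by
          gcongr
          refine hXZ.trans ?_
          gcongr
          refine hZ2.trans ?_
          gcongr
          exact hY.trans (by gcongr)
      _ = _ := by ring
  refine (lintegral_mono hbound).trans_lt ?_
  have hm1 := measurable_expSum ψ₁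
  have hm2 := measurable_expSum ψ₂
  rw [lintegral_add_right _ measurable_const, lintegral_add_left (by fun_prop),
    lintegral_const_mul _ hm1, lintegral_const_mul _ (by fun_prop),
    ← laplace_eq_lintegral_expSum]
  refine ENNReal.add_lt_top.2 ⟨ENNReal.add_lt_top.2 ⟨?_, ?_⟩, by simp⟩
  · exact ENNReal.mul_lt_top (by simp) h1
  · exact ENNReal.mul_lt_top (by simp) h2

theorem SecondOrder.lintegral_expSum_sq_lt_top {μ : Measure PointConfig} {θ : ℝ}
    (h : SecondOrder μ θ) : ∫⁻ c, c.expSum θ ^ 2 ∂μ < ∞ := by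
  refine (lintegral_mono fun c => ?_).trans_lt h
  have : c.expSum θ ≤ c.sum fun x => ENNReal.ofReal ((1 + |x|) * Real.exp (θ * x)) := by
    refine c.sum_mono fun x => ENNReal.ofReal_le_ofReal ?_
    nlinarith [abs_nonneg x, Real.exp_pos (θ * x)]
  gcongr

theorem eventually_lt_zero_of_hasDerivAt {g : ℝ → ℝ} {d : ℝ} (hg : HasDerivAt g d 0)
    (h0 : g 0 = 0) (hd : d < 0) : ∀ᶠ q in 𝓝[>] 0, g q < 0 := by
  have h1 := (hasDerivAt_iff_tendsto_slope.1 hg).mono_left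
    (nhdsWithin_mono 0 (fun x (hx : 0 < x) => hx.ne' : Set.Ioi (0 : ℝ) ⊆ {0}ᶜ))
  filter_upwards [h1.eventually (gt_mem_nhds hd), self_mem_nhdsWithin] with q hq hq0
  rw [slope_def_field, h0, sub_zero, sub_zero, div_lt_iff₀ hq0, zero_mul] at hq
  exact hq

/-- At `q = 0` the difference of the two sides vanishes and its derivative is `σ(θκ'(θ) - κ(θ))`.
The sign `σ = 1` serves the first phase and `σ = -1` the second. -/
theorem eventually_kappa_expand {μ : Measure PointConfig} {θ a : ℝ} (ha : HasKappaDerivAt μ a θ)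
    (σ : ℝ) (h : σ * (θ * a - (kappa μ θ).toReal) < 0) :
    ∀ᶠ q in 𝓝[>] (0 : ℝ), kappa μ ((1 + σ * q) * θ) < ⊤ ∧
      (kappa μ ((1 + σ * q) * θ)).toReal < (1 + σ * q) * (kappa μ θ).toReal := by
  have hlin : HasDerivAt (fun q : ℝ => 1 + σ * q) σ 0 := by
    simpa using ((hasDerivAt_id (0 : ℝ)).const_mul σ).const_add 1
  have hin : HasDerivAt (fun q : ℝ => (1 + σ * q) * θ) (σ * θ) 0 := hlin.mul_const θ
  have hval : (1 + σ * 0) * θ = θ := by ring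
  have hcont : Tendsto (fun q : ℝ => (1 + σ * q) * θ) (𝓝 0) (𝓝 θ) := by
    have := hin.continuousAt.tendsto
    rwa [hval] at this
  have h1 : ∀ᶠ q in 𝓝[>] (0 : ℝ), kappa μ ((1 + σ * q) * θ) < ⊤ :=
    (hcont.eventually ha.1).filter_mono nhdsWithin_le_nhds
  have hd : HasDerivAt (fun q : ℝ => (kappa μ ((1 + σ * q) * θ)).toReal -
      (1 + σ * q) * (kappa μ θ).toReal) (a * (σ * θ) - σ * (kappa μ θ).toReal) 0 := by
    refine HasDerivAt.sub ?_ (hlin.mul_const _)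
    have h2 : HasDerivAt (fun s => (kappa μ s).toReal) a ((1 + σ * 0) * θ) := by
      rw [hval]; exact ha.2
    exact h2.comp (0 : ℝ) hin
  have h2 := eventually_lt_zero_of_hasDerivAt hd (by simp) (by linarith)
  filter_upwards [h1, h2] with q hq1 hq2
  exact ⟨hq1, by linarith⟩

theorem exists_laplace_lt_top {μ : Measure PointConfig} {θ a : ℝ} (ha : HasKappaDerivAt μ a θ) :
    ∃ δ > 0, laplace μ (θ - δ) < ∞ ∧ laplace μ (θ + δ) < ∞ := by
  obtain ⟨ε, hε, h⟩ := Metric.eventually_nhds_iff.1 ha.1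
  refine ⟨ε / 2, by positivity, ?_, ?_⟩ <;> rw [← kappa_lt_top_iff] <;> refine h ?_
  · rw [Real.dist_eq, abs_lt]; constructor <;> linarith
  · rw [Real.dist_eq, abs_lt]; constructor <;> linarith

theorem exists_moment_exponent {μ ν : Measure PointConfig} [IsProbabilityMeasure μ]
    [IsProbabilityMeasure ν] {θμ θν : ℝ} (hμ : Admissible μ θμ) (hν : Admissible ν θν)
    {θ a b : ℝ} (hθ : 0 < θ) (ha : HasKappaDerivAt μ a θ) (hb : HasKappaDerivAt ν b θ)
    (h1 : θν < θ) (h2 : θ < θμ) (h3 : θ * a < (kappa μ θ).toReal)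
    (h4 : (kappa ν θ).toReal < θ * b) :
    ∃ q : ℝ, 0 < q ∧ q ≤ 1 ∧ kappa μ ((1 + q) * θ) < ⊤ ∧
      (kappa μ ((1 + q) * θ)).toReal < (1 + q) * (kappa μ θ).toReal ∧
      kappa ν ((1 - q) * θ) < ⊤ ∧
      (kappa ν ((1 - q) * θ)).toReal < (1 - q) * (kappa ν θ).toReal ∧
      ∫⁻ c, c.expSum θ ^ (1 + q) ∂μ < ∞ ∧
      ∫⁻ c, c.expSum ((1 - q) * θ) * c.expSum θ ^ q ∂ν < ∞ := by
  have e1 := eventually_kappa_expand ha 1 (by linarith)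
  have e2 := eventually_kappa_expand hb (-1) (by linarith)
  obtain ⟨δ, hδ, hδ1, -⟩ := exists_laplace_lt_top ha
  obtain ⟨ε, hε, -, hε2⟩ := exists_laplace_lt_top hb
  -- Barycentric weight of `θ` between `θ - δ`, where the first moment is finite, and the critical
  -- parameter `θμ`.
  set p := (θμ - θ) / (θμ - (θ - δ))
  have hp0 : 0 < p := div_pos (by linarith) (by linarith)
  have hp1 : p < 1 := (div_lt_one (by linarith)).2 (by linarith)
  have hpθ : p * (θ - δ) + (1 - p) * θμ = θ := by
    simp only [p]; field_simp [show θμ - (θ - δ) ≠ 0 by linarith]; ring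
  -- For the second mechanism both `(1 - q)θ` and `θ` are interpolated between `θν` and `θ + ε`, an
  -- interval of length `D`.
  set D := θ + ε - θν
  have hD : 0 < D := by simp only [D]; linarith
  have e3 : ∀ᶠ q in 𝓝[>] (0 : ℝ), q < 1 ∧ 2 * q < 1 - p ∧ 2 * q < ε / D ∧ q * θ < θ - θν := by
    refine Filter.Eventually.filter_mono nhdsWithin_le_nhds ?_
    refine (gt_mem_nhds one_pos).and (Filter.Eventually.and ?_ (Filter.Eventually.and ?_ ?_))
    · filter_upwards [gt_mem_nhds (show 0 < (1 - p) / 2 by linarith)] with q hq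
      linarith
    · filter_upwards [gt_mem_nhds (show 0 < ε / D / 2 by positivity)] with q hq
      linarith
    · filter_upwards [gt_mem_nhds (show 0 < (θ - θν) / θ from div_pos (by linarith) hθ)] with q hq
      rwa [lt_div_iff₀ hθ] at hq
  obtain ⟨q, ⟨⟨k1, k2⟩, ⟨k3, k4⟩, q1, q2, q3, q4⟩, hq⟩ :=
    ((e1.and (e2.and e3)).and self_mem_nhdsWithin).exists
  have hq0 : 0 < q := hq
  rw [one_mul] at k1 k2
  rw [show (1 : ℝ) + -1 * q = 1 - q by ring] at k3 k4
  refine ⟨q, hq0, q1.le, k1, k2, k3, k4, ?_, ?_⟩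
  · have := lintegral_expSum_mul_rpow_lt_top hδ1 hμ.secondOrder.lintegral_expSum_sq_lt_top hp0.le
      hp1 hp0.le hp1.le hq0.le q2.le
    rw [hpθ] at this
    refine (lintegral_mono fun c => ?_).trans_lt this
    rw [ENNReal.rpow_add_of_nonneg _ _ zero_le_one hq0.le, ENNReal.rpow_one]
  · set r := ((1 - q) * θ - θν) / D
    set r' := (θ - θν) / D
    have hr0 : 0 ≤ r := div_nonneg (by linarith) hD.le
    have hr1 : 2 * q ≤ 1 - r := by
      refine q3.le.trans ?_
      rw [le_sub_iff_add_le, ← add_div, div_le_one hD]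
      simp only [D]
      nlinarith
    have hr0' : 0 ≤ r' := div_nonneg (by linarith) hD.le
    have hr1' : r' ≤ 1 := (div_le_one hD).2 (by simp only [D]; linarith)
    have hrθ : r * (θ + ε) + (1 - r) * θν = (1 - q) * θ := by
      have : r * D = (1 - q) * θ - θν := div_mul_cancel₀ _ hD.ne'
      simp only [D] at this
      linarith
    have hrθ' : r' * (θ + ε) + (1 - r') * θν = θ := by
      have : r' * D = θ - θν := div_mul_cancel₀ _ hD.ne'
      simp only [D] at this
      linarith
    have := lintegral_expSum_mul_rpow_lt_top hε2 hν.secondOrder.lintegral_expSum_sq_lt_top hr0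
      (by linarith) hr0' hr1' hq0.le hr1
    rwa [hrθ, hrθ'] at this

/-! ### Bounds on the correction term in each phase -/

/-- The exponential, with values in `[0, ∞]`. -/
def eexp (x : ℝ) : ℝ≥0∞ := ENNReal.ofReal (Real.exp x)

theorem eexp_add (x y : ℝ) : eexp (x + y) = eexp x * eexp y := by
  rw [eexp, Real.exp_add, ENNReal.ofReal_mul (Real.exp_pos _).le]; rfl

theorem eexp_ne_top (x : ℝ) : eexp x ≠ ∞ := ENNReal.ofReal_ne_top

theorem eexp_zero : eexp 0 = 1 := by simp [eexp]

theorem eexp_le_eexp {x y : ℝ} (h : x ≤ y) : eexp x ≤ eexp y :=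
  ENNReal.ofReal_le_ofReal (Real.exp_le_exp.2 h)

theorem eexp_rpow (x r : ℝ) : eexp x ^ r = eexp (r * x) := by
  rw [eexp, ENNReal.ofReal_rpow_of_pos (Real.exp_pos _), ← Real.exp_mul, mul_comm]; rfl

theorem eexp_pow (x : ℝ) (n : ℕ) : eexp x ^ n = eexp (n * x) := by
  rw [← ENNReal.rpow_natCast, eexp_rpow]

@[fun_prop]
theorem measurable_eexp : Measurable eexp := by unfold eexp; fun_prop

theorem IsExpDensity.eq {θ E : ℝ} {ρ σ : Measure ℝ} (h : IsExpDensity θ E ρ σ) {f : ℝ → ℝ≥0∞}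
    (hf : Measurable f) : ∫⁻ x, f x ∂ρ = eexp E * ∫⁻ x, f x * eexp (-(θ * x)) ∂σ := h f hf

theorem IsExpDensity.apply_eq {θ E : ℝ} {ρ σ : Measure ℝ} (h : IsExpDensity θ E ρ σ) {s : Set ℝ}
    (hs : MeasurableSet s) : ρ s = eexp E * ∫⁻ x in s, eexp (-(θ * x)) ∂σ := by
  rw [← lintegral_indicator_one hs, h.eq (measurable_one.indicator hs), ← lintegral_indicator hs]
  congr 1
  refine lintegral_congr fun x => ?_
  by_cases hx : x ∈ s <;> simp [hx]

theorem IsExpDensity.Ioc_le {θ E : ℝ} (hθ : 0 ≤ θ) {ρ σ : Measure ℝ} (h : IsExpDensity θ E ρ σ)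
    (y H : ℝ) : ρ (Set.Ioc y (y + H)) ≤ eexp (E - θ * y) * σ (Set.Ioc y (y + H)) := by
  rw [h.apply_eq measurableSet_Ioc, sub_eq_add_neg, eexp_add, mul_assoc, ← setLIntegral_const]
  refine mul_le_mul' le_rfl (setLIntegral_mono' measurableSet_Ioc fun x hx => eexp_le_eexp ?_)
  have : θ * y ≤ θ * x := mul_le_mul_of_nonneg_left hx.1.le hθ
  linarith

theorem IsExpDensity.le_Ioc {θ E : ℝ} (hθ : 0 ≤ θ) {ρ σ : Measure ℝ} (h : IsExpDensity θ E ρ σ)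
    (y H : ℝ) : eexp (E - θ * (y + H)) * σ (Set.Ioc y (y + H)) ≤ ρ (Set.Ioc y (y + H)) := by
  rw [h.apply_eq measurableSet_Ioc, sub_eq_add_neg, eexp_add, mul_assoc, ← setLIntegral_const]
  refine mul_le_mul' le_rfl (setLIntegral_mono' measurableSet_Ioc fun x hx => eexp_le_eexp ?_)
  have : θ * x ≤ θ * (y + H) := mul_le_mul_of_nonneg_left hx.2 hθ
  linarith

theorem conv_Ioc (α β : Measure ℝ) [SFinite β] (y H : ℝ) :
    (α ∗ β) (Set.Ioc y (y + H)) = ∫⁻ x, β (Set.Ioc (y - x) (y - x + H)) ∂α := by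
  rw [conv_apply_eq_lintegral _ _ measurableSet_Ioc]
  simp_rw [preimage_const_add_Ioc', add_sub_right_comm]

theorem conv_univ (α β : Measure ℝ) [SFinite β] :
    (α ∗ β) Set.univ = α Set.univ * β Set.univ := by
  rw [conv_apply_eq_lintegral _ _ MeasurableSet.univ]
  simp [mul_comm]

theorem lintegral_eexp_convPow (π : Measure ℝ) [IsProbabilityMeasure π] (φ : ℝ) (n : ℕ) :
    ∫⁻ x, eexp (φ * x) ∂(convPow π n) = (∫⁻ x, eexp (φ * x) ∂π) ^ n := by
  induction n with
  | zero => simp [convPow, lintegral_dirac, eexp_zero]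
  | succ n ih =>
    rw [convPow, Measure.lintegral_conv (by fun_prop), pow_succ', ← ih,
      ← lintegral_mul_const _ (by fun_prop)]
    refine lintegral_congr fun x => ?_
    rw [← lintegral_const_mul _ (by fun_prop)]
    refine lintegral_congr fun y => ?_
    rw [mul_add, eexp_add]

/-- The intensity of the point process with law `ν` biased by `(∑ exp (θ ℓ)) ^ q`, tilted by
`exp ((1 - q) θ x)`. -/
def biasedIntensity (ν : Measure PointConfig) (θ q : ℝ) : Measure ℝ :=
  (intensity (ν.withDensity fun c => c.expSum θ ^ q)).withDensity fun x => eexp ((1 - q) * θ * x)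

instance (ν : Measure PointConfig) [SFinite ν] (θ q : ℝ) : SFinite (biasedIntensity ν θ q) := by
  unfold biasedIntensity; infer_instance

theorem lintegral_biasedIntensity (ν : Measure PointConfig) (θ q : ℝ) {f : ℝ → ℝ≥0∞}
    (hf : Measurable f) : ∫⁻ x, f x ∂(biasedIntensity ν θ q) =
      ∫⁻ c, c.expSum θ ^ q * c.sum (fun x => eexp ((1 - q) * θ * x) * f x) ∂ν := by
  rw [biasedIntensity, lintegral_withDensity_eq_lintegral_mul _ (by fun_prop) hf,
    lintegral_intensity _ (by fun_prop), lintegral_withDensity_eq_lintegral_mul _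
      ((measurable_expSum θ).pow_const q) (measurable_sum (by fun_prop))]
  rfl

theorem biasedIntensity_univ (ν : Measure PointConfig) (θ q : ℝ) :
    biasedIntensity ν θ q Set.univ = ∫⁻ c, c.expSum ((1 - q) * θ) * c.expSum θ ^ q ∂ν := by
  rw [← lintegral_one, lintegral_biasedIntensity ν θ q measurable_const]
  refine lintegral_congr fun c => ?_
  simp only [mul_one]
  rw [mul_comm]
  rfl

/-- The measure controlling the correction term in the second phase. -/
def phaseTwo (ν : Measure PointConfig) (π' : Measure ℝ) (θ q H E' : ℝ) : ℕ → Measure ℝ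
  | 0 => 0
  | m + 1 => π' ∗ phaseTwo ν π' θ q H E' m +
      eexp ((q * m - 1) * E' + q * θ * H) •
        (biasedIntensity ν θ q ∗ (convPow π' m).withDensity fun x => eexp (-(q * θ) * x))

theorem sFinite_phaseTwo (ν : Measure PointConfig) [SFinite ν] (π' : Measure ℝ)
    [IsProbabilityMeasure π'] (θ q H E' : ℝ) (m : ℕ) : SFinite (phaseTwo ν π' θ q H E' m) := by
  induction m with
  | zero => unfold phaseTwo; infer_instance
  | succ m ih => unfold phaseTwo; infer_instance

/-- A split with `j` generations left contributes the `j`-th term of a geometric series, so the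
bound does not depend on `m`; it is finite when the ratio is below one and the biased intensity is
finite. -/
theorem phaseTwo_univ_le {ν : Measure PointConfig} [SFinite ν] {π' : Measure ℝ}
    [IsProbabilityMeasure π'] {θ q H E' : ℝ} (m : ℕ) :
    phaseTwo ν π' θ q H E' m Set.univ ≤
      eexp (q * θ * H - E') * biasedIntensity ν θ q Set.univ *
        (1 - eexp (q * E') * ∫⁻ x, eexp (-(q * θ) * x) ∂π')⁻¹ := by
  have h1 : phaseTwo ν π' θ q H E' m Set.univ =
      ∑ j ∈ Finset.range m, eexp (q * θ * H - E') * biasedIntensity ν θ q Set.univ *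
        (eexp (q * E') * ∫⁻ x, eexp (-(q * θ) * x) ∂π') ^ j := by
    induction m with
    | zero => simp [phaseTwo]
    | succ m ih =>
      have := sFinite_phaseTwo ν π' θ q H E' m
      rw [phaseTwo, Measure.add_apply, conv_univ, measure_univ, one_mul, ih,
        Finset.sum_range_succ, Measure.smul_apply, conv_univ, withDensity_apply _ MeasurableSet.univ,
        Measure.restrict_univ, lintegral_eexp_convPow, smul_eq_mul, mul_pow, eexp_pow,
        show (q * m - 1) * E' + q * θ * H = (q * θ * H - E') + m * (q * E') by ring, eexp_add]
      ring
  rw [h1, ← ENNReal.tsum_geometric, ← ENNReal.tsum_mul_left]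
  exact ENNReal.sum_le_tsum _

theorem sFinite_meanMeasure_replicate (μ ν : Measure PointConfig) [IsProbabilityMeasure μ]
    [IsProbabilityMeasure ν] (k m : ℕ) :
    SFinite (meanMeasure (List.replicate k μ ++ List.replicate m ν)) :=
  sFinite_meanMeasure _ fun ρ hρ => by
    rcases List.mem_append.1 hρ with h | h
    · rw [List.eq_of_mem_replicate h]; infer_instance
    · rw [List.eq_of_mem_replicate h]; infer_instance

/-- One step of the many-to-one formula. It propagates a bound of the form exponential times window
mass through one generation. -/
theorem lintegral_sum_eexp_mul_Ioc {μ : Measure PointConfig} {θ E a : ℝ} {π : Measure ℝ}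
    (hπ : IsTiltedLaw μ θ E a π) (D : Measure ℝ) [SFinite D] (F y H : ℝ) :
    ∫⁻ c, c.sum (fun x => eexp (F - θ * (y - x)) * D (Set.Ioc (y - x) (y - x + H))) ∂μ =
      eexp (E + F - θ * y) * (π ∗ D) (Set.Ioc y (y + H)) := by
  have hm := measurable_measure_Ioc D y H
  have hg : Measurable fun x => eexp (F - θ * (y - x)) * D (Set.Ioc (y - x) (y - x + H)) :=
    Measurable.mul (by fun_prop) hm
  rw [← lintegral_intensity μ hg, hπ.density.eq hg, conv_Ioc,
    ← lintegral_const_mul _ hm, ← lintegral_const_mul' _ _ (eexp_ne_top E)]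
  refine lintegral_congr fun x => ?_
  rw [show E + F - θ * y = E + ((F - θ * (y - x)) + -(θ * x)) by ring, eexp_add E, eexp_add]
  ring

/-- The power is split as `S ^ q * S`. The factor `S ^ q` forgets the window and biases the
reproduction; the factor `S` keeps the window, and part of its exponential weight is moved onto the
remaining walk to produce the geometric decay. -/
theorem lintegral_rpow_sum_le (ν : Measure PointConfig) [IsProbabilityMeasure ν]
    {π' : Measure ℝ} [IsProbabilityMeasure π'] {θ q : ℝ} (hθ : 0 ≤ θ) (hq : 0 ≤ q) (H F y : ℝ)
    (m : ℕ) :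
    ∫⁻ c, (c.sum fun x => eexp (F - θ * (y - x)) *
        convPow π' m (Set.Ioc (y - x) (y - x + H))) ^ (1 + q) ∂ν ≤
      eexp ((1 + q) * F - θ * y + q * θ * H) *
        (biasedIntensity ν θ q ∗ (convPow π' m).withDensity fun x => eexp (-(q * θ) * x))
          (Set.Ioc y (y + H)) := by
  set W := (convPow π' m).withDensity fun x => eexp (-(q * θ) * x)
  have hmW := measurable_measure_Ioc W y H
  rw [conv_Ioc, lintegral_biasedIntensity ν θ q hmW, ← lintegral_const_mul]
  swap
  · exact ((measurable_expSum θ).pow_const q).mul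
      (measurable_sum (Measurable.mul (by fun_prop) hmW))
  refine lintegral_mono fun c => ?_
  set P : ℝ → ℝ≥0∞ := fun x => convPow π' m (Set.Ioc (y - x) (y - x + H))
  set S := c.sum fun x => eexp (θ * x) * P x
  have hS : c.sum (fun x => eexp (F - θ * (y - x)) * P x) = eexp (F - θ * y) * S := by
    rw [← c.sum_const_mul]
    congr 1
    ext x
    rw [← mul_assoc, ← eexp_add]
    congr 2
    ring
  have hSX : S ≤ c.expSum θ := c.sum_mono fun x =>
    mul_le_of_le_one_right' prob_le_one
  -- On the window the remaining displacement `z` satisfies `z ≤ y + H - x`, so `exp(qθx)` is at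
  -- most `exp(qθ(y + H)) exp(-qθz)`.
  have hPW (x : ℝ) : eexp (θ * x) * P x ≤
      eexp (q * θ * (y + H)) * (eexp ((1 - q) * θ * x) * W (Set.Ioc (y - x) (y - x + H))) := by
    rw [show θ * x = (1 - q) * θ * x + q * θ * x by ring, eexp_add, mul_assoc,
      mul_left_comm (eexp (q * θ * (y + H)))]
    refine mul_le_mul' le_rfl ?_
    change _ * convPow π' m _ ≤ _
    rw [withDensity_apply _ measurableSet_Ioc, ← lintegral_const_mul _ (by fun_prop),
      ← setLIntegral_const]
    refine setLIntegral_mono' measurableSet_Ioc fun z (hz : z ∈ Set.Ioc (y - x) (y - x + H)) => ?_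
    rw [← eexp_add]
    refine eexp_le_eexp ?_
    have : 0 ≤ q * θ * (y + H - x - z) := mul_nonneg (mul_nonneg hq hθ) (by linarith [hz.2])
    linarith
  have hSW : S ≤ eexp (q * θ * (y + H)) *
      c.sum (fun x => eexp ((1 - q) * θ * x) * W (Set.Ioc (y - x) (y - x + H))) := by
    rw [← c.sum_const_mul]
    exact c.sum_mono hPW
  calc (c.sum fun x => eexp (F - θ * (y - x)) * P x) ^ (1 + q)
      = eexp ((1 + q) * (F - θ * y)) * (S ^ q * S) := by
        rw [hS, ENNReal.mul_rpow_of_nonneg _ _ (by linarith), eexp_rpow,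
          ENNReal.rpow_add_of_nonneg _ _ zero_le_one hq, ENNReal.rpow_one, mul_comm S]
    _ ≤ eexp ((1 + q) * (F - θ * y)) * (c.expSum θ ^ q * (eexp (q * θ * (y + H)) *
      c.sum (fun x => eexp ((1 - q) * θ * x) * W (Set.Ioc (y - x) (y - x + H))))) := by
        gcongr
    _ = _ := by
        rw [show (1 + q) * F - θ * y + q * θ * H =
          (1 + q) * (F - θ * y) + q * θ * (y + H) by ring, eexp_add]
        ring

/-- The recursion of `phaseTwo` mirrors that of the correction: its convolution transports later
splits through one step, and its second summand accounts for a split at the current generation. -/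
theorem correction_replicate_le {ν : Measure PointConfig} [IsProbabilityMeasure ν]
    {π' : Measure ℝ} {θ q H E' b : ℝ} (hπ' : IsTiltedLaw ν θ E' b π') (hθ : 0 ≤ θ) (hq : 0 ≤ q)
    (m : ℕ) (y : ℝ) :
    correction q H (List.replicate m ν) y ≤
      eexp (m * E' - θ * y) * phaseTwo ν π' θ q H E' m (Set.Ioc y (y + H)) := by
  have := hπ'.prob
  induction m generalizing y with
  | zero => simp [correction]
  | succ m ih =>
    have := sFinite_phaseTwo ν π' θ q H E' m
    have := sFinite_meanMeasure_replicate ν ν 0 m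
    have hdens := isExpDensity_meanMeasure hπ' hπ' 0 m
    simp only [List.replicate_zero, List.nil_append, convPow, Measure.dirac_zero_conv,
      CharP.cast_eq_zero, zero_mul, zero_add] at hdens
    rw [List.replicate_succ, correction, phaseTwo, Measure.add_apply, Measure.smul_apply,
      smul_eq_mul, mul_add]
    have hm := measurable_measure_Ioc (phaseTwo ν π' θ q H E' m) y H
    have hg : Measurable fun x => eexp (m * E' - θ * (y - x)) *
        phaseTwo ν π' θ q H E' m (Set.Ioc (y - x) (y - x + H)) := Measurable.mul (by fun_prop) hm
    calc _ ≤ ∫⁻ c, (c.sum (fun x => eexp (m * E' - θ * (y - x)) *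
            phaseTwo ν π' θ q H E' m (Set.Ioc (y - x) (y - x + H))) +
          (c.sum fun x => eexp (m * E' - θ * (y - x)) *
            convPow π' m (Set.Ioc (y - x) (y - x + H))) ^ (1 + q)) ∂ν := by
          refine lintegral_mono fun c => ?_
          gcongr ?_ + ?_ ^ (1 + q)
          · exact c.sum_mono fun x => ih (y - x)
          · exact c.sum_mono fun x => hdens.Ioc_le hθ _ _
      _ ≤ _ := by
          rw [lintegral_add_left (measurable_sum hg)]
          refine add_le_add (le_of_eq ?_) ?_
          · rw [lintegral_sum_eexp_mul_Ioc hπ']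
            congr 2
            push_cast
            ring
          · refine (lintegral_rpow_sum_le ν hθ hq H (m * E') y m).trans_eq ?_
            conv_rhs => rw [← mul_assoc, ← eexp_add]
            congr 2
            push_cast
            ring

/-- Splits in the second phase are carried back by the first walk. For splits in the first phase the
windows are bounded by the concentration `K` of the second walk, leaving a multiple of
`exp((1+q)θx)`; the hypothesis on `M` says that this multiple is a supersolution of the recursion.
-/
theorem correction_replicate_append_le {μ ν : Measure PointConfig} [IsProbabilityMeasure μ]
    [IsProbabilityMeasure ν] {π π' : Measure ℝ} {θ q H E E' a b : ℝ}
    (hπ : IsTiltedLaw μ θ E a π) (hπ' : IsTiltedLaw ν θ E' b π') (hθ : 0 ≤ θ) (hq : 0 ≤ q)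
    {M : ℝ≥0∞} (hM : M * laplace μ ((1 + q) * θ) + ∫⁻ c, c.expSum θ ^ (1 + q) ∂μ ≤
      M * eexp ((1 + q) * E)) {m : ℕ} {K : ℝ≥0∞}
    (hK : ∀ x, convPow π' m (Set.Ioc x (x + H)) ≤ K) (k : ℕ) (y : ℝ) :
    correction q H (List.replicate k μ ++ List.replicate m ν) y ≤
      eexp (k * E + m * E' - θ * y) *
          (convPow π k ∗ phaseTwo ν π' θ q H E' m) (Set.Ioc y (y + H)) +
        M * (K * eexp (k * E + m * E' - θ * y)) ^ (1 + q) := by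
  have := hπ.prob
  have := hπ'.prob
  have := sFinite_phaseTwo ν π' θ q H E' m
  have h1q : 0 ≤ 1 + q := by linarith
  induction k generalizing y with
  | zero =>
    simp only [List.replicate_zero, List.nil_append, convPow, Measure.dirac_zero_conv,
      CharP.cast_eq_zero, zero_mul, zero_add]
    exact (correction_replicate_le hπ' hθ hq m y).trans le_self_add
  | succ k ih =>
    have := sFinite_meanMeasure_replicate μ ν k m
    have hdens := isExpDensity_meanMeasure hπ hπ' k m
    set F := k * E + m * E' with hF
    set D := convPow π k ∗ phaseTwo ν π' θ q H E' m
    have hm := measurable_measure_Ioc D y H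
    have hg : Measurable fun x => eexp (F - θ * (y - x)) * D (Set.Ioc (y - x) (y - x + H)) :=
      Measurable.mul (by fun_prop) hm
    -- The dependence on the child's position reduces to `exp(θx)`, so the power of the sum becomes
    -- a power of `expSum θ`.
    have hA (x : ℝ) : meanMeasure (List.replicate k μ ++ List.replicate m ν)
        (Set.Ioc (y - x) (y - x + H)) ≤ K * eexp (F - θ * y) * eexp (θ * x) := by
      refine (hdens.Ioc_le hθ _ _).trans ?_
      rw [mul_assoc, ← eexp_add, show F - θ * y + θ * x = F - θ * (y - x) by ring, mul_comm K]
      gcongr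
      exact (conv_Ioc_le _ _ hK _).trans_eq (by simp)
    rw [List.replicate_succ, List.cons_append, correction, convPow, Measure.conv_assoc,
      show ((k + 1 : ℕ) : ℝ) * E + m * E' - θ * y = E + F - θ * y by rw [hF]; push_cast; ring]
    calc _ ≤ ∫⁻ c, (c.sum (fun x => eexp (F - θ * (y - x)) * D (Set.Ioc (y - x) (y - x + H))) +
          (M * (K * eexp (F - θ * y)) ^ (1 + q) * c.expSum ((1 + q) * θ) +
          (K * eexp (F - θ * y)) ^ (1 + q) * c.expSum θ ^ (1 + q))) ∂μ := by
          refine lintegral_mono fun c => ?_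
          rw [← add_assoc]
          gcongr ?_ + ?_
          · unfold PointConfig.expSum
            rw [← c.sum_const_mul, ← c.sum_add]
            refine c.sum_mono fun x => (ih (y - x)).trans_eq ?_
            congr 1
            rw [show F - θ * (y - x) = F - θ * y + θ * x by ring, eexp_add, ← mul_assoc K,
              ENNReal.mul_rpow_of_nonneg _ _ h1q, eexp_rpow, ← mul_assoc M, mul_assoc (1 + q)]
            rfl
          · rw [← ENNReal.mul_rpow_of_nonneg _ _ h1q]
            refine ENNReal.rpow_le_rpow ?_ h1q
            unfold PointConfig.expSum
            rw [← c.sum_const_mul]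
            exact c.sum_mono hA
      _ = eexp (E + F - θ * y) * (π ∗ D) (Set.Ioc y (y + H)) +
          (K * eexp (F - θ * y)) ^ (1 + q) * (M * laplace μ ((1 + q) * θ) +
            ∫⁻ c, c.expSum θ ^ (1 + q) ∂μ) := by
          have he1 := measurable_expSum θ
          have he2 := measurable_expSum ((1 + q) * θ)
          rw [lintegral_add_left (measurable_sum hg), lintegral_sum_eexp_mul_Ioc hπ,
            lintegral_add_left (by fun_prop), lintegral_const_mul _ he2,
            lintegral_const_mul _ (by fun_prop), laplace_eq_lintegral_expSum]
          ring
      _ ≤ eexp (E + F - θ * y) * (π ∗ D) (Set.Ioc y (y + H)) +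
          (K * eexp (F - θ * y)) ^ (1 + q) * (M * eexp ((1 + q) * E)) := by gcongr
      _ = _ := by
          congr 1
          rw [show E + F - θ * y = (F - θ * y) + E by ring, eexp_add, ← mul_assoc K,
            ENNReal.mul_rpow_of_nonneg (K * _) _ h1q, eexp_rpow E]
          ring

/-! ### Tail bounds around the level of unit mean -/

theorem ofReal_div_sqrt_le {C : ℝ} (hC : 0 ≤ C) {k n r : ℝ} (hr : 0 < r) (hn : 0 < n)
    (h : r * n ≤ k) :
    ENNReal.ofReal (C / Real.sqrt k) ≤ ENNReal.ofReal (C / Real.sqrt r / Real.sqrt n) := by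
  refine ENNReal.ofReal_le_ofReal ?_
  rw [div_div, ← Real.sqrt_mul hr.le]
  have : 0 < Real.sqrt (r * n) := Real.sqrt_pos.2 (by positivity)
  gcongr

theorem exists_convPow_Ioc_le' (ρ : Measure ℝ) [IsProbabilityMeasure ρ] (hρ : MemLp id 2 ρ)
    {a : ℝ} (ha : ∫ x, x ∂ρ = a) (hv : 0 < ∫ x, (x - a) ^ 2 ∂ρ) (H : ℝ) :
    ∃ C : ℝ, 0 < C ∧ ∀ n : ℕ, 0 < n → ∀ x : ℝ,
      convPow ρ n (Set.Ioc x (x + H)) ≤ ENNReal.ofReal (C / Real.sqrt n) := by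
  obtain ⟨C, hC, h⟩ := exists_convPow_Ioc_le ρ hρ ha hv
  refine ⟨(⌈H⌉₊ + 1) * C, by positivity, fun n hn x => ?_⟩
  have hcov (N : ℕ) : convPow ρ n (Set.Ioc x (x + N)) ≤ N * ENNReal.ofReal (C / Real.sqrt n) := by
    induction N with
    | zero => simp
    | succ N ih =>
      have hsub : Set.Ioc x (x + (N + 1 : ℕ)) ⊆
          Set.Ioc x (x + N) ∪ Set.Ioc (x + N) (x + N + 1) := by
        intro z hz
        have h2 := hz.2
        push_cast at h2
        rcases le_or_gt z (x + N) with h1 | h1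
        · exact Or.inl ⟨hz.1, h1⟩
        · exact Or.inr ⟨h1, by linarith⟩
      refine (measure_mono hsub).trans ((measure_union_le _ _).trans ?_)
      push_cast
      rw [add_mul, one_mul]
      exact add_le_add ih (h n hn _)
  have hN : Set.Ioc x (x + H) ⊆ Set.Ioc x (x + (⌈H⌉₊ + 1 : ℕ)) := by
    refine Set.Ioc_subset_Ioc_right ?_
    have := Nat.le_ceil H
    push_cast
    linarith
  refine (measure_mono hN).trans ((hcov _).trans_eq ?_)
  rw [mul_div_assoc, ENNReal.ofReal_mul (by positivity)]
  congr 1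
  rw [← ENNReal.ofReal_natCast]
  push_cast
  rfl

/-- The phase with more steps has at least half of them, and its concentration survives convolution
with the other. -/
theorem exists_convPow_conv_Ioc_le {π π' : Measure ℝ} [IsProbabilityMeasure π]
    [IsProbabilityMeasure π'] (hπ : MemLp id 2 π) (hπ' : MemLp id 2 π') {a b : ℝ}
    (ha : ∫ x, x ∂π = a) (hb : ∫ x, x ∂π' = b) (hv : 0 < ∫ x, (x - a) ^ 2 ∂π)
    (hv' : 0 < ∫ x, (x - b) ^ 2 ∂π') :
    ∃ C : ℝ, 0 < C ∧ ∀ k m : ℕ, 0 < k + m → ∀ x : ℝ,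
      (convPow π k ∗ convPow π' m) (Set.Ioc x (x + 1)) ≤
        ENNReal.ofReal (C / Real.sqrt (k + m : ℕ)) := by
  obtain ⟨C, hC, h⟩ := exists_convPow_Ioc_le π hπ ha hv
  obtain ⟨C', hC', h'⟩ := exists_convPow_Ioc_le π' hπ' hb hv'
  have hmax : 0 < max C C' := lt_max_of_lt_left hC
  refine ⟨max C C' / Real.sqrt (1 / 2), by positivity, fun k m hkm x => ?_⟩
  have hkm' : (0 : ℝ) < (k + m : ℕ) := by exact_mod_cast hkm
  rcases le_total m k with hle | hle
  · have hle' : (m : ℝ) ≤ k := by exact_mod_cast hle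
    rw [convPow_conv_comm]
    refine (conv_Ioc_le _ _ (h k (by omega)) x).trans ?_
    rw [measure_univ, one_mul]
    refine le_trans (ENNReal.ofReal_le_ofReal ?_)
      (ofReal_div_sqrt_le hmax.le one_half_pos hkm' (k := k) (by push_cast; linarith))
    gcongr
    exact le_max_left _ _
  · have hle' : (k : ℝ) ≤ m := by exact_mod_cast hle
    refine (conv_Ioc_le _ _ (h' m (by omega)) x).trans ?_
    rw [measure_univ, one_mul]
    refine le_trans (ENNReal.ofReal_le_ofReal ?_)
      (ofReal_div_sqrt_le hmax.le one_half_pos hkm' (k := m) (by push_cast; linarith))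
    gcongr
    exact le_max_right _ _

theorem isProbabilityMeasure_of_mem_replicate_append {μ ν : Measure PointConfig}
    [IsProbabilityMeasure μ] [IsProbabilityMeasure ν] {k m : ℕ} {ρ : Measure PointConfig}
    (hρ : ρ ∈ List.replicate k μ ++ List.replicate m ν) : IsProbabilityMeasure ρ := by
  rcases List.mem_append.1 hρ with h | h
  · rw [List.eq_of_mem_replicate h]; infer_instance
  · rw [List.eq_of_mem_replicate h]; infer_instance

/-- The first moment upper bound of the tail of the maximal displacement. -/
theorem exists_one_sub_cdfMax_le {μ ν : Measure PointConfig} [IsProbabilityMeasure μ]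
    [IsProbabilityMeasure ν] {θ E E' a b : ℝ} {π π' : Measure ℝ} (hθ : 0 < θ)
    (hπ : IsTiltedLaw μ θ E a π) (hπ' : IsTiltedLaw ν θ E' b π') :
    ∃ C : ℝ, 0 < C ∧ ∀ k m : ℕ, 0 < k + m → ∀ y : ℝ,
      1 - cdfMax (List.replicate k μ ++ List.replicate m ν) y ≤
        eexp (k * E + m * E' - θ * y) * ENNReal.ofReal (C / Real.sqrt (k + m : ℕ)) := by
  have := hπ.prob
  have := hπ'.prob
  obtain ⟨C, hC, h⟩ := exists_convPow_conv_Ioc_le hπ.memLp hπ'.memLp hπ.mean hπ'.mean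
    hπ.variance_pos hπ'.variance_pos
  have hlt : Real.exp (-θ) < 1 := by simpa using hθ
  have h1 : 0 < 1 - Real.exp (-θ) := by linarith
  have h2 : (1 - eexp (-θ))⁻¹ = ENNReal.ofReal (1 - Real.exp (-θ))⁻¹ := by
    rw [ENNReal.ofReal_inv_of_pos h1, ENNReal.ofReal_sub _ (Real.exp_pos _).le, ENNReal.ofReal_one]
    rfl
  refine ⟨C * (1 - Real.exp (-θ))⁻¹, by positivity, fun k m hkm y => ?_⟩
  refine (one_sub_cdfMax_le _ (fun ρ hρ => isProbabilityMeasure_of_mem_replicate_append hρ)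
    y).trans ?_
  rw [(isExpDensity_meanMeasure hπ hπ' k m).apply_eq measurableSet_Ioi, sub_eq_add_neg,
    eexp_add (k * E + m * E'), mul_assoc]
  refine mul_le_mul' le_rfl ?_
  -- Unit windows above `y` have mass `O((k+m)^{-1/2})` and exponential weights decaying
  -- geometrically.
  calc ∫⁻ x in Set.Ioi y, eexp (-(θ * x)) ∂(convPow π k ∗ convPow π' m)
      ≤ ∫⁻ x in ⋃ j : ℕ, Set.Ioc (y + j) (y + j + 1), eexp (-(θ * x))
          ∂(convPow π k ∗ convPow π' m) := lintegral_mono_set (Ioi_subset_iUnion_Ioc y)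
    _ ≤ ENNReal.ofReal (C / Real.sqrt (k + m : ℕ)) *
          ∑' j : ℕ, eexp (-(θ * y)) * eexp (-θ) ^ j := by
        refine lintegral_iUnion_le_tsum (fun j => measurableSet_Ioc) (fun j => h k m hkm _) ?_
        intro j x hx
        rw [eexp_pow, ← eexp_add]
        refine eexp_le_eexp ?_
        have : θ * (y + j) ≤ θ * x := mul_le_mul_of_nonneg_left hx.1.le hθ.le
        linarith
    _ = _ := by
        rw [ENNReal.tsum_mul_left, ENNReal.tsum_geometric, h2, mul_div_right_comm,
          ENNReal.ofReal_mul (by positivity)]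
        ring

theorem exists_rpow_mul_le {q c C : ℝ} (hq : 0 < q) (hc : 0 < c) :
    ∃ ε : ℝ, 0 < ε ∧ ε ≤ 1 ∧ ε ^ (1 + q) * C ≤ ε * c := by
  have h1 : Tendsto (fun ε : ℝ => ε ^ q * C) (𝓝[>] 0) (𝓝 (0 ^ q * C)) :=
    (((Real.continuousAt_rpow_const 0 q (Or.inr hq.le)).tendsto).mono_left
      nhdsWithin_le_nhds).mul_const C
  rw [Real.zero_rpow hq.ne', zero_mul] at h1
  obtain ⟨ε, h2, h3⟩ := ((h1.eventually (gt_mem_nhds hc)).and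
    (Ioc_mem_nhdsGT (zero_lt_one' ℝ))).exists
  refine ⟨ε, h3.1, h3.2, ?_⟩
  rw [Real.rpow_add h3.1, Real.rpow_one, mul_assoc]
  exact mul_le_mul_of_nonneg_left h2.le h3.1.le

theorem eventually_mul_le {k : ℕ → ℕ} {r s : ℝ} (hrs : r < s)
    (hk : Tendsto (fun n => (k n : ℝ) / n) atTop (𝓝 s)) : ∀ᶠ n : ℕ in atTop, r * n ≤ k n := by
  filter_upwards [hk.eventually (lt_mem_nhds hrs), eventually_gt_atTop 0] with n hn hn0
  have hn0' : (0 : ℝ) < n := by exact_mod_cast hn0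
  exact ((lt_div_iff₀ hn0').1 hn).le

/-- At the critical level the branching random walk exceeds with probability bounded below. -/
theorem exists_le_one_sub_cdfMax {μ ν : Measure PointConfig} [IsProbabilityMeasure μ]
    [IsProbabilityMeasure ν] {θ E E' a b q : ℝ} {π π' : Measure ℝ} (hθ : 0 < θ)
    (hπ : IsTiltedLaw μ θ E a π) (hπ' : IsTiltedLaw ν θ E' b π') (hq : 0 < q) (hq1 : q ≤ 1)
    {M : ℝ≥0∞} (hMt : M ≠ ∞)
    (hM : M * laplace μ ((1 + q) * θ) + ∫⁻ c, c.expSum θ ^ (1 + q) ∂μ ≤ M * eexp ((1 + q) * E))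
    (hbias : ∫⁻ c, c.expSum ((1 - q) * θ) * c.expSum θ ^ q ∂ν < ∞)
    (hlam : eexp (q * E') * ∫⁻ x, eexp (-(q * θ) * x) ∂π' < 1) {t t' : ℝ} (ht : 0 < t)
    (ht' : 0 < t') :
    ∃ p : ℝ, 0 < p ∧ ∀ (k m : ℕ → ℕ) (w : ℕ → ℝ),
      Tendsto (fun n => (k n : ℝ) / n) atTop (𝓝 t) →
      Tendsto (fun n => (m n : ℝ) / n) atTop (𝓝 t') →
      Tendsto (fun n : ℕ => (w n - k n * a - m n * b) / Real.sqrt n) atTop (𝓝 0) →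
      (∀ᶠ n : ℕ in atTop, eexp (k n * E + m n * E' - θ * w n) = ENNReal.ofReal (Real.sqrt n)) →
      ∀ᶠ n in atTop, ENNReal.ofReal p ≤
        1 - cdfMax (List.replicate (k n) μ ++ List.replicate (m n) ν) (w n) := by
  have := hπ.prob
  have := hπ'.prob
  obtain ⟨c, H, hc, hH, hlow⟩ := exists_local_lower_bound π π' hπ.memLp hπ'.memLp hπ.mean hπ'.mean
    hπ.variance_pos ht ht'.le
  obtain ⟨C, hC, hconc⟩ := exists_convPow_Ioc_le' π hπ.memLp hπ.mean hπ.variance_pos H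
  obtain ⟨C', hC', hconc'⟩ := exists_convPow_Ioc_le' π' hπ'.memLp hπ'.mean hπ'.variance_pos H
  set C₁ := C / Real.sqrt (t / 2)
  set C₂ := C' / Real.sqrt (t' / 2)
  set B := eexp (q * θ * H - E') * biasedIntensity ν θ q Set.univ *
    (1 - eexp (q * E') * ∫⁻ x, eexp (-(q * θ) * x) ∂π')⁻¹
  have hB : B ≠ ∞ := by
    refine ENNReal.mul_ne_top (ENNReal.mul_ne_top (eexp_ne_top _) ?_) ?_
    · rw [biasedIntensity_univ]
      exact hbias.ne
    · rw [ENNReal.inv_ne_top]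
      exact (tsub_pos_of_lt hlam).ne'
  set C₃ := B * ENNReal.ofReal C₁ + M * ENNReal.ofReal C₂ ^ (1 + q) with hC₃
  have hC₃t : C₃ ≠ ∞ := ENNReal.add_ne_top.2 ⟨ENNReal.mul_ne_top hB ENNReal.ofReal_ne_top,
    ENNReal.mul_ne_top hMt (ENNReal.rpow_ne_top_of_nonneg (by linarith) ENNReal.ofReal_ne_top)⟩
  set c' := Real.exp (-(θ * H)) * c with hc'
  have hc'0 : 0 < c' := by positivity
  -- The correction then costs at most half of `ε * c'`, the lower bound for the mean, and `p` is
  -- the remaining half.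
  obtain ⟨ε, hε, hε1, hεC⟩ := exists_rpow_mul_le (C := C₃.toReal) hq (half_pos hc'0)
  refine ⟨ε * (c' / 2), by positivity, fun k m w hk hm hw hexp => ?_⟩
  filter_upwards [hlow k m w hk hm hw, hexp, eventually_mul_le (half_lt_self ht) hk,
    eventually_mul_le (half_lt_self ht') hm, eventually_gt_atTop 0] with n h1 h2 h3 h4 h5
  have hn : (0 : ℝ) < n := by exact_mod_cast h5
  have hsq : 0 < Real.sqrt n := Real.sqrt_pos.2 hn
  have hk0 : 0 < k n := by
    have : (0 : ℝ) < k n := by nlinarith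
    exact_mod_cast this
  have hm0 : 0 < m n := by
    have : (0 : ℝ) < m n := by nlinarith
    exact_mod_cast this
  have hcancel (r : ℝ) : ENNReal.ofReal (Real.sqrt n) * ENNReal.ofReal (r / Real.sqrt n) =
      ENNReal.ofReal r := by
    rw [← ENNReal.ofReal_mul hsq.le, mul_div_cancel₀ _ hsq.ne']
  set L := List.replicate (k n) μ ++ List.replicate (m n) ν
  have hmean : ENNReal.ofReal c' ≤ meanMeasure L (Set.Ioc (w n) (w n + H)) := by
    refine le_trans ?_ ((isExpDensity_meanMeasure hπ hπ' (k n) (m n)).le_Ioc hθ.le (w n) H)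
    rw [show k n * E + m n * E' - θ * (w n + H) = -(θ * H) + (k n * E + m n * E' - θ * w n) by
      ring, eexp_add, h2, hc', ENNReal.ofReal_mul (Real.exp_pos _).le, mul_assoc, ← hcancel c]
    exact mul_le_mul' le_rfl (mul_le_mul' le_rfl h1)
  -- The exponential prefactor is `√n`. For splits in the second phase it is cancelled by the
  -- concentration of the first walk, for splits in the first phase by that of the second walk; both
  -- phases must therefore have length of order `n`.
  have hcorr : correction q H L (w n) ≤ C₃ := by
    refine (correction_replicate_append_le hπ hπ' hθ.le hq.le hM
      (K := ENNReal.ofReal (C₂ / Real.sqrt n)) (fun x => (hconc' _ hm0 x).trans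
        (ofReal_div_sqrt_le hC'.le (half_pos ht') hn h4)) (k n) (w n)).trans ?_
    rw [h2, hC₃]
    refine add_le_add ?_ ?_
    · have := sFinite_phaseTwo ν π' θ q H E' (m n)
      rw [Measure.conv_comm]
      refine (mul_le_mul' le_rfl (conv_Ioc_le _ _ (fun x => (hconc _ hk0 x).trans
        (ofReal_div_sqrt_le hC.le (half_pos ht) hn h3)) _)).trans ?_
      rw [mul_left_comm, hcancel]
      exact mul_le_mul' (phaseTwo_univ_le _) le_rfl
    · rw [mul_comm (ENNReal.ofReal (C₂ / _)), hcancel]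
  have hmain := mul_meanMeasure_le L
    (fun ρ hρ => isProbabilityMeasure_of_mem_replicate_append hρ) hq.le hq1 hε1 (H := H) (w n)
  have hfin : ENNReal.ofReal (ε * (c' / 2)) + ENNReal.ofReal (ε * (c' / 2)) ≤
      (1 - cdfMax L (w n)) + ENNReal.ofReal (ε * (c' / 2)) := by
    calc _ = ENNReal.ofReal ε * ENNReal.ofReal c' := by
          rw [← ENNReal.ofReal_add (by positivity) (by positivity), ← ENNReal.ofReal_mul hε.le]
          congr 1
          ring
      _ ≤ ENNReal.ofReal ε * meanMeasure L (Set.Ioc (w n) (w n + H)) := mul_le_mul' le_rfl hmean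
      _ ≤ _ := hmain
      _ ≤ _ := by
          refine add_le_add le_rfl ((mul_le_mul' le_rfl hcorr).trans ?_)
          rw [ENNReal.ofReal_rpow_of_pos hε, ← ENNReal.ofReal_toReal hC₃t,
            ← ENNReal.ofReal_mul (by positivity)]
          exact ENNReal.ofReal_le_ofReal hεC
  exact (ENNReal.add_le_add_iff_right ENNReal.ofReal_ne_top).1 hfin

/-! ### From a positive probability to tightness -/

theorem exists_measure_bad_le (μ : Measure PointConfig) [IsProbabilityMeasure μ]
    (h0 : μ {c | c.1 = 0} = 0) {δ : ℝ} (hδ : 0 < δ) :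
    ∃ R : ℝ, 0 ≤ R ∧ μ {c | c.1 = 0 ∨ R < |c.2 0| ∨ R < |c.2 1|} ≤ ENNReal.ofReal δ := by
  have hmeas (R : ℝ) : MeasurableSet {c : PointConfig | R < |c.2 0| ∨ R < |c.2 1|} := by
    refine MeasurableSet.union ?_ ?_
    · exact measurableSet_lt measurable_const (measurable_point 0).abs
    · exact measurableSet_lt measurable_const (measurable_point 1).abs
  have h1 := tendsto_measure_iInter_atTop (μ := μ)
    (s := fun n : ℕ => {c : PointConfig | (n : ℝ) < |c.2 0| ∨ (n : ℝ) < |c.2 1|})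
    (fun n => (hmeas n).nullMeasurableSet) (fun m n hmn c hc => by
      have h2 : (m : ℝ) ≤ n := by exact_mod_cast hmn
      exact hc.imp (fun h => h2.trans_lt h) fun h => h2.trans_lt h) ⟨0, measure_ne_top _ _⟩
  have h2 : (⋂ n : ℕ, {c : PointConfig | (n : ℝ) < |c.2 0| ∨ (n : ℝ) < |c.2 1|}) = ∅ := by
    refine Set.eq_empty_of_forall_notMem fun c hc => ?_
    obtain ⟨n, hn⟩ := exists_nat_ge (max |c.2 0| |c.2 1|)
    rcases Set.mem_iInter.1 hc n with h | h
    · exact absurd ((le_max_left _ _).trans hn) (not_le.2 h)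
    · exact absurd ((le_max_right _ _).trans hn) (not_le.2 h)
  rw [h2, measure_empty] at h1
  obtain ⟨n, hn⟩ := (h1.eventually (gt_mem_nhds (ENNReal.ofReal_pos.2 hδ))).exists
  refine ⟨n, Nat.cast_nonneg n, ?_⟩
  calc _ ≤ μ {c | c.1 = 0} + μ {c | (n : ℝ) < |c.2 0| ∨ (n : ℝ) < |c.2 1|} :=
        measure_union_le _ _
    _ ≤ ENNReal.ofReal δ := by
        rw [h0, zero_add]
        exact hn.le

/-- One branching step makes it quadratically unlikely that the maximum stays low. -/
theorem exists_cdfMax_cons_le (μ : Measure PointConfig) [IsProbabilityMeasure μ]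
    (h0 : μ {c | c.1 = 0} = 0) {δ : ℝ} (hδ : 0 < δ) :
    ∃ R : ℝ, ∀ L : List (Measure PointConfig), ∀ y s : ℝ, 0 ≤ s →
      cdfMax L (y + R) ≤ ENNReal.ofReal s →
      cdfMax (μ :: L) y ≤ ENNReal.ofReal (δ + (μ.real {c | c.1 = 1} * s +
        (1 - μ.real {c | c.1 = 1}) * s ^ 2)) := by
  obtain ⟨R, hR, hbad⟩ := exists_measure_bad_le μ h0 hδ
  refine ⟨R, fun L y s hs hL => ?_⟩
  have hm1 : MeasurableSet {c : PointConfig | c.1 = 1} :=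
    measurable_fst (measurableSet_singleton 1)
  -- The entry `c.2 1` is tested even when there is only one child. It is then a meaningless real
  -- number, but still bounded by a large `R` with high probability.
  set bad := {c : PointConfig | c.1 = 0 ∨ R < |c.2 0| ∨ R < |c.2 1|}
  have hmb : MeasurableSet bad := by
    refine (measurable_fst (measurableSet_singleton 0)).union (MeasurableSet.union ?_ ?_)
    · exact measurableSet_lt measurable_const (measurable_point 0).abs
    · exact measurableSet_lt measurable_const (measurable_point 1).abs
  set p := μ.real {c | c.1 = 1}
  have hp0 : 0 ≤ p := measureReal_nonneg
  have hp1 : p ≤ 1 := measureReal_le_one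
  have hF (x : ℝ) (hx : |x| ≤ R) : cdfMax L (y - x) ≤ ENNReal.ofReal s :=
    (cdfMax_mono L (by linarith [neg_le_of_abs_le hx])).trans hL
  calc cdfMax (μ :: L) y
      ≤ ∫⁻ c, (bad.indicator 1 c + ({c : PointConfig | c.1 = 1}.indicator
          (fun _ => ENNReal.ofReal s) c + {c : PointConfig | c.1 = 1}ᶜ.indicator
          (fun _ => ENNReal.ofReal s ^ 2) c)) ∂μ := by
        refine lintegral_mono fun c => ?_
        by_cases hb : c ∈ bad
        · rw [Set.indicator_of_mem hb]
          exact (c.prod_le_one _).trans le_self_add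
        · refine le_trans ?_ le_add_self
          simp only [bad, Set.mem_ofPred_eq, not_or, not_lt] at hb
          obtain ⟨hb0, hb1, hb2⟩ := hb
          -- Two children are enough to gain a square; the others are discarded.
          refine (c.prod_le_prodLT _ 2).trans ?_
          have hc0 : (0 : ℕ∞) < c.1 := pos_iff_ne_zero.2 hb0
          by_cases hc : c.1 = 1
          · simpa [PointConfig.prodLT, Finset.prod_range_succ, hc] using hF _ hb1
          · have hc1 : (1 : ℕ∞) < c.1 := lt_of_le_of_ne (Order.one_le_iff_pos.2 hc0) (Ne.symm hc)
            simpa [PointConfig.prodLT, Finset.prod_range_succ, hc, hc0, hc1, sq] using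
              mul_le_mul' (hF _ hb1) (hF _ hb2)
    _ = μ bad + (ENNReal.ofReal s * μ {c | c.1 = 1} +
          ENNReal.ofReal s ^ 2 * μ {c | c.1 = 1}ᶜ) := by
        rw [lintegral_add_left (measurable_one.indicator hmb),
          lintegral_add_left (measurable_const.indicator hm1), lintegral_indicator_one hmb,
          lintegral_indicator_const hm1, lintegral_indicator_const hm1.compl]
    _ ≤ ENNReal.ofReal δ + (ENNReal.ofReal s * ENNReal.ofReal p +
          ENNReal.ofReal s ^ 2 * ENNReal.ofReal (1 - p)) := by
        rw [← ofReal_measureReal (μ := μ) (s := {c | c.1 = 1}),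
          ← ofReal_measureReal (μ := μ) (s := {c | c.1 = 1}ᶜ), probReal_compl_eq_one_sub hm1]
        gcongr
    _ = _ := by
        rw [← ENNReal.ofReal_pow hs, ← ENNReal.ofReal_mul hs, ← ENNReal.ofReal_mul (by positivity),
          ← ENNReal.ofReal_add (by positivity) (mul_nonneg (by positivity) (by linarith)),
          ← ENNReal.ofReal_add hδ.le (add_nonneg (by positivity)
            (mul_nonneg (by positivity) (by linarith)))]
        congr 1
        ring

/-- Without extinction the maximal displacement is not `-∞`. -/
theorem exists_cdfMax_le (L : List (Measure PointConfig))
    (hL : ∀ μ ∈ L, IsProbabilityMeasure μ ∧ μ {c | c.1 = 0} = 0) {ε : ℝ} (hε : 0 < ε) :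
    ∃ y : ℝ, cdfMax L y ≤ ENNReal.ofReal ε := by
  induction L generalizing ε with
  | nil => exact ⟨-1, by norm_num [cdfMax]⟩
  | cons μ L ih =>
    obtain ⟨hμ, h0⟩ := hL μ (by simp)
    obtain ⟨R, hR⟩ := exists_cdfMax_cons_le μ h0 (half_pos hε)
    -- The cap at one gives `s ^ 2 ≤ s`, so the branching step returns at most `ε / 2 + s`.
    have hs : 0 < min (ε / 2) 1 := lt_min (half_pos hε) one_pos
    obtain ⟨y, hy⟩ := ih (fun ρ hρ => hL ρ (List.mem_cons_of_mem _ hρ)) hs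
    refine ⟨y - R, (hR L (y - R) _ hs.le (by simpa using hy)).trans
      (ENNReal.ofReal_le_ofReal ?_)⟩
    set s := min (ε / 2) 1
    have h1 : s ≤ ε / 2 := min_le_left _ _
    have h2 : s ≤ 1 := min_le_right _ _
    have hp1 : μ.real {c | c.1 = 1} ≤ 1 := measureReal_le_one
    have h3 : (1 - μ.real {c | c.1 = 1}) * s ^ 2 ≤ (1 - μ.real {c | c.1 = 1}) * s :=
      mul_le_mul_of_nonneg_left (by nlinarith) (by linarith)
    linarith

/-- A uniform positive lower bound for exceeding a level is improved to tightness, by branching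
during a bounded number of generations. -/
theorem exists_eventually_cdfMax_le {μ ν : Measure PointConfig} [IsProbabilityMeasure μ]
    [IsProbabilityMeasure ν] (hμ : Breeding μ) {k m : ℕ → ℕ} (hk : Tendsto k atTop atTop)
    {w : ℕ → ℝ} {p : ℝ} (hp : 0 < p)
    (h : ∀ D : ℕ, ∃ A : ℝ, ∀ᶠ n in atTop, ENNReal.ofReal p ≤
      1 - cdfMax (List.replicate (k n - D) μ ++ List.replicate (m n) ν) (w n - A))
    {ε : ℝ} (hε : 0 < ε) :
    ∃ A : ℝ, ∀ᶠ n in atTop,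
      cdfMax (List.replicate (k n) μ ++ List.replicate (m n) ν) (w n - A) ≤ ENNReal.ofReal ε := by
  wlog hp1 : p < 1 generalizing p
  · refine this (p := 1 / 2) (by norm_num) (fun D => ?_) (by norm_num)
    obtain ⟨A, hA⟩ := h D
    refine ⟨A, hA.mono fun n hn => le_trans (ENNReal.ofReal_le_ofReal ?_) hn⟩
    linarith
  set p₁ := μ.real {c | c.1 = 1} with hp₁
  have hp₁0 : 0 ≤ p₁ := measureReal_nonneg
  have hp₁1 : p₁ < 1 := by
    have := (ENNReal.toReal_lt_toReal (measure_ne_top _ _) ENNReal.one_ne_top).2 hμ.2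
    rwa [ENNReal.toReal_one] at this
  -- While `s ≤ 1 - p`, one branching step maps `s` to at most `δ + lam * s`. Taking `δ = s(1 -
  -- lam)/2` gives the contraction factor `(1 + lam)/2 < 1`.
  set lam := p₁ + (1 - p₁) * (1 - p) with hlam
  have hlam1 : lam < 1 := by nlinarith
  have hlam0 : 0 ≤ lam := by nlinarith
  have key (j : ℕ) : ∀ D : ℕ, ∃ A : ℝ, ∀ᶠ n in atTop,
      cdfMax (List.replicate (k n - D) μ ++ List.replicate (m n) ν) (w n - A) ≤
        ENNReal.ofReal ((1 - p) * ((1 + lam) / 2) ^ j) := by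
    induction j with
    | zero =>
      intro D
      obtain ⟨A, hA⟩ := h D
      refine ⟨A, hA.mono fun n hn => ?_⟩
      rw [pow_zero, mul_one, ENNReal.ofReal_sub _ hp.le, ENNReal.ofReal_one]
      have hle := cdfMax_le_one (List.replicate (k n - D) μ ++ List.replicate (m n) ν)
        (fun ρ hρ => isProbabilityMeasure_of_mem_replicate_append hρ) (w n - A)
      exact ENNReal.le_sub_of_add_le_left ENNReal.ofReal_ne_top
        ((add_le_add hn le_rfl).trans_eq (tsub_add_cancel_of_le hle))
    | succ j ih =>
      intro D
      -- The first remaining generation is peeled off, so the induction needs every deficit `D`,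
      -- with the same `p` for all of them.
      obtain ⟨A, hA⟩ := ih (D + 1)
      set s := (1 - p) * ((1 + lam) / 2) ^ j with hs
      have hs0 : 0 < s := mul_pos (by linarith) (pow_pos (by linarith) _)
      have hs1 : s ≤ 1 - p :=
        mul_le_of_le_one_right (by linarith) (pow_le_one₀ (by linarith) (by linarith))
      obtain ⟨R, hR⟩ := exists_cdfMax_cons_le μ hμ.1 (δ := s * ((1 - lam) / 2))
        (mul_pos hs0 (by linarith))
      refine ⟨A + R, ?_⟩
      filter_upwards [hA, hk.eventually_ge_atTop (D + 1)] with n hn hkn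
      rw [show k n - D = (k n - (D + 1)) + 1 by omega, List.replicate_succ, List.cons_append]
      refine (hR _ (w n - (A + R)) s hs0.le (by
        rwa [show w n - (A + R) + R = w n - A by ring])).trans (ENNReal.ofReal_le_ofReal ?_)
      have h1 : (1 - p₁) * s ^ 2 ≤ (1 - p₁) * ((1 - p) * s) :=
        mul_le_mul_of_nonneg_left (by nlinarith) (by linarith)
      rw [pow_succ ((1 + lam) / 2), ← mul_assoc (1 - p), ← hs, ← hp₁]
      calc _ ≤ s * ((1 - lam) / 2) + (p₁ * s + (1 - p₁) * ((1 - p) * s)) := by gcongr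
        _ = _ := by rw [hlam]; ring
  have hlim : Tendsto (fun j : ℕ => (1 - p) * ((1 + lam) / 2) ^ j) atTop (𝓝 ((1 - p) * 0)) :=
    (tendsto_pow_atTop_nhds_zero_of_lt_one (by linarith) (by linarith)).const_mul _
  rw [mul_zero] at hlim
  obtain ⟨j, hj⟩ := (hlim.eventually (gt_mem_nhds hε)).exists
  obtain ⟨A, hA⟩ := key j 0
  exact ⟨A, hA.mono fun n hn => hn.trans (ENNReal.ofReal_le_ofReal hj.le)⟩

/-! ### Assembly of the tail bounds -/

theorem map_range_ite (μ ν : Measure PointConfig) {K n : ℕ} (h : K ≤ n) :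
    (List.range n).map (fun k => if k < K then μ else ν) =
      List.replicate K μ ++ List.replicate (n - K) ν := by
  obtain ⟨r, rfl⟩ := Nat.exists_eq_add_of_le h
  rw [List.range_add, List.map_append, List.map_map, Nat.add_sub_cancel_left]
  congr 1
  · rw [List.eq_replicate_iff]
    refine ⟨by simp, fun ρ hρ => ?_⟩
    obtain ⟨k, hk, rfl⟩ := List.mem_map.1 hρ
    simp [List.mem_range.1 hk]
  · rw [List.eq_replicate_iff]
    refine ⟨by simp, fun ρ hρ => ?_⟩
    obtain ⟨k, hk, rfl⟩ := List.mem_map.1 hρ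
    simp

theorem exists_forall_le_of_eventually {f : ℕ → ℝ → ℝ≥0∞} (hf : ∀ n, Antitone (f n)) {e : ℝ≥0∞}
    (h1 : ∃ A, ∀ᶠ n in atTop, f n A ≤ e) (h2 : ∀ n, ∃ A, f n A ≤ e) : ∃ A, ∀ n, f n A ≤ e := by
  obtain ⟨A, hA⟩ := h1
  obtain ⟨N, hN⟩ := eventually_atTop.1 hA
  choose B hB using h2
  obtain ⟨C, hC⟩ := ((Finset.range N).image B).exists_le
  refine ⟨max A C, fun n => ?_⟩
  rcases lt_or_ge n N with hn | hn
  · exact (hf n ((hC _ (Finset.mem_image_of_mem _ (Finset.mem_range.2 hn))).trans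
      (le_max_right _ _))).trans (hB n)
  · exact (hf n (le_max_left _ _)).trans (hN n hn)

theorem tendsto_div_sqrt_of_abs_add_log_le {x : ℕ → ℝ} {r C : ℝ}
    (h : ∀ᶠ n : ℕ in atTop, |x n + r * Real.log n| ≤ C) :
    Tendsto (fun n : ℕ => x n / Real.sqrt n) atTop (𝓝 0) := by
  have hsq : Tendsto (fun n : ℕ => Real.sqrt n) atTop atTop :=
    Real.tendsto_sqrt_atTop.comp tendsto_natCast_atTop_atTop
  have hlog : Tendsto (fun n : ℕ => Real.log n / Real.sqrt n) atTop (𝓝 0) := by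
    have := ((isLittleO_log_rpow_atTop (r := 1 / 2) (by norm_num)).tendsto_div_nhds_zero).comp
      tendsto_natCast_atTop_atTop
    refine this.congr fun n => ?_
    simp [Real.sqrt_eq_rpow]
  have h1 : Tendsto (fun n : ℕ => (x n + r * Real.log n) / Real.sqrt n) atTop (𝓝 0) := by
    refine squeeze_zero_norm' ?_ ((tendsto_const_nhds (x := C)).div_atTop hsq)
    filter_upwards [h] with n hn
    rw [norm_div, Real.norm_eq_abs, Real.norm_of_nonneg (Real.sqrt_nonneg _)]
    gcongr
  have h2 := h1.sub (hlog.const_mul r)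
  rw [mul_zero, sub_zero] at h2
  refine h2.congr fun n => ?_
  ring

theorem ofReal_le_abs_sub_coe {x : EReal} {c A : ℝ} (hA : 0 < A)
    (h : ENNReal.ofReal A ≤ (x - (c : EReal)).abs) :
    x ≤ ((c - A : ℝ) : EReal) ∨ ¬ x ≤ ((c + A / 2 : ℝ) : EReal) := by
  induction x with
  | bot => exact Or.inl bot_le
  | top => exact Or.inr (not_le.2 (EReal.coe_lt_top _))
  | coe x =>
    rw [← EReal.coe_sub, EReal.abs_def, ENNReal.ofReal_le_ofReal_iff (abs_nonneg _)] at h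
    rw [EReal.coe_le_coe_iff, EReal.coe_le_coe_iff]
    rcases le_abs.1 h with h | h
    · right; linarith
    · left; linarith

theorem stochBounded_sub_coe {Ω : Type*} [MeasurableSpace Ω] {P : Measure Ω}
    [IsProbabilityMeasure P] {M : ℕ → Ω → EReal} (hM : ∀ n, Measurable (M n)) {c : ℕ → ℝ}
    (h1 : ∀ ε : ℝ, 0 < ε → ∃ A : ℝ, ∀ n,
      P {ω | M n ω ≤ ((c n - A : ℝ) : EReal)} ≤ ENNReal.ofReal ε)
    (h2 : ∀ ε : ℝ, 0 < ε → ∃ A : ℝ, ∀ n,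
      1 - P {ω | M n ω ≤ ((c n + A : ℝ) : EReal)} ≤ ENNReal.ofReal ε) :
    StochBounded P fun n ω => M n ω - (c n : EReal) := by
  intro ε hε
  obtain ⟨A₁, hA₁⟩ := h1 _ (half_pos hε)
  obtain ⟨A₂, hA₂⟩ := h2 _ (half_pos hε)
  -- The factor two matches the halved threshold in `ofReal_le_abs_sub_coe`, where the upper event
  -- is the negation of a weak inequality.
  set A := max (max A₁ (2 * A₂)) 1
  have hA : 0 < A := lt_max_of_lt_right one_pos
  have hAA₁ : A₁ ≤ A := (le_max_left _ _).trans (le_max_left _ _)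
  have hAA₂ : 2 * A₂ ≤ A := (le_max_right _ _).trans (le_max_left _ _)
  refine ⟨A, hA, fun n => ?_⟩
  calc _ ≤ P ({ω | M n ω ≤ ((c n - A₁ : ℝ) : EReal)} ∪
        {ω | M n ω ≤ ((c n + A₂ : ℝ) : EReal)}ᶜ) := by
        refine measure_mono fun ω hω => ?_
        refine (ofReal_le_abs_sub_coe hA hω).imp (fun h => h.trans ?_) fun h h' => h (h'.trans ?_)
        · exact EReal.coe_le_coe_iff.2 (by linarith)
        · exact EReal.coe_le_coe_iff.2 (by linarith)
    _ ≤ _ := measure_union_le _ _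
    _ ≤ ENNReal.ofReal (ε / 2) + ENNReal.ofReal (ε / 2) := by
        refine add_le_add (hA₁ n) ?_
        rw [prob_compl_eq_one_sub (measurableSet_le (hM n) measurable_const)]
        exact hA₂ n
    _ = ENNReal.ofReal ε := by
        rw [← ENNReal.ofReal_add (by positivity) (by positivity), add_halves]

theorem exists_ne_top_mul_add_eq {x y z : ℝ≥0∞} (hx : x < y) (hy : y ≠ ∞) (hz : z ≠ ∞) :
    ∃ M : ℝ≥0∞, M ≠ ∞ ∧ M * x + z = M * y := by
  have h1 : y - x ≠ 0 := (tsub_pos_of_lt hx).ne'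
  refine ⟨z / (y - x), ENNReal.div_ne_top hz h1, ?_⟩
  nth_rewrite 2 [← ENNReal.div_mul_cancel h1 (ENNReal.sub_ne_top hy) (b := z)]
  rw [← mul_add, add_tsub_cancel_of_le hx.le]

/-- Identifies the geometric ratio of `phaseTwo`: it is below one exactly when `κ̃((1-q)θ) <
(1-q)κ̃(θ)`, once `E' = κ̃(θ)` and the transform at `(1-q)θ` is finite. -/
theorem IsTiltedLaw.laplace_eq {ν : Measure PointConfig} {θ E' b : ℝ} {π' : Measure ℝ}
    (hπ' : IsTiltedLaw ν θ E' b π') (q : ℝ) :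
    eexp (q * E') * ∫⁻ x, eexp (-(q * θ) * x) ∂π' =
      eexp ((q - 1) * E') * laplace ν ((1 - q) * θ) := by
  have h1 : laplace ν ((1 - q) * θ) = ∫⁻ x, eexp ((1 - q) * θ * x) ∂(intensity ν) := rfl
  rw [h1, hπ'.density.eq (by fun_prop), ← mul_assoc, ← eexp_add,
    show (q - 1) * E' + E' = q * E' by ring]
  congr 1
  refine lintegral_congr fun x => ?_
  rw [← eexp_add]
  congr 1
  ring

/-- Tightness of the maximal displacement through the interface, around the level where the
expected number of particles above it is of order one. -/
theorem exists_interface_tail_bounds {μ ν : Measure PointConfig} [IsProbabilityMeasure μ]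
    [IsProbabilityMeasure ν] (hμ : Breeding μ) (hν : ν {c | c.1 = 0} = 0)
    {θ E E' a b q : ℝ} {π π' : Measure ℝ} (hθ : 0 < θ)
    (hπ : IsTiltedLaw μ θ E a π) (hπ' : IsTiltedLaw ν θ E' b π') (hq : 0 < q) (hq1 : q ≤ 1)
    {M : ℝ≥0∞} (hMt : M ≠ ∞)
    (hM : M * laplace μ ((1 + q) * θ) + ∫⁻ c, c.expSum θ ^ (1 + q) ∂μ ≤ M * eexp ((1 + q) * E))
    (hbias : ∫⁻ c, c.expSum ((1 - q) * θ) * c.expSum θ ^ q ∂ν < ∞)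
    (hlam : eexp (q * E') * ∫⁻ x, eexp (-(q * θ) * x) ∂π' < 1) {t : ℝ}
    (ht : t ∈ Set.Ioo (0 : ℝ) 1) (hst : (t * a + (1 - t) * b) * θ = t * E + (1 - t) * E')
    {c : ℕ → ℝ} (hc : ∀ n : ℕ, c n = (t * a + (1 - t) * b) * n - 1 / (2 * θ) * Real.log n)
    {L : ℕ → List (Measure PointConfig)} (hL : ∀ n : ℕ, L n =
      List.replicate ⌊(n : ℝ) * t⌋₊ μ ++ List.replicate (n - ⌊(n : ℝ) * t⌋₊) ν)
    {ε : ℝ} (hε : 0 < ε) :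
    (∃ A : ℝ, ∀ n, cdfMax (L n) (c n - A) ≤ ENNReal.ofReal ε) ∧
      ∃ A : ℝ, ∀ n, 1 - cdfMax (L n) (c n + A) ≤ ENNReal.ofReal ε := by
  obtain ⟨ht0, ht1⟩ := ht
  set k : ℕ → ℕ := fun n => ⌊(n : ℝ) * t⌋₊ with hk
  set m : ℕ → ℕ := fun n => n - k n with hm
  have hk_le (n : ℕ) : (k n : ℝ) ≤ n * t := Nat.floor_le (by positivity)
  have hk_gt (n : ℕ) : (n : ℝ) * t < k n + 1 := Nat.lt_floor_add_one _
  have hkn (n : ℕ) : k n ≤ n := by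
    have : (k n : ℝ) ≤ n := (hk_le n).trans (mul_le_of_le_one_right (by positivity) ht1.le)
    exact_mod_cast this
  have hmn (n : ℕ) : (m n : ℝ) = n - k n := Nat.cast_sub (hkn n)
  have hkt : Tendsto (fun n => (k n : ℝ) / n) atTop (𝓝 t) := by
    have h1 := (tendsto_nat_floor_mul_div_atTop ht0.le).comp
      (tendsto_natCast_atTop_atTop (R := ℝ))
    refine h1.congr fun n => ?_
    simp [hk, mul_comm]
  have hktop : Tendsto k atTop atTop :=
    tendsto_nat_floor_atTop.comp (tendsto_natCast_atTop_atTop.atTop_mul_const ht0)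
  have hmt : Tendsto (fun n => (m n : ℝ) / n) atTop (𝓝 (1 - t)) := by
    refine (hkt.const_sub 1).congr' ?_
    filter_upwards [eventually_gt_atTop 0] with n hn
    have hn' : (n : ℝ) ≠ 0 := by positivity
    rw [hmn, sub_div, div_self hn']
  -- This level makes the exponential prefactor exactly `√n` for `n > 0`. By stationarity it differs
  -- from `c n` only through the rounding of `nt`, hence by at most `|E - E'| / θ`.
  set w : ℕ → ℝ := fun n => (k n * E + m n * E' - Real.log n / 2) / θ with hw
  have hθw (n : ℕ) : θ * w n = k n * E + m n * E' - Real.log n / 2 :=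
    mul_div_cancel₀ _ hθ.ne'
  set B := |E - E'| / θ with hB
  have hwc (n : ℕ) : |w n - c n| ≤ B := by
    have h1 : w n - c n = (k n - n * t) * (E - E') / θ := by
      rw [hw, hc, eq_div_iff hθ.ne', sub_mul, div_mul_cancel₀ _ hθ.ne', sub_mul,
        mul_right_comm _ _ θ, hst, hmn]
      field_simp
      ring
    rw [h1, abs_div, abs_mul, abs_of_pos hθ, hB]
    gcongr
    refine mul_le_of_le_one_left (abs_nonneg _) (abs_le.2 ⟨?_, ?_⟩)
    · linarith [hk_gt n]
    · linarith [hk_le n]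
  obtain ⟨p, hp, hlow⟩ := exists_le_one_sub_cdfMax hθ hπ hπ' hq hq1 hMt hM hbias hlam ht0
    (sub_pos.2 ht1)
  have hkD (D : ℕ) : ∀ᶠ n in atTop, ((k n - D : ℕ) : ℝ) = k n - D := by
    filter_upwards [hktop.eventually_ge_atTop D] with n hn
    exact Nat.cast_sub hn
  have hshift (D : ℕ) : ∃ A : ℝ, ∀ᶠ n in atTop, ENNReal.ofReal p ≤
      1 - cdfMax (List.replicate (k n - D) μ ++ List.replicate (m n) ν) (w n - A) := by
    -- Dropping `D` generations divides the mean by `exp(DE)`; lowering the level by `DE / θ`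
    -- restores it. The constant `p` was obtained before the sequences were chosen, so it does not
    -- depend on `D`.
    refine ⟨D * E / θ, hlow (fun n => k n - D) m (fun n => w n - D * E / θ) ?_ hmt ?_ ?_⟩
    · have h1 := hkt.sub (tendsto_const_div_atTop_nhds_zero_nat (D : ℝ))
      rw [sub_zero] at h1
      refine h1.congr' ?_
      filter_upwards [hkD D] with n hn
      rw [hn, sub_div]
    · refine tendsto_div_sqrt_of_abs_add_log_le (r := 1 / (2 * θ))
        (C := B + |a - b| + |D * (a - E / θ)|) ?_
      filter_upwards [hkD D] with n hn
      have h1 : w n - D * E / θ - ((k n - D : ℕ) : ℝ) * a - m n * b +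
          1 / (2 * θ) * Real.log n =
          (w n - c n) + (n * t - k n) * (a - b) + D * (a - E / θ) := by
        rw [hn, hmn, hc]
        ring
      rw [h1]
      refine (abs_add_three _ _ _).trans ?_
      refine add_le_add (add_le_add (hwc n) ?_) le_rfl
      rw [abs_mul]
      refine mul_le_of_le_one_left (abs_nonneg _) (abs_le.2 ⟨?_, ?_⟩)
      · linarith [hk_le n]
      · linarith [hk_gt n]
    · filter_upwards [hkD D, eventually_gt_atTop 0] with n hn hn0
      have hn0' : (0 : ℝ) < n := by exact_mod_cast hn0
      rw [hn, mul_sub, hθw, mul_div_cancel₀ _ hθ.ne', show (k n - D) * E + m n * E' -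
        (k n * E + m n * E' - Real.log n / 2 - D * E) = Real.log n / 2 by ring, eexp,
        Real.exp_half, Real.exp_log hn0']
  constructor
  · refine exists_forall_le_of_eventually (f := fun n A => cdfMax (L n) (c n - A))
      (fun n x y hxy => cdfMax_mono (L n) (sub_le_sub_left hxy (c n))) ?_ fun n => ?_
    · obtain ⟨A, hA⟩ := exists_eventually_cdfMax_le hμ hktop hp hshift hε
      refine ⟨A + B, hA.mono fun n hn => ?_⟩
      rw [hL]
      exact (cdfMax_mono _ (by linarith [(abs_le.1 (hwc n)).1])).trans hn
    -- The finitely many remaining `n` are handled separately, using absence of extinction in both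
    -- mechanisms.
    · obtain ⟨y, hy⟩ := exists_cdfMax_le (L n) (fun ρ hρ => by
        rw [hL] at hρ
        rcases List.mem_append.1 hρ with h | h
        · rw [List.eq_of_mem_replicate h]; exact ⟨inferInstance, hμ.1⟩
        · rw [List.eq_of_mem_replicate h]; exact ⟨inferInstance, hν⟩) hε
      exact ⟨c n - y, by rwa [sub_sub_cancel]⟩
  · obtain ⟨C, hC, hup⟩ := exists_one_sub_cdfMax_le hθ hπ hπ'
    have hlim : Tendsto (fun A : ℝ => Real.exp (-A) * (Real.exp (θ * B) * C)) atTop (𝓝 0) := by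
      simpa using (Real.tendsto_exp_neg_atTop_nhds_zero).mul_const (Real.exp (θ * B) * C)
    obtain ⟨A, hA, hA0⟩ := ((hlim.eventually (gt_mem_nhds hε)).and (eventually_ge_atTop 0)).exists
    refine ⟨A / θ, fun n => ?_⟩
    -- For `n = 0` the walk sits at zero and `c 0 = 0`, because `Real.log 0 = 0`.
    rcases Nat.eq_zero_or_pos n with rfl | hn
    · have h0 : 0 ≤ A / θ := by positivity
      simp [hL, hc, cdfMax, h0]
    · have hn' : (0 : ℝ) < n := by exact_mod_cast hn
      have hsq : 0 < Real.sqrt n := Real.sqrt_pos.2 hn'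
      have hsum : k n + m n = n := Nat.add_sub_of_le (hkn n)
      rw [hL]
      refine (hup (k n) (m n) (by omega) _).trans ?_
      have h1 : k n * E + m n * E' - θ * (c n + A / θ) ≤ Real.log n / 2 + (θ * B - A) := by
        have h2 : θ * (w n - c n) ≤ θ * B :=
          mul_le_mul_of_nonneg_left (abs_le.1 (hwc n)).2 hθ.le
        rw [mul_add, mul_div_cancel₀ _ hθ.ne']
        rw [mul_sub, hθw] at h2
        linarith
      refine (mul_le_mul' (eexp_le_eexp h1) le_rfl).trans ?_
      rw [hsum, eexp, ← ENNReal.ofReal_mul (Real.exp_pos _).le, Real.exp_add, Real.exp_half,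
        Real.exp_log hn']
      refine ENNReal.ofReal_le_ofReal (le_trans (le_of_eq ?_) hA.le)
      rw [sub_eq_add_neg, Real.exp_add]
      field_simp

theorem stochBounded_interface {Ω : Type*} [MeasurableSpace Ω] (P : Measure Ω)
    [IsProbabilityMeasure P] (μ ν : Measure PointConfig) [IsProbabilityMeasure μ]
    [IsProbabilityMeasure ν] (θμ θν : ℝ) (hμ : Admissible μ θμ) (hν : Admissible ν θν)
    (t : ℝ) (ht : t ∈ Set.Ioo (0 : ℝ) 1) (X : ℕ → List ℕ → Ω → PointConfig)
    (hX : ∀ n, IsBRWi P μ ν t n (X n)) (θ a b : ℝ) (hθ : 0 < θ)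
    (ha : HasKappaDerivAt μ a θ) (hb : HasKappaDerivAt ν b θ)
    (hst : (t * a + (1 - t) * b) * θ = t * (kappa μ θ).toReal + (1 - t) * (kappa ν θ).toReal)
    (h1 : θν < θ) (h2 : θ < θμ) (h3 : θ * a < (kappa μ θ).toReal)
    (h4 : (kappa ν θ).toReal < θ * b) :
    StochBounded P (fun n ω => maxDisplacement (fun u => X n u ω) n -
      (((t * a + (1 - t) * b) * n - 1 / (2 * θ) * Real.log n : ℝ) : EReal)) := by
  obtain ⟨q, hq, hq1, q1, q2, q3, q4, q5, q6⟩ := exists_moment_exponent hμ hν hθ ha hb h1 h2 h3 h4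
  obtain ⟨π, hπ⟩ := exists_isTiltedLaw hμ.breeding.1 hμ.nonLattice ha
  obtain ⟨π', hπ'⟩ := exists_isTiltedLaw hν.breeding.1 hν.nonLattice hb
  -- The finite solution of `M x + z = M y`, available because `κ((1+q)θ) < (1+q)κ(θ)`; it is the
  -- sum of the geometric series of first-phase splits.
  obtain ⟨M, hMt, hM⟩ := exists_ne_top_mul_add_eq (x := laplace μ ((1 + q) * θ))
    (y := eexp ((1 + q) * (kappa μ θ).toReal)) (by
      rw [laplace_eq_ofReal_exp hμ.breeding.1 q1, eexp,
        ENNReal.ofReal_lt_ofReal_iff (Real.exp_pos _)]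
      exact Real.exp_lt_exp.2 q2) (eexp_ne_top _) q5.ne
  have hlam : eexp (q * (kappa ν θ).toReal) * ∫⁻ x, eexp (-(q * θ) * x) ∂π' < 1 := by
    rw [hπ'.laplace_eq, laplace_eq_ofReal_exp hν.breeding.1 q3, ← eexp, ← eexp_add, ← eexp_zero,
      eexp, eexp, ENNReal.ofReal_lt_ofReal_iff (Real.exp_pos _)]
    exact Real.exp_lt_exp.2 (by linarith)
  have hkn (n : ℕ) : ⌊(n : ℝ) * t⌋₊ ≤ n :=
    Nat.floor_le_of_le (mul_le_of_le_one_right (Nat.cast_nonneg n) ht.2.le)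
  have hcdf (n : ℕ) (y : ℝ) : P {ω | maxDisplacement (fun u => X n u ω) n ≤ (y : EReal)} =
      cdfMax (List.replicate ⌊(n : ℝ) * t⌋₊ μ ++ List.replicate (n - ⌊(n : ℝ) * t⌋₊) ν) y := by
    rw [(hX n).measure_maxDisplacement_le, map_range_ite μ ν (hkn n)]
  have hb {ε : ℝ} (hε : 0 < ε) := exists_interface_tail_bounds hμ.breeding hν.breeding.1 hθ hπ hπ'
    hq hq1 hMt hM.le q6 hlam ht hst (fun n => rfl) (fun n => rfl) hε
  refine stochBounded_sub_coe
    (fun n => measurable_maxDisplacement _ n (hX n).measurable) (fun ε hε => ?_) fun ε hε => ?_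
  · simp_rw [hcdf]
    exact (hb hε).1
  · simp_rw [hcdf]
    exact (hb hε).2

end BRW

end


theorem mainTheorem3 {Ω : Type*} [MeasurableSpace Ω] (P : Measure Ω) [IsProbabilityMeasure P]
    (μ ν : Measure BRW.PointConfig) [IsProbabilityMeasure μ] [IsProbabilityMeasure ν]
    (θμ θν : ℝ) (hμ : BRW.Admissible μ θμ) (hν : BRW.Admissible ν θν)
    (t : ℝ) (ht : t ∈ Set.Ioo (0 : ℝ) 1)
    (X : ℕ → List ℕ → Ω → BRW.PointConfig) (hX : ∀ n, BRW.IsBRWi P μ ν t n (X n))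
    (hfast : θν < θμ)
    (θ a b : ℝ) (hθ : 0 < θ)
    (hmin : BRW.interfaceRate μ ν t θ =
      ⨅ φ : Set.Ioi (0 : ℝ), BRW.interfaceRate μ ν t φ)
    (ha : BRW.HasKappaDerivAt μ a θ) (hb : BRW.HasKappaDerivAt ν b θ) :
    t * BRW.speed μ + (1 - t) * BRW.speed ν < t * a + (1 - t) * b ∧
    BRW.StochBounded P (fun n ω =>
      BRW.maxDisplacement (fun u => X n u ω) n -
        (((t * a + (1 - t) * b) * n - 1 / (2 * θ) * Real.log n : ℝ) : EReal)) := by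
  obtain ⟨h1, h2, h3, h4, h5⟩ := BRW.fast_regime_parameters hμ hν ht hfast hθ hmin ha hb
  have hst := BRW.stationary_interfaceRate hμ.breeding.1 hν.breeding.1 hθ hmin ha hb
  exact ⟨h5, BRW.stochBounded_interface P μ ν θμ θν hμ hν t ht X hX θ a b hθ ha hb hst h1 h2 h3 h4⟩
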